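/- For quadratic forms $Q(x_5,x_6,x_7)$, $Q'(x_1,x_2,x_3)$ over $\mathbb C$ and a quadric $\mathcal A=\sum a_{ij}x_ix_j$ (sum over $1\le i\le 4\le j\le 7$, $(i,j)\neq(4,4)$), let $$\Psi_{3,1,3}=Q(x_5,x_6,x_7)(x_1+x_2+x_3+x_4)+Q'(x_1,x_2,x_3)(x_4+x_5+x_6+x_7)+x_4\mathcal A$$ and let $X_{3,1,3}\subset\mathbb P^6_{\mathbb C}$ be the cubic hypersurface $\Psi_{3,1,3}=0$. Let $C\colon Q=x_1=x_2=x_3=x_4=0$, let $C'\colon Q'=x_4=x_5=x_6=x_7=0$, and let $\mathcal S\colon Q=Q'=x_4=x_1+x_2+x_3=x_5+x_6+x_7=\mathcal A=0$. Let $\pi\colon W\to\mathbb P^6$ be the blowup along the reduced closed subscheme $C\cup C'\cup\mathcal S$, and let $Z\subset W$ be the strict transform of $X_{3,1,3}$, i.e. the closure of $\pi^{-1}(X_{3,1,3}\setminus(C\cup C'\cup\mathcal S))$ with its reduced structure. (1) If the coefficients of $Q$, $Q'$ and $\mathcal A$ are generic (i.e. outside the zero set of some fixed nonzero polynomial in these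 coefficients), then $Z$ is a smooth divisor on $W$: it is an effective Cartier divisor on $W$ and it is smooth over $\mathbb C$. (2) Let $D\ge 5$. The double box graph has six vertices and seven edges $1,\dots,7$; two of its vertices are joined by three chains, consisting of the edges $1,2,3$, of the edge $4$, and of the edges $5,6,7$. For masses $m_1,\dots,m_7\in\mathbb C$ and momenta $w_\mu\in\mathbb C^D$ at the vertices with $\sum_\mu w_\mu=0$, its massive second Symanzik polynomial is $\big(\sum_i m_i^2x_i\big)\phi+\psi$, where $\phi$ is the sum of $x_ix_j$ over the pairs of edges whose removal leaves a tree, and $\psi$ is the sum of $\big(\sum_{\mu\in K}w_\mu\big)^2x_ix_jx_k$ over the triples of edges whose removal leaves a forest with exactly two components, $K$ being one of these components and the square referring to the quadratic form $\sum_d z_d^2$ on $\mathbb C^D$. For generic masses and momenta (i.e. for those in some nonempty Zariski open subset of the space of masses and of momenta with sum zero), this polynomial has the form $\Psi_{3,1,3}$ above for some $Q$, $Q'$, $\mathcal A$, and for these $Z$ is a smooth divisor on $W$. -/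

import Mathlib

open CategoryTheory AlgebraicGeometry TopologicalSpace

noncomputable section

namespace DoubleBox

/-! ### Blowups and strict transforms -/

/-- An ideal sheaf is invertible (i.e. its closed subscheme is an effective Cartier divisor) if it
is locally generated by one nonzerodivisor. -/
def IsInvertible {X : Scheme.{0}} (I : X.IdealSheafData) : Prop :=
  ∀ x : X, ∃ U : X.affineOpens, x ∈ U.1 ∧
    ∃ f ∈ nonZeroDivisors Γ(X, U.1), I.ideal U = Ideal.span {f}

/-- `π : W ⟶ X` is the blowup of `X` along the closed subscheme with ideal sheaf `I`: the inverse
image ideal sheaf on `W` is invertible, and `π` is universal among all morphisms of schemes with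
this property. This determines `π` up to a unique isomorphism over `X`. -/
structure IsBlowup {W X : Scheme.{0}} (π : W ⟶ X) (I : X.IdealSheafData) : Prop where
  invertible : IsInvertible (I.comap π)
  existsUnique_lift : ∀ (T : Scheme.{0}) (f : T ⟶ X), IsInvertible (I.comap f) →
    ∃! g : T ⟶ W, g ≫ π = f

/-- The strict transform of the closed set `Y` under `π`, where `B` is the centre of the blowup:
the closure of `π⁻¹(Y ∖ B)`. -/
def strictTransform {W X : Scheme.{0}} (π : W ⟶ X) (B Y : Closeds X) : Closeds W :=
  Closeds.closure (π ⁻¹' ((Y : Set X) \ (B : Set X)))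

/-- The closed subset `Z`, with its reduced structure, is a smooth divisor on the `ℂ`-scheme `W`:
it is an effective Cartier divisor, and it is smooth over `ℂ`. -/
def IsSmoothDivisor {W : Scheme.{0}} (s : W ⟶ Spec (CommRingCat.of ℂ)) (Z : Closeds W) : Prop :=
  IsInvertible (Scheme.IdealSheafData.vanishingIdeal Z) ∧
    Smooth ((Scheme.IdealSheafData.vanishingIdeal Z).subschemeι ≫ s)

/-! ### Projective 6-space over `ℂ` -/

/-- The grading of `ℂ[x₁, …, x₇]` by degree. The variable `xᵢ` is `MvPolynomial.X (i - 1)`. -/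
abbrev grading : ℕ → Submodule ℂ (MvPolynomial (Fin 7) ℂ) :=
  MvPolynomial.homogeneousSubmodule (Fin 7) ℂ

instance : GradedRing grading := MvPolynomial.gradedAlgebra

/-- Projective space `ℙ⁶` over `ℂ`. -/
abbrev P6 : Scheme.{0} := Proj grading

/-- The structure morphism `ℙ⁶ ⟶ Spec ℂ`. -/
def P6.toSpec : P6 ⟶ Spec (CommRingCat.of ℂ) :=
  Proj.toSpecZero grading ≫ Spec.map (CommRingCat.ofHom (algebraMap ℂ (grading 0)))

/-- The closed subset of `ℙ⁶` defined by the vanishing of a set of polynomials. -/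
def zeros (F : Set (MvPolynomial (Fin 7) ℂ)) : Closeds P6 :=
  ⟨ProjectiveSpectrum.zeroLocus grading F, ProjectiveSpectrum.isClosed_zeroLocus grading F⟩

/-! ### The cubic hypersurface and the centre of the blowup -/

/-- The monomials `tᵢ tⱼ`, `i ≤ j`, of degree two in three variables. -/
abbrev QuadIndex : Type := {p : Fin 3 × Fin 3 // p.1 ≤ p.2}

/-- The entries of a `4 × 4` matrix other than the lower left one. -/
abbrev BilinIndex : Type := {p : Fin 4 × Fin 4 // p ≠ (3, 0)}

/-- Index set for the coefficients of the triple `(Q, Q', 𝒜)`, in this order. -/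
abbrev CoeffIndex : Type := QuadIndex ⊕ QuadIndex ⊕ BilinIndex

variable (c : CoeffIndex → ℂ)

/-- The edge variable `xᵢ`, for `i = 1, …, 7`, where the argument is `i - 1`. -/
abbrev x (i : Fin 7) : MvPolynomial (Fin 7) ℂ := MvPolynomial.X i

/-- The quadratic form `Q(x₅, x₆, x₇)`. -/
def Q : MvPolynomial (Fin 7) ℂ :=
  ∑ p : QuadIndex, MvPolynomial.C (c (.inl p)) *
    (x (Fin.natAdd 4 p.1.1) * x (Fin.natAdd 4 p.1.2))

/-- The quadratic form `Q'(x₁, x₂, x₃)`. -/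
def Q' : MvPolynomial (Fin 7) ℂ :=
  ∑ p : QuadIndex, MvPolynomial.C (c (.inr (.inl p))) *
    (x (Fin.castAdd 4 p.1.1) * x (Fin.castAdd 4 p.1.2))

/-- The quadric `𝒜 = ∑ aᵢⱼ xᵢ xⱼ`, the sum over `1 ≤ i ≤ 4 ≤ j ≤ 7` with `(i, j) ≠ (4, 4)`. -/
def A : MvPolynomial (Fin 7) ℂ :=
  ∑ p : BilinIndex, MvPolynomial.C (c (.inr (.inr p))) *
    (x (Fin.castAdd 3 p.1.1) * x (Fin.natAdd 3 p.1.2))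

/-- The cubic form `Ψ₃,₁,₃ = Q (x₁ + x₂ + x₃ + x₄) + Q' (x₄ + x₅ + x₆ + x₇) + x₄ 𝒜`. -/
def Psi : MvPolynomial (Fin 7) ℂ :=
  Q c * (x 0 + x 1 + x 2 + x 3) + Q' c * (x 3 + x 4 + x 5 + x 6) + x 3 * A c

/-- The cubic hypersurface `X₃,₁,₃`. -/
def cubic : Closeds P6 := zeros {Psi c}

/-- The conic `C : Q = x₁ = x₂ = x₃ = x₄ = 0`. -/
def conic : Closeds P6 := zeros {Q c, x 0, x 1, x 2, x 3}

/-- The conic `C' : Q' = x₄ = x₅ = x₆ = x₇ = 0`. -/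
def conic' : Closeds P6 := zeros {Q' c, x 3, x 4, x 5, x 6}

/-- The locus `𝒮 : Q = Q' = x₄ = x₁ + x₂ + x₃ = x₅ + x₆ + x₇ = 𝒜 = 0`. -/
def nodes : Closeds P6 :=
  zeros {Q c, Q' c, x 3, x 0 + x 1 + x 2, x 4 + x 5 + x 6, A c}

/-- The centre of the blowup: the union of `C`, `C'` and `𝒮`. -/
def center : Closeds P6 := conic c ⊔ conic' c ⊔ nodes c

/-- For the blowup `π : W ⟶ ℙ⁶` along the reduced closed subscheme `C ∪ C' ∪ 𝒮`, the strict
transform `Z` of `X₃,₁,₃` is a smooth divisor on `W`. -/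
def StrictTransformIsSmoothDivisor : Prop :=
  ∀ (W : Scheme.{0}) (π : W ⟶ P6),
    IsBlowup π (Scheme.IdealSheafData.vanishingIdeal (center c)) →
      IsSmoothDivisor (π ≫ P6.toSpec) (strictTransform π (center c) (cubic c))

/-! ### The second Symanzik polynomial of the double box graph -/

/-- The edges of the double box graph, on the vertices `0, …, 5`. The vertices `0` and `1` are
joined by three chains, consisting of the edges `1, 2, 3`, the edge `4`, and the edges `5, 6, 7`. -/
def edge : Fin 7 → Sym2 (Fin 6) :=
  ![s(0, 2), s(2, 3), s(3, 1), s(0, 1), s(0, 4), s(4, 5), s(5, 1)]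

/-- The double box graph with the edges in `T` cut. -/
def cutGraph (T : Finset (Fin 7)) : SimpleGraph (Fin 6) :=
  SimpleGraph.fromEdgeSet (edge '' (T : Set (Fin 7))ᶜ)

open Classical in
/-- The first Symanzik polynomial `φ`. -/
def firstSymanzik : MvPolynomial (Fin 7) ℂ :=
  ∑ T ∈ (Finset.powersetCard 2 (Finset.univ : Finset (Fin 7))) with (cutGraph T).IsTree,
    ∏ e ∈ T, x e

/-- A 2-tree: no loops and exactly two connected components. -/
def IsTwoTree (G : SimpleGraph (Fin 6)) : Prop :=
  G.IsAcyclic ∧ Nat.card G.ConnectedComponent = 2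

open Classical in
/-- The square of the sum of the momenta in the connected component of the vertex `0` (if the
graph is a 2-tree and the momenta sum to zero, the other component gives the same). -/
def flowSq {D : ℕ} (w : Fin 6 → Fin D → ℂ) (G : SimpleGraph (Fin 6)) : ℂ :=
  ∑ d : Fin D, (∑ v : Fin 6 with G.Reachable 0 v, w v d) ^ 2

open Classical in
/-- The massless second Symanzik polynomial `ψ`, for the momenta `w`. -/
def masslessSymanzik {D : ℕ} (w : Fin 6 → Fin D → ℂ) : MvPolynomial (Fin 7) ℂ :=
  ∑ T ∈ (Finset.powersetCard 3 (Finset.univ : Finset (Fin 7))) with IsTwoTree (cutGraph T),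
    MvPolynomial.C (flowSq w (cutGraph T)) * ∏ e ∈ T, x e

/-- The massive second Symanzik polynomial `(∑ mᵢ² xᵢ) φ + ψ`. -/
def massiveSymanzik {D : ℕ} (m : Fin 7 → ℂ) (w : Fin 6 → Fin D → ℂ) : MvPolynomial (Fin 7) ℂ :=
  (∑ i : Fin 7, MvPolynomial.C (m i ^ 2) * x i) * firstSymanzik + masslessSymanzik w

/-- The point with coordinates the masses `m` and the components of the momenta `w`. -/
def kinematics {D : ℕ} (m : Fin 7 → ℂ) (w : Fin 6 → Fin D → ℂ) : Fin 7 ⊕ Fin 6 × Fin D → ℂ :=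
  Sum.elim m (fun p => w p.1 p.2)

end DoubleBox

end

/-! ### The Jacobian criterion over an algebraically closed field. -/

noncomputable section

namespace DoubleBox

/-! Write `u = (x₁, x₂, x₃)`, `z = x₄`, `v = (x₅, x₆, x₇)`. For generic coefficients every point of
`𝒮` has `u = 0` or `v = 0`, so `𝒮` lies in `C ∪ C'` and the reduced centre is the disjoint union of
two smooth conics. The symmetry `u ↔ v` exchanges them. It remains to treat the charts `vₖ ≠ 0`,
which meet only `C` (`zeroLocus_conicGens`), and the chart `z ≠ 0`, which misses the centre.

In a chart `vₖ = 1` the ideal of `C` is generated by `u`, `z`, `Q(v)`. The blowup has Cox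
coordinates `s`, `y = (u, z, q)`, `v` with the relation `Q(v) = s q`. The old coordinates are `s u`,
`s z`, `v`, and the affine charts are given by `yⱼ = vₖ = 1`. In these coordinates the cubic becomes
`s²` times a polynomial `cox`, the equation of the strict transform. The abstract blowup is compared
with these algebras through their universal property (`exists_blowup_chart`). By
`isSmoothDivisor_strictTransform` it then suffices that `cox` cuts out something smooth, that `cox`
is a nonzerodivisor, and that `s` is a nonzerodivisor modulo `cox`. Smoothness comes from the
Jacobian criterion (`smooth_of_jacobian`); regularity comes from the same criterion together with
lines inside the zero sets (`IsTransversal.isRegularMod`).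

By the Jacobian criterion a singular point solves a Lagrange system with multiplier `l`
(`IsGenericSide.nonsingular`), and a parameter count excludes this. If the coefficients are
algebraically independent over `ℂ` in a field `F`, a solution would express seven of them rationally
through the others and six further quantities, which contradicts transcendence degree
(`false_of_forall_mem`, `false_of_singular_of_eq_one`); degenerate solutions are handled by smaller
counts. To descend to complex coefficients, suppose no nonzero polynomial forces the conclusion.
Then an ultrafilter carries counterexamples along which the coordinate functions have algebraically
independent germs, and the counterexamples glue over the field of germs
(`exists_ne_zero_of_forall_ultrafilter`, `eventually_isGenericSide`).

For the graph polynomial the coefficients of all `z² uᵢ` and `z² vⱼ` equal `m₄²`, so it is not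
generic among all `Ψ₃,₁,₃`. Hence the count is made for `CubicForm.ofParams`, where these
coefficients may coincide. The remaining coefficients are arbitrary once `D ≥ 5`, because every
complex symmetric `5 × 5` matrix is a Gram matrix in `ℂᴰ` (`exists_symanzikParams_eq`). The
genericity condition therefore pulls back to a nonempty open set of masses and momenta. -/

open MvPolynomial in
/-- A smooth algebra over a field is reduced. -/
theorem isReduced_of_smooth (K S : Type*) [Field K] [CommRing S] [Algebra K S]
    [Algebra.Smooth K S] : IsReduced S := by
  constructor
  intro a ha
  by_contra hne
  have hI : (⊥ : Ideal S).colon (Ideal.span {a} : Set S) ≠ ⊤ := by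
    intro h
    apply hne
    have h1 : (1 : S) ∈ (⊥ : Ideal S).colon (Ideal.span {a} : Set S) := h ▸ trivial
    simpa using Submodule.mem_colon.mp h1 a (Ideal.subset_span rfl)
  obtain ⟨m, hm, hle⟩ := Ideal.exists_le_maximal _ hI
  have := Algebra.smoothLocus_eq_univ (R := K) (A := S)
  have hsm : Algebra.IsSmoothAt K m := by
    have h2 : (⟨m, inferInstance⟩ : PrimeSpectrum S) ∈ Algebra.smoothLocus K S := this ▸ trivial
    exact h2
  -- Near `m` the algebra is étale over a polynomial ring `T`. By flatness `Sf` embeds into its base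
  -- change to the fraction field of `T`, which is unramified over a field and hence reduced.
  obtain ⟨f, hfm, n, _, _, _⟩ := Algebra.IsSmoothAt.exists_isStandardEtale_mvPolynomial
    (R := K) (p := m)
  let T := MvPolynomial (Fin n) K
  let F := FractionRing T
  let Sf := Localization.Away f
  have hred : IsReduced (TensorProduct T F Sf) :=
    Algebra.FormallyUnramified.isReduced_of_field F _
  have hinj : Function.Injective
      (Algebra.TensorProduct.includeRight : Sf →ₐ[T] TensorProduct T F Sf) :=
    Algebra.TensorProduct.includeRight_injective (IsFractionRing.injective T F)
  have h0 : algebraMap S Sf a = 0 := by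
    apply hinj
    rw [map_zero]
    exact ((ha.map (algebraMap S Sf)).map
      (Algebra.TensorProduct.includeRight : Sf →ₐ[T] TensorProduct T F Sf)).eq_zero
  obtain ⟨⟨_, k, rfl⟩, hk⟩ := (IsLocalization.map_eq_zero_iff (Submonoid.powers f) Sf a).mp h0
  refine hfm (‹m.IsMaximal›.isPrime.mem_of_pow_mem k (hle ?_))
  refine Submodule.mem_colon.mpr fun x hx => ?_
  obtain ⟨y, rfl⟩ := Ideal.mem_span_singleton'.mp hx
  simp only [smul_eq_mul, Ideal.mem_bot] at hk ⊢
  linear_combination y * hk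

/-- A matrix with linearly independent rows has a nonzero maximal minor. -/
theorem exists_submatrix_det_ne_zero {K ι σ : Type*} [Field K] [Fintype ι] [DecidableEq ι]
    [Fintype σ] (J : Matrix ι σ K) (h : LinearIndependent K J.row) :
    ∃ a : ι → σ, Function.Injective a ∧ (J.submatrix id a).det ≠ 0 := by
  classical
  obtain ⟨κ, a, ha, hspan, hli⟩ := exists_linearIndependent' K J.col
  have hcol : Submodule.span K (Set.range J.col) = ⊤ := by
    apply Submodule.eq_top_of_finrank_eq
    rw [← Matrix.rank_eq_finrank_span_cols, Module.finrank_fintype_fun_eq_card]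
    exact h.rank_matrix
  rw [hcol] at hspan
  have : Fintype κ := Fintype.ofInjective a ha
  let b := Module.Basis.mk hli hspan.ge
  have hcard : Fintype.card ι = Fintype.card κ := by
    have := Module.finrank_eq_card_basis b
    rwa [Module.finrank_fintype_fun_eq_card] at this
  let e := Fintype.equivOfCardEq hcard
  refine ⟨a ∘ e, ha.comp e.injective, ?_⟩
  have hli' := hli.comp e e.injective
  have hu : IsUnit (J.submatrix id (a ∘ e)) := by
    rw [← Matrix.linearIndependent_cols_iff_isUnit]
    exact hli'
  exact ((Matrix.isUnit_iff_isUnit_det _).mp hu).ne_zero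

open MvPolynomial in
/-- The localization of `K[X] / (g)` at a maximal minor of the Jacobian matrix is smooth. -/
theorem smooth_away_of_minor {K ι σ : Type*} [Field K] [Fintype ι] [DecidableEq ι]
    [Fintype σ] (g : ι → MvPolynomial σ K) (a : ι → σ) (ha : Function.Injective a)
    (d : MvPolynomial σ K) (hd : d = (Matrix.of fun i j => pderiv (a i) (g j)).det) :
    Algebra.Smooth K (Localization.Away
      (Ideal.Quotient.mk (Ideal.span (Set.range g)) d)) := by
  let S := MvPolynomial σ K ⧸ Ideal.span (Set.range g)
  let δ : S := Ideal.Quotient.mk (Ideal.span (Set.range g)) d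
  let P := Algebra.PreSubmersivePresentation.naive (R := K) (v := g) a ha
  let L := Algebra.PreSubmersivePresentation.localizationAway (Localization.Away δ) δ
  have hP : P.jacobian = δ := by
    rw [Algebra.PreSubmersivePresentation.jacobian_eq_jacobiMatrix_det]
    have : P.jacobiMatrix = Matrix.of fun i j => pderiv (a i) (g j) := by
      ext1 i j
      exact Algebra.PreSubmersivePresentation.jacobiMatrix_naive a ha _ _ i j
    rw [this, ← hd]
    rfl
  have hu : IsUnit (L.comp P).jacobian := by
    rw [Algebra.PreSubmersivePresentation.comp_jacobian_eq_jacobian_smul_jacobian,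
      Algebra.PreSubmersivePresentation.localizationAway_jacobian, hP, Algebra.smul_def]
    have := IsLocalization.Away.algebraMap_isUnit (S := Localization.Away δ) δ
    exact this.mul this
  have := (⟨L.comp P, hu⟩ : Algebra.SubmersivePresentation K (Localization.Away δ) _ _)
    |>.isStandardSmooth
  infer_instance

open MvPolynomial in
/-- The Jacobian criterion for complete intersections in affine space. -/
theorem smooth_of_jacobian {K ι σ : Type*} [Field K] [IsAlgClosed K] [Fintype ι]
    [Fintype σ] (g : ι → MvPolynomial σ K)
    (h : ∀ p : σ → K, (∀ i, eval p (g i) = 0) → ∀ c : ι → K,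
      (∀ s, ∑ i, c i * eval p (pderiv s (g i)) = 0) → c = 0) :
    Algebra.Smooth K (MvPolynomial σ K ⧸ Ideal.span (Set.range g)) := by
  classical
  let I := Ideal.span (Set.range g)
  have hfp : Algebra.FinitePresentation K (MvPolynomial σ K ⧸ I) :=
    Algebra.FinitePresentation.quotient ⟨(Set.finite_range g).toFinset, by simp [I]⟩
  refine ⟨?_, hfp⟩
  rw [← Algebra.smoothLocus_eq_univ_iff]
  by_contra hne
  -- The singular locus is closed, so if it is nonempty it contains a closed point. By the
  -- Nullstellensatz this is a point `p` of affine space, where some maximal minor of the Jacobian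
  -- matrix is nonzero.
  have hcl : IsClosed (Algebra.smoothLocus K (MvPolynomial σ K ⧸ I))ᶜ :=
    Algebra.isOpen_smoothLocus.isClosed_compl
  obtain ⟨x, hx⟩ : ((Algebra.smoothLocus K (MvPolynomial σ K ⧸ I))ᶜ).Nonempty :=
    Set.nonempty_compl.mpr hne
  obtain ⟨m, hm, hxm⟩ := Ideal.exists_le_maximal x.asIdeal x.2.ne_top
  have hmem : (⟨m, hm.isPrime⟩ : PrimeSpectrum _) ∈
      (Algebra.smoothLocus K (MvPolynomial σ K ⧸ I))ᶜ :=
    hcl.stableUnderSpecialization ((PrimeSpectrum.le_iff_specializes _ _).mp hxm) hx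
  apply hmem
  have hmax := Ideal.comap_isMaximal_of_surjective (Ideal.Quotient.mk I)
    Ideal.Quotient.mk_surjective (K := m)
  obtain ⟨p, hp⟩ := MvPolynomial.isMaximal_iff_eq_vanishingIdeal_singleton.mp hmax
  have hval : ∀ q : MvPolynomial σ K, Ideal.Quotient.mk I q ∈ m ↔ eval p q = 0 := by
    intro q
    rw [← Ideal.mem_comap, hp, mem_vanishingIdeal_singleton_iff]
    simp [aeval_eq_eval]
  have hg : ∀ i, eval p (g i) = 0 := fun i => by
    have h0 : Ideal.Quotient.mk I (g i) = 0 :=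
      Ideal.Quotient.eq_zero_iff_mem.mpr (Ideal.subset_span ⟨i, rfl⟩)
    rw [← hval, h0]
    exact zero_mem _
  let J : Matrix ι σ K := Matrix.of fun i s => eval p (pderiv s (g i))
  obtain ⟨a, ha, hdet⟩ := exists_submatrix_det_ne_zero J (by
    rw [Fintype.linearIndependent_iff]
    intro c hc i
    refine congrFun (h p hg c fun s => ?_) i
    simpa [J, Matrix.row] using congrFun hc s)
  set d := (Matrix.of fun i j => pderiv (a i) (g j)).det with hd
  have hsm := smooth_away_of_minor g a ha d hd
  rw [← Algebra.basicOpen_subset_smoothLocus_iff_smooth] at hsm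
  refine hsm ?_
  change Ideal.Quotient.mk I d ∉ m
  rw [hval, hd, RingHom.map_det, ← Matrix.det_transpose]
  exact hdet

/-- If `g` satisfies the Jacobian criterion, the ideal generated by `g` is determined by its
zeros. -/
theorem mem_span_of_jacobian {K ι σ : Type*} [Field K] [IsAlgClosed K] [Fintype ι]
    [Fintype σ] (g : ι → MvPolynomial σ K)
    (h : ∀ p : σ → K, (∀ i, MvPolynomial.eval p (g i) = 0) → ∀ c : ι → K,
      (∀ s, ∑ i, c i * MvPolynomial.eval p (MvPolynomial.pderiv s (g i)) = 0) → c = 0)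
    (f : MvPolynomial σ K)
    (hf : ∀ p, (∀ i, MvPolynomial.eval p (g i) = 0) → MvPolynomial.eval p f = 0) :
    f ∈ Ideal.span (Set.range g) := by
  have := smooth_of_jacobian g h
  have hred := isReduced_of_smooth K (MvPolynomial σ K ⧸ Ideal.span (Set.range g))
  have hrad := (Ideal.isRadical_iff_quotient_reduced _).mpr hred
  rw [← hrad.radical, ← MvPolynomial.vanishingIdeal_zeroLocus_eq_radical (K := K)]
  intro p hp
  have := hf p fun i => by
    have := (MvPolynomial.mem_zeroLocus_iff.mp hp) (g i) (Ideal.subset_span ⟨i, rfl⟩)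
    simpa [MvPolynomial.aeval_eq_eval] using this
  simpa [MvPolynomial.aeval_eq_eval] using this

/-! ### Nonzerodivisors modulo an ideal. -/

/-- `x` is a nonzerodivisor modulo the ideal `I`. -/
def IsRegularMod {P : Type*} [CommRing P] (I : Ideal P) (x : P) : Prop :=
  ∀ a, x * a ∈ I → a ∈ I

/-- Two elements of a regular sequence may be interchanged. -/
theorem IsRegularMod.swap {P : Type*} [CommRing P] {I : Ideal P} {x y : P}
    (hx : IsRegularMod I x) (hy : IsRegularMod (I ⊔ Ideal.span {x}) y) :
    IsRegularMod (I ⊔ Ideal.span {y}) x := by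
  intro a ha
  obtain ⟨i, hi, _, h1, e⟩ := Submodule.mem_sup.mp ha
  obtain ⟨h, rfl⟩ := Ideal.mem_span_singleton'.mp h1
  have h2 : y * h ∈ I ⊔ Ideal.span {x} := by
    have : y * h = (-i) + a * x := by linear_combination e
    rw [this]
    exact Submodule.mem_sup.mpr ⟨_, neg_mem hi, _, Ideal.mem_span_singleton'.mpr ⟨a, rfl⟩, rfl⟩
  obtain ⟨i', hi', _, h3, e'⟩ := Submodule.mem_sup.mp (hy h h2)
  obtain ⟨h', rfl⟩ := Ideal.mem_span_singleton'.mp h3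
  have h4 : a - h' * y ∈ I := by
    apply hx
    have : x * (a - h' * y) = i + y * i' := by linear_combination -e - y * e'
    rw [this]
    exact I.add_mem hi (I.mul_mem_left _ hi')
  exact Submodule.mem_sup.mpr ⟨_, h4, _, Ideal.mem_span_singleton'.mpr ⟨h', rfl⟩, by ring⟩

open Polynomial in
/-- If the product of two polynomials vanishes on a line, and one of them does not, then the
other one does. -/
theorem eval_eq_zero_of_line {K σ : Type*} [Field K] [Infinite K] {f a : MvPolynomial σ K}
    {p q : σ → K} (hf : MvPolynomial.eval q f ≠ 0)
    (h : ∀ t : K, MvPolynomial.eval (fun i => p i + t * (q i - p i)) f *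
      MvPolynomial.eval (fun i => p i + t * (q i - p i)) a = 0) :
    MvPolynomial.eval p a = 0 := by
  -- Restriction to the line through `p` (at `t = 0`) and `q` (at `t = 1`); the target is a domain.
  let φ : MvPolynomial σ K →ₐ[K] K[X] :=
    MvPolynomial.aeval fun i => Polynomial.C (p i) + Polynomial.X * Polynomial.C (q i - p i)
  have hφ : ∀ t (b : MvPolynomial σ K), (φ b).eval t =
      MvPolynomial.eval (fun i => p i + t * (q i - p i)) b := by
    intro t b
    have h1 : (Polynomial.aeval t).comp φ =
        MvPolynomial.aeval fun i => p i + t * (q i - p i) := by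
      ext i
      simp [φ]
    have h2 := DFunLike.congr_fun h1 b
    simpa [MvPolynomial.aeval_eq_eval] using h2
  have h0 : φ f * φ a = 0 := by
    apply Polynomial.funext
    intro t
    rw [Polynomial.eval_mul, hφ, hφ, h, Polynomial.eval_zero]
  rcases mul_eq_zero.mp h0 with h1 | h1
  · refine absurd ?_ hf
    have := hφ 1 f
    rw [h1] at this
    simpa using this.symm
  · have := hφ 0 a
    rw [h1] at this
    simpa using this.symm

/-! ### Ideal sheaves on affine schemes -/

/-- The ideal of `R` corresponding to an ideal sheaf on `Spec R`. -/
def globalIdeal {R : CommRingCat.{0}} (J : (Spec R).IdealSheafData) : Ideal R :=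
  (J.ideal ⟨⊤, isAffineOpen_top _⟩).comap (Scheme.ΓSpecIso R).inv.hom

theorem le_of_globalIdeal_le {R : CommRingCat.{0}} {J K : (Spec R).IdealSheafData}
    (h : globalIdeal J ≤ globalIdeal K) : J ≤ K := by
  apply Scheme.IdealSheafData.le_of_isAffine
  intro x hx
  have h1 : (Scheme.ΓSpecIso R).inv.hom ((Scheme.ΓSpecIso R).hom.hom x) = x := by
    rw [← CommRingCat.comp_apply, Iso.hom_inv_id, CommRingCat.id_apply]
  have h2 : (Scheme.ΓSpecIso R).hom.hom x ∈ globalIdeal J := by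
    rw [globalIdeal, Ideal.mem_comap, h1]
    exact hx
  have h3 := h h2
  rwa [globalIdeal, Ideal.mem_comap, h1] at h3

theorem globalIdeal_mono {R : CommRingCat.{0}} {J K : (Spec R).IdealSheafData}
    (h : J ≤ K) : globalIdeal J ≤ globalIdeal K :=
  Ideal.comap_mono (h _)

theorem exists_globalIdeal_eq {R : CommRingCat.{0}} (I : Ideal R) :
    ∃ J : (Spec R).IdealSheafData, globalIdeal J = I := by
  refine ⟨(Scheme.IdealSheafData.equivOfIsAffine (X := Spec R)).symm
    (I.comap (Scheme.ΓSpecIso R).hom.hom), ?_⟩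
  have h := (Scheme.IdealSheafData.equivOfIsAffine (X := Spec R)).apply_symm_apply
    (I.comap (Scheme.ΓSpecIso R).hom.hom)
  rw [Scheme.IdealSheafData.equivOfIsAffine_apply] at h
  rw [globalIdeal, h, Ideal.comap_comap, ← CommRingCat.hom_comp, Iso.inv_hom_id]
  exact Ideal.comap_id I

theorem globalIdeal_map {R S : CommRingCat.{0}} (φ : R ⟶ S) (K : (Spec S).IdealSheafData) :
    globalIdeal (K.map (Spec.map φ)) = (globalIdeal K).comap φ.hom := by
  rw [globalIdeal, Scheme.IdealSheafData.ideal_map_of_isAffineHom, Ideal.comap_comap, globalIdeal,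
    Ideal.comap_comap, ← CommRingCat.hom_comp, ← CommRingCat.hom_comp]
  rw [Scheme.ΓSpecIso_inv_naturality]
  rfl

/-- Pullback of ideal sheaves is left adjoint to pushforward, as extension of ideals is to
contraction. The right adjoints correspond by `globalIdeal_map`, hence so do the left ones. -/
theorem globalIdeal_comap {R S : CommRingCat.{0}} (φ : R ⟶ S) (J : (Spec R).IdealSheafData) :
    globalIdeal (J.comap (Spec.map φ)) = (globalIdeal J).map φ.hom := by
  have hgc := Scheme.IdealSheafData.map_gc (Spec.map φ)
  apply le_antisymm
  · obtain ⟨K, hK⟩ := exists_globalIdeal_eq ((globalIdeal J).map φ.hom)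
    rw [← hK]
    apply globalIdeal_mono
    apply (hgc _ _).mpr
    apply le_of_globalIdeal_le
    rw [globalIdeal_map, hK]
    exact Ideal.le_comap_map
  · rw [Ideal.map_le_iff_le_comap, ← globalIdeal_map]
    exact globalIdeal_mono ((hgc _ _).mp le_rfl)

theorem globalIdeal_comap_openImmersion {X : Scheme.{0}} {A : CommRingCat.{0}} (ι : Spec A ⟶ X)
    [IsOpenImmersion ι] (I : X.IdealSheafData) :
    globalIdeal (I.comap ι) =
      (I.ideal ⟨ι ''ᵁ ⊤, (isAffineOpen_top _).image_of_isOpenImmersion ι⟩).comap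
        ((Scheme.ΓSpecIso A).symm ≪≫ (ι.appIso ⊤).symm).hom.hom := by
  rw [globalIdeal, Scheme.IdealSheafData.ideal_comap_of_isOpenImmersion, Ideal.comap_comap]
  rfl

theorem exists_span_comap_iff {A B : CommRingCat.{0}} (e : A ≅ B) (I : Ideal B) :
    (∃ f ∈ nonZeroDivisors B, I = Ideal.span {f}) ↔
      ∃ f ∈ nonZeroDivisors A, I.comap e.hom.hom = Ideal.span {f} := by
  let E := e.commRingCatIsoToRingEquiv
  have hE : I.comap e.hom.hom = I.comap E := rfl
  rw [hE]
  constructor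
  · rintro ⟨f, hf, rfl⟩
    refine ⟨E.symm f, ?_, ?_⟩
    · exact (MulEquivClass.map_nonZeroDivisors E.symm ▸ Submonoid.mem_map_of_mem E.symm hf :)
    · rw [← Ideal.map_symm, Ideal.map_span, Set.image_singleton]
  · rintro ⟨f, hf, h⟩
    refine ⟨E f, ?_, ?_⟩
    · exact (MulEquivClass.map_nonZeroDivisors E ▸ Submonoid.mem_map_of_mem E hf :)
    · rw [← Set.image_singleton, ← Ideal.map_span, ← h, Ideal.map_comap_of_surjective _ E.surjective]

/-- Invertibility can be checked on an affine open cover. -/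
theorem isInvertible_of_cover {X : Scheme.{0}} (I : X.IdealSheafData)
    (h : ∀ x : X, ∃ (A : CommRingCat.{0}) (ι : Spec A ⟶ X) (_ : IsOpenImmersion ι),
      x ∈ Set.range ι ∧ ∃ f ∈ nonZeroDivisors A, globalIdeal (I.comap ι) = Ideal.span {f}) :
    IsInvertible I := by
  intro x
  obtain ⟨A, ι, _, ⟨y, rfl⟩, hf⟩ := h x
  refine ⟨⟨ι ''ᵁ ⊤, (isAffineOpen_top _).image_of_isOpenImmersion ι⟩, ⟨y, trivial, rfl⟩, ?_⟩
  rw [globalIdeal_comap_openImmersion] at hf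
  exact (exists_span_comap_iff _ _).mpr hf

theorem isInvertible_of_globalIdeal {A : CommRingCat.{0}} (J : (Spec A).IdealSheafData) (f : A)
    (hf : f ∈ nonZeroDivisors A) (h : globalIdeal J = Ideal.span {f}) : IsInvertible J :=
  isInvertible_of_cover J fun x =>
    ⟨A, 𝟙 _, inferInstance, ⟨x, rfl⟩, f, hf, by rwa [Scheme.IdealSheafData.comap_id]⟩

theorem map_away_mem_nonZeroDivisors {A : CommRingCat.{0}} (g f : A)
    (hf : f ∈ nonZeroDivisors A) :
    algebraMap A (Localization.Away g) f ∈ nonZeroDivisors (Localization.Away g) :=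
  IsLocalization.map_nonZeroDivisors_le (Submonoid.powers g) _ (Submonoid.mem_map_of_mem _ hf)

/-- The basic open subset `D(g)` of an affine chart, as an affine chart. -/
abbrev awayMap {A : CommRingCat.{0}} (g : A) : A ⟶ CommRingCat.of (Localization.Away g) :=
  CommRingCat.ofHom (algebraMap A (Localization.Away g))

instance {A : CommRingCat.{0}} (g : A) : IsOpenImmersion (Spec.map (awayMap g)) :=
  IsOpenImmersion.of_isLocalization g

theorem range_SpecMap_awayMap {A : CommRingCat.{0}} (g : A) :
    Set.range (Spec.map (awayMap g)) = (PrimeSpectrum.basicOpen g : Set (PrimeSpectrum A)) :=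
  PrimeSpectrum.localization_away_comap_range _ g

/-- An invertible ideal sheaf is generated by a nonzerodivisor in an affine chart around any
point, contained in a given open set. -/
theorem IsInvertible.exists_chart {X : Scheme.{0}} {I : X.IdealSheafData} (hI : IsInvertible I)
    (x : X) (O : X.Opens) (hx : x ∈ O) :
    ∃ (A : CommRingCat.{0}) (ι : Spec A ⟶ X) (_ : IsOpenImmersion ι),
      x ∈ Set.range ι ∧ Set.range ι ⊆ O ∧
        ∃ f ∈ nonZeroDivisors A, globalIdeal (I.comap ι) = Ideal.span {f} := by
  obtain ⟨U, hxU, hf⟩ := hI x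
  let A := Γ(X, U.1)
  let ι : Spec A ⟶ X := U.2.fromSpec
  have hι : IsOpenImmersion ι := U.2.isOpenImmersion_fromSpec
  have hU : (⟨ι ''ᵁ ⊤, (isAffineOpen_top _).image_of_isOpenImmersion ι⟩ : X.affineOpens) = U := by
    apply Subtype.ext
    apply Opens.ext
    change ι '' Set.univ = _
    rw [Set.image_univ]
    exact U.2.range_fromSpec
  obtain ⟨y, rfl⟩ : x ∈ Set.range ι := by
    rw [show Set.range ι = _ from U.2.range_fromSpec]
    exact hxU
  have hf' : ∃ f ∈ nonZeroDivisors A, globalIdeal (I.comap ι) = Ideal.span {f} := by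
    have hf' : ∃ f ∈ nonZeroDivisors Γ(X, ι ''ᵁ ⊤), I.ideal ⟨ι ''ᵁ ⊤,
        (isAffineOpen_top _).image_of_isOpenImmersion ι⟩ = Ideal.span {f} := by
      let T : X.affineOpens → Prop := fun V => ∃ f ∈ nonZeroDivisors Γ(X, V.1),
        I.ideal V = Ideal.span {f}
      exact (congrArg T hU).mpr hf
    rw [globalIdeal_comap_openImmersion]
    exact (exists_span_comap_iff _ _).mp hf'
  obtain ⟨f, hf, hIf⟩ := hf'
  obtain ⟨_, ⟨_, ⟨g, rfl⟩, rfl⟩, hyg, hgO⟩ := PrimeSpectrum.isBasis_basic_opens.exists_subset_of_mem_open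
    (show y ∈ (ι ⁻¹ᵁ O : Set _) from hx) (ι ⁻¹ᵁ O).2
  refine ⟨.of (Localization.Away g), Spec.map (awayMap g) ≫ ι, inferInstance, ?_, ?_,
    algebraMap A _ f, map_away_mem_nonZeroDivisors g f hf, ?_⟩
  · rw [← range_SpecMap_awayMap] at hyg
    obtain ⟨w, rfl⟩ := hyg
    exact ⟨w, rfl⟩
  · rintro _ ⟨w, rfl⟩
    apply hgO
    rw [← range_SpecMap_awayMap]
    exact ⟨w, rfl⟩
  · rw [Scheme.IdealSheafData.comap_comp, globalIdeal_comap, hIf, Ideal.map_span,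
      Set.image_singleton]
    rfl

/-! ### Charts of a blowup -/

/-- A criterion for `B[1/b] ≅ A[1/b]`, for a `B`-algebra `A`. -/
theorem isLocalization_away_of_section {B A : Type} [CommRing B] [CommRing A] (χ : B →+* A) (b : B)
    (ε : A →+* Localization.Away b) (hε : ε.comp χ = algebraMap B (Localization.Away b))
    (hα : ∀ α : Localization.Away b →+* Localization.Away (χ b),
      α.comp (algebraMap B _) = (algebraMap A _).comp χ → α.comp ε = algebraMap A _) :
    @IsLocalization.Away B _ b (Localization.Away (χ b)) _
      ((algebraMap A (Localization.Away (χ b))).comp χ).toAlgebra := by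
  let := ((algebraMap A (Localization.Away (χ b))).comp χ).toAlgebra
  have hu : IsUnit (((algebraMap A (Localization.Away (χ b))).comp χ) b) :=
    IsLocalization.Away.algebraMap_isUnit (S := Localization.Away (χ b)) (χ b)
  let α := Localization.awayLift ((algebraMap A (Localization.Away (χ b))).comp χ) b hu
  have hαB : ∀ t, α (algebraMap B _ t) = algebraMap A (Localization.Away (χ b)) (χ t) :=
    fun t => IsLocalization.Away.lift_eq b hu t
  have hεb : IsUnit (ε (χ b)) := by
    have : ε (χ b) = algebraMap B (Localization.Away b) b := DFunLike.congr_fun hε b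
    rw [this]
    exact IsLocalization.Away.algebraMap_isUnit (S := Localization.Away b) b
  let β : Localization.Away (χ b) →+* Localization.Away b := Localization.awayLift ε (χ b) hεb
  have hβA : ∀ t, β (algebraMap A _ t) = ε t := fun t => IsLocalization.Away.lift_eq (χ b) hεb t
  have hβα : β.comp α = RingHom.id _ := by
    apply IsLocalization.ringHom_ext (Submonoid.powers b)
    ext t
    simp only [RingHom.comp_apply, RingHom.id_apply, hαB, hβA]
    exact DFunLike.congr_fun hε t
  have hαβ : α.comp β = RingHom.id _ := by
    apply IsLocalization.ringHom_ext (Submonoid.powers (χ b))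
    ext t
    simp only [RingHom.comp_apply, RingHom.id_apply, hβA]
    exact DFunLike.congr_fun (hα α (RingHom.ext hαB)) t
  let E : Localization.Away b ≃ₐ[B] Localization.Away (χ b) :=
    { RingEquiv.ofRingHom α β hαβ hβα with
      commutes' := hαB }
  exact IsLocalization.isLocalization_of_algEquiv (Submonoid.powers b) E

/-- If the inverse image of the ideal generated by the `f j` is invertible, then locally one of the
`f j` generates it. -/
theorem exists_chart_generator {W X : Scheme.{0}} {π : W ⟶ X} {I : X.IdealSheafData}
    (hI' : IsInvertible (I.comap π)) {R : CommRingCat.{0}} (u : Spec R ⟶ X) [IsOpenImmersion u]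
    {J : Type} (f : J → R) (hI : globalIdeal (I.comap u) = Ideal.span (Set.range f))
    (x : W) (hx : π x ∈ Set.range u) :
    ∃ (j : J) (A : CommRingCat.{0}) (ι : Spec A ⟶ W) (ψ : R ⟶ A), IsOpenImmersion ι ∧
      x ∈ Set.range ι ∧ ι ≫ π = Spec.map ψ ≫ u ∧ ψ (f j) ∈ nonZeroDivisors A ∧
        ∀ i, ψ (f j) ∣ ψ (f i) := by
  obtain ⟨A₀, ι₀, _, ⟨y, hy⟩, hO, a, ha, hIa⟩ :=
    hI'.exists_chart x (π ⁻¹ᵁ u.opensRange) hx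
  have hr : Set.range (ι₀ ≫ π) ⊆ Set.range u := by
    rintro _ ⟨w, rfl⟩
    exact hO ⟨w, rfl⟩
  let ψ₀ : R ⟶ A₀ := Spec.preimage (IsOpenImmersion.lift u (ι₀ ≫ π) hr)
  have hψ₀ : ι₀ ≫ π = Spec.map ψ₀ ≫ u := by
    rw [Spec.map_preimage, IsOpenImmersion.lift_fac]
  have hspan : Ideal.span (Set.range fun i => ψ₀ (f i)) = Ideal.span {a} := by
    rw [← hIa, ← Scheme.IdealSheafData.comap_comp, hψ₀, Scheme.IdealSheafData.comap_comp,
      globalIdeal_comap, hI, Ideal.map_span, ← Set.range_comp]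
    rfl
  have hd : ∀ i, ∃ d, d * a = ψ₀ (f i) := fun i => by
    rw [← Ideal.mem_span_singleton', ← hspan]
    exact Ideal.subset_span ⟨i, rfl⟩
  choose d hd using hd
  -- The ideals `(a)` and `(a)(dᵢ)` agree and `a` is a nonzerodivisor, so the `dᵢ` generate the unit
  -- ideal. Some `d j` is then invertible near the point, and there `f j` generates.
  have hd1 : Ideal.span (Set.range d) = ⊤ := by
    have h1 : a ∈ Ideal.span {a} * Ideal.span (Set.range d) := by
      have h2 : Ideal.span {a} ≤ Ideal.span {a} * Ideal.span (Set.range d) := by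
        rw [← hspan, hspan, Ideal.span_mul_span', ← hspan, Ideal.span_le]
        rintro _ ⟨i, rfl⟩
        refine Ideal.subset_span ⟨a, rfl, d i, ⟨i, rfl⟩, ?_⟩
        exact (mul_comm _ _).trans (hd i)
      exact h2 (Ideal.subset_span rfl)
    obtain ⟨e, he, hae⟩ := Ideal.mem_span_singleton_mul.mp h1
    have h3 : e = 1 := by
      have h4 : a * (e - 1) = 0 := by rw [mul_sub, hae, mul_one, sub_self]
      rw [← sub_eq_zero]
      exact (mul_left_mem_nonZeroDivisors_eq_zero_iff ha).mp h4
    rw [Ideal.eq_top_iff_one]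
    exact h3 ▸ he
  obtain ⟨j, hj⟩ : ∃ j, d j ∉ y.asIdeal := by
    by_contra! hcon
    apply y.2.ne_top
    rw [← top_le_iff, ← hd1, Ideal.span_le]
    rintro _ ⟨i, rfl⟩
    exact hcon i
  let A₁ := CommRingCat.of (Localization.Away (d j))
  let ι₁ : Spec A₁ ⟶ W := Spec.map (awayMap (d j)) ≫ ι₀
  let ψ₁ : R ⟶ A₁ := ψ₀ ≫ awayMap (d j)
  have hψ₁ : ι₁ ≫ π = Spec.map ψ₁ ≫ u := by
    simp only [ι₁, ψ₁, Category.assoc, hψ₀, Spec.map_comp]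
  have hu : IsUnit (awayMap (d j) (d j)) :=
    IsLocalization.Away.algebraMap_isUnit (S := Localization.Away (d j)) (d j)
  have hψf : ∀ i, ψ₁ (f i) = awayMap (d j) (d i) * awayMap (d j) a := fun i => by
    rw [← map_mul, hd]
    rfl
  have ha₁ : awayMap (d j) a ∈ nonZeroDivisors A₁ := map_away_mem_nonZeroDivisors (d j) a ha
  have hreg₁ : ψ₁ (f j) ∈ nonZeroDivisors A₁ := by
    rw [hψf]
    exact mul_mem hu.mem_nonZeroDivisors ha₁
  have hdvd₁ : ∀ i, ψ₁ (f j) ∣ ψ₁ (f i) := fun i => by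
    rw [hψf, hψf]
    exact mul_dvd_mul hu.dvd dvd_rfl
  obtain ⟨y₁, hy₁⟩ : y ∈ Set.range (Spec.map (awayMap (d j))) := by
    rw [range_SpecMap_awayMap]
    exact hj
  refine ⟨j, A₁, ι₁, ψ₁, inferInstance, ⟨y₁, ?_⟩, hψ₁, hreg₁, hdvd₁⟩
  rw [Scheme.Hom.comp_apply, hy₁, hy]

/-- The charts of a blowup. If the centre is given in an affine chart `Spec R` by the ideal
generated by the `f j`, and the `R`-algebra `B j` is universal among the `R`-algebras in which
`f j` is a nonzerodivisor dividing all the `f i`, then the blowup is covered, over `Spec R`, by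
open subschemes of the `Spec (B j)`. -/
theorem exists_blowup_chart {W X : Scheme.{0}} {π : W ⟶ X} {I : X.IdealSheafData}
    (hπ : IsBlowup π I) {R : CommRingCat.{0}} (u : Spec R ⟶ X) [IsOpenImmersion u]
    {J : Type} (f : J → R) (hI : globalIdeal (I.comap u) = Ideal.span (Set.range f))
    (B : J → CommRingCat.{0}) (φ : ∀ j, R ⟶ B j)
    (hreg : ∀ j, φ j (f j) ∈ nonZeroDivisors (B j)) (hdvd : ∀ j i, φ j (f j) ∣ φ j (f i))
    (hex : ∀ j (A : CommRingCat.{0}) (ψ : R ⟶ A), ψ (f j) ∈ nonZeroDivisors A →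
      (∀ i, ψ (f j) ∣ ψ (f i)) → ∃ χ : B j ⟶ A, φ j ≫ χ = ψ)
    (huniq : ∀ j (A : CommRingCat.{0}) (χ χ' : B j ⟶ A), φ j ≫ χ = φ j ≫ χ' →
      χ (φ j (f j)) ∈ nonZeroDivisors A → χ = χ')
    (x : W) (hx : π x ∈ Set.range u) :
    ∃ (j : J) (A : CommRingCat.{0}) (ι : Spec A ⟶ W) (χ : B j ⟶ A) (b : B j),
      IsOpenImmersion ι ∧ x ∈ Set.range ι ∧ (@IsLocalization.Away (B j) _ b A _ χ.hom.toAlgebra) ∧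
        ι ≫ π = Spec.map (φ j ≫ χ) ≫ u := by
  obtain ⟨j, A₁, ι₁, ψ₁, _, ⟨y₁, rfl⟩, hψ₁, hreg₁, hdvd₁⟩ :=
    exists_chart_generator hπ.invertible u f hI x hx
  obtain ⟨χ₁, hχ₁⟩ := hex j A₁ ψ₁ hreg₁ hdvd₁
  -- the map from the model to the blowup
  have hinv : ∀ {S : CommRingCat.{0}} (θ : R ⟶ S), θ (f j) ∈ nonZeroDivisors S →
      (∀ i, θ (f j) ∣ θ (f i)) → IsInvertible (I.comap (Spec.map θ ≫ u)) := by
    intro S θ h1 h2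
    refine isInvertible_of_globalIdeal _ _ h1 ?_
    rw [Scheme.IdealSheafData.comap_comp, globalIdeal_comap, hI, Ideal.map_span]
    apply le_antisymm
    · rw [Ideal.span_le]
      rintro _ ⟨_, ⟨i, rfl⟩, rfl⟩
      exact Ideal.mem_span_singleton.mpr (h2 i)
    · rw [Ideal.span_singleton_le_iff_mem]
      exact Ideal.subset_span ⟨_, ⟨j, rfl⟩, rfl⟩
  obtain ⟨h, hh, -⟩ := hπ.existsUnique_lift _ _ (hinv (φ j) (hreg j) (hdvd j))
  -- Two lifts of the same morphism to the base agree by uniqueness in the universal property.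
  have hιh : Spec.map χ₁ ≫ h = ι₁ := by
    refine (hπ.existsUnique_lift _ _ (hinv ψ₁ hreg₁ hdvd₁)).unique ?_ hψ₁
    rw [Category.assoc, hh, ← Category.assoc, ← Spec.map_comp, hχ₁]
  -- a basic open subset of the model that maps into the chart
  obtain ⟨_, ⟨_, ⟨b, rfl⟩, rfl⟩, hyb, hbO⟩ := PrimeSpectrum.isBasis_basic_opens.exists_subset_of_mem_open
    (show Spec.map χ₁ y₁ ∈ (h ⁻¹ᵁ ι₁.opensRange : Set _) from by
      change h (Spec.map χ₁ y₁) ∈ Set.range ι₁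
      rw [← hιh]
      exact ⟨y₁, rfl⟩) (h ⁻¹ᵁ ι₁.opensRange).2
  have hrb : Set.range (Spec.map (awayMap b) ≫ h) ⊆ Set.range ι₁ := by
    rintro _ ⟨w, rfl⟩
    refine hbO ?_
    rw [← range_SpecMap_awayMap]
    exact ⟨w, rfl⟩
  let ε : A₁ ⟶ .of (Localization.Away b) := Spec.preimage (IsOpenImmersion.lift ι₁ _ hrb)
  have hε : Spec.map ε ≫ ι₁ = Spec.map (awayMap b) ≫ h := by
    rw [Spec.map_preimage, IsOpenImmersion.lift_fac]
  -- The two maps agree on `R`, and `f j` stays a nonzerodivisor, so uniqueness for maps out of `B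
  -- j` applies.
  have hχε : χ₁ ≫ ε = awayMap b := by
    refine huniq j _ _ _ ?_ ?_
    · rw [← Spec.map_inj, ← cancel_mono u, Spec.map_comp, Spec.map_comp (φ j) (awayMap b),
        Category.assoc, Category.assoc, ← hh, Spec.map_comp, Category.assoc,
        reassoc_of% hιh, reassoc_of% hε]
    · have h1 : φ j ≫ χ₁ ≫ ε = φ j ≫ awayMap b := by
        rw [← Spec.map_inj, ← cancel_mono u, Spec.map_comp, Spec.map_comp (φ j) (awayMap b),
          Category.assoc, Category.assoc, ← hh, Spec.map_comp, Category.assoc,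
          reassoc_of% hιh, reassoc_of% hε]
      have h2 : (χ₁ ≫ ε) (φ j (f j)) = awayMap b (φ j (f j)) :=
        congrArg (fun k : R ⟶ _ => k (f j)) h1
      rw [h2]
      exact map_away_mem_nonZeroDivisors b _ (hreg j)
  -- the corresponding chart of `W`
  let A₂ := CommRingCat.of (Localization.Away (χ₁ b))
  let χ₂ : B j ⟶ A₂ := χ₁ ≫ awayMap (χ₁ b)
  refine ⟨j, A₂, Spec.map (awayMap (χ₁ b)) ≫ ι₁, χ₂, b, inferInstance, ?_, ?_, ?_⟩
  · obtain ⟨y₂, hy₂⟩ : y₁ ∈ Set.range (Spec.map (awayMap (χ₁ b))) := by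
      rw [range_SpecMap_awayMap]
      exact hyb
    refine ⟨y₂, ?_⟩
    rw [Scheme.Hom.comp_apply, hy₂]
  · -- `B[1/b] ≅ A₂`
    refine isLocalization_away_of_section χ₁.hom b ε.hom (congrArg CommRingCat.Hom.hom hχε)
      fun α hα => ?_
    have hα' : awayMap b ≫ CommRingCat.ofHom α = χ₂ := CommRingCat.hom_ext hα
    have hεα : ε ≫ CommRingCat.ofHom α = awayMap (χ₁ b) := by
      rw [← Spec.map_inj, ← cancel_mono ι₁, Spec.map_comp, Category.assoc, hε,
        ← Category.assoc, ← Spec.map_comp, hα', Spec.map_comp, Category.assoc, hιh]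
    exact congrArg CommRingCat.Hom.hom hεα
  · simp only [χ₂, Category.assoc, hψ₁, Spec.map_comp]
    rw [← hχ₁, Spec.map_comp, Category.assoc]

/-! ### Reduced closed subschemes -/

theorem comap_vanishingIdeal_of_bijective {R S : Type*} [CommRing R] [CommRing S] (e : R →+* S)
    (he : Function.Bijective e) (Z : Set (PrimeSpectrum R)) :
    (PrimeSpectrum.vanishingIdeal (PrimeSpectrum.comap e ⁻¹' Z)).comap e =
      PrimeSpectrum.vanishingIdeal Z := by
  ext r
  simp only [Ideal.mem_comap, PrimeSpectrum.mem_vanishingIdeal]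
  constructor
  · intro h p hp
    obtain ⟨q, rfl⟩ := (PrimeSpectrum.homeomorphOfRingEquiv (RingEquiv.ofBijective e he)).symm.surjective p
    exact h q hp
  · intro h q hq
    exact h _ hq

theorem globalIdeal_vanishingIdeal {R : CommRingCat.{0}} (Z : Closeds (Spec R)) :
    globalIdeal (Scheme.IdealSheafData.vanishingIdeal Z) =
      PrimeSpectrum.vanishingIdeal ((Z : Set (Spec R)) :) := by
  rw [globalIdeal, Scheme.IdealSheafData.vanishingIdeal_ideal]
  have h : (isAffineOpen_top (Spec R)).fromSpec = Spec.map (Scheme.ΓSpecIso R).inv := by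
    rw [IsAffineOpen.fromSpec_top, Scheme.isoSpec_Spec_inv]
  have h' : (isAffineOpen_top (Spec R)).fromSpec ⁻¹' (Z : Set (Spec R)) =
      PrimeSpectrum.comap (Scheme.ΓSpecIso R).inv.hom ⁻¹' ((Z : Set (Spec R)) :) := by
    rw [h]
    rfl
  exact (congrArg (fun T => Ideal.comap (Scheme.ΓSpecIso R).inv.hom
    (PrimeSpectrum.vanishingIdeal T)) h').trans
      (comap_vanishingIdeal_of_bijective (Scheme.ΓSpecIso R).inv.hom
        (ConcreteCategory.bijective_of_isIso (Scheme.ΓSpecIso R).inv) _)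

/-- Pulling back along an open immersion preserves radical ideals, so the pullback is the vanishing
ideal of its own support. -/
theorem comap_vanishingIdeal_of_isOpenImmersion {X Y : Scheme.{0}} (ι : Y ⟶ X) [IsOpenImmersion ι]
    (Z : Closeds X) :
    (Scheme.IdealSheafData.vanishingIdeal Z).comap ι =
      Scheme.IdealSheafData.vanishingIdeal (Z.preimage ι.continuous) := by
  have h1 : ((Scheme.IdealSheafData.vanishingIdeal Z).comap ι).support =
      Z.preimage ι.continuous := by
    rw [Scheme.IdealSheafData.support_comap]
    congr 1
  rw [← h1, Scheme.IdealSheafData.vanishingIdeal_support]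
  ext U : 2
  change _ = Ideal.radical _
  rw [Scheme.IdealSheafData.ideal_comap_of_isOpenImmersion, ← Ideal.comap_radical]
  congr 1
  rw [Scheme.IdealSheafData.vanishingIdeal_ideal]
  exact ((PrimeSpectrum.isRadical_vanishingIdeal _).radical).symm

theorem globalIdeal_bot {R : CommRingCat.{0}} :
    globalIdeal (⊥ : (Spec R).IdealSheafData) = ⊥ := by
  rw [globalIdeal]
  change Ideal.comap _ (⊥ : Ideal _) = ⊥
  rw [← RingHom.ker_eq_comap_bot, ← RingHom.injective_iff_ker_eq_bot]
  exact (ConcreteCategory.bijective_of_isIso (Scheme.ΓSpecIso R).inv).1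

/-- The closed immersion `Spec (A / I) ⟶ Spec A`. -/
abbrev quotientι {A : CommRingCat.{0}} (I : Ideal A) :
    Spec (CommRingCat.of (A ⧸ I)) ⟶ Spec A :=
  Spec.map (CommRingCat.ofHom (Ideal.Quotient.mk I))

instance {A : CommRingCat.{0}} (I : Ideal A) : IsClosedImmersion (quotientι I) :=
  IsClosedImmersion.spec_of_surjective _ Ideal.Quotient.mk_surjective

theorem ker_quotientι {A : CommRingCat.{0}} (J : (Spec A).IdealSheafData) :
    (quotientι (globalIdeal J)).ker = J := by
  have h : globalIdeal (quotientι (globalIdeal J)).ker = globalIdeal J := by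
    rw [← Scheme.IdealSheafData.map_bot, globalIdeal_map, globalIdeal_bot,
      ← RingHom.ker_eq_comap_bot]
    exact Ideal.mk_ker
  exact le_antisymm (le_of_globalIdeal_le h.le) (le_of_globalIdeal_le h.ge)

/-- A closed subscheme of an affine chart, as an open subscheme of a closed subscheme. -/
theorem exists_openImmersion_subscheme {X : Scheme.{0}} (I : X.IdealSheafData)
    {A : CommRingCat.{0}} (ι : Spec A ⟶ X) [IsOpenImmersion ι] :
    ∃ g : Spec (CommRingCat.of (A ⧸ globalIdeal (I.comap ι))) ⟶ I.subscheme,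
      IsOpenImmersion g ∧ Set.range g = I.subschemeι ⁻¹' Set.range ι ∧
        g ≫ I.subschemeι = quotientι (globalIdeal (I.comap ι)) ≫ ι := by
  let q := quotientι (globalIdeal (I.comap ι))
  -- A closed immersion is determined by its kernel, so the base change of the subscheme to the
  -- chart is the quotient model.
  have hker : (Limits.pullback.fst ι I.subschemeι).ker = q.ker := (ker_quotientι _).symm
  let e := IsClosedImmersion.lift (Limits.pullback.fst ι I.subschemeι) q hker.le
  have he : IsIso e := IsClosedImmersion.isIso_of_ker_eq q (Limits.pullback.fst ι I.subschemeι) e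
    (IsClosedImmersion.lift_fac _ _ _) hker.symm
  refine ⟨e ≫ Limits.pullback.snd ι I.subschemeι, inferInstance, ?_, ?_⟩
  · rw [← Scheme.Pullback.range_snd, Scheme.Hom.comp_base, TopCat.coe_comp, Set.range_comp,
      Set.range_eq_univ.mpr e.surjective, Set.image_univ]
  · rw [Category.assoc, ← Limits.pullback.condition, ← Category.assoc,
      IsClosedImmersion.lift_fac]

/-- Being a smooth divisor can be checked on an affine open cover. -/
theorem isSmoothDivisor_of_cover {W : Scheme.{0}} (s : W ⟶ Spec (CommRingCat.of ℂ)) (Z : Closeds W)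
    (h : ∀ x : W, ∃ (A : CommRingCat.{0}) (ι : Spec A ⟶ W) (_ : IsOpenImmersion ι) (f : A),
      x ∈ Set.range ι ∧ f ∈ nonZeroDivisors A ∧
        PrimeSpectrum.vanishingIdeal (ι ⁻¹' Z : Set (PrimeSpectrum A)) = Ideal.span {f} ∧
        Smooth (quotientι (Ideal.span {f}) ≫ ι ≫ s)) :
    IsSmoothDivisor s Z := by
  choose A ι hι f hx hf hI hs using h
  have hI' : ∀ x, globalIdeal ((Scheme.IdealSheafData.vanishingIdeal Z).comap (ι x)) =
      Ideal.span {f x} := fun x => by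
    rw [comap_vanishingIdeal_of_isOpenImmersion, globalIdeal_vanishingIdeal]
    exact hI x
  refine ⟨isInvertible_of_cover _ fun x => ⟨A x, ι x, hι x, hx x, f x, hf x, hI' x⟩, ?_⟩
  choose g hg hgr hgc using fun x =>
    exists_openImmersion_subscheme (Scheme.IdealSheafData.vanishingIdeal Z) (ι x)
  let 𝒰 : (Scheme.IdealSheafData.vanishingIdeal Z).subscheme.OpenCover :=
    Scheme.Cover.mkOfCovers W _ g (fun y => by
      have : y ∈ Set.range (g ((Scheme.IdealSheafData.vanishingIdeal Z).subschemeι y)) := by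
        rw [hgr]
        exact hx _
      exact ⟨_, this⟩) hg
  have : IsZariskiLocalAtSource (@Smooth : MorphismProperty Scheme.{0}) :=
    HasRingHomProperty.instIsZariskiLocalAtSource
  rw [IsZariskiLocalAtSource.iff_of_openCover (P := (@Smooth : MorphismProperty Scheme.{0})) 𝒰]
  intro x
  change Smooth (g x ≫ _)
  rw [reassoc_of% hgc x]
  have key : ∀ I : Ideal (A x), I = Ideal.span {f x} → Smooth (quotientι I ≫ ι x ≫ s) := by
    rintro _ rfl
    exact hs x
  exact key _ (hI' x)

/-! ### Strict transforms in charts -/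

/-- Data describing the blowup of `Cn` and the strict transform of `Y` in an affine chart. -/
structure BlowupChart {X : Scheme.{0}} (s : X ⟶ Spec (CommRingCat.of ℂ)) (Cn Y : Closeds X) where
  R : CommRingCat.{0}
  u : Spec R ⟶ X
  isOpenImmersion_u : IsOpenImmersion u
  J : Type
  f : J → R
  F : R
  B : J → CommRingCat.{0}
  φ : ∀ j, R ⟶ B j
  vanishingIdeal_center :
    PrimeSpectrum.vanishingIdeal (u ⁻¹' Cn : Set (PrimeSpectrum R)) = Ideal.span (Set.range f)
  preimage_eq : (u ⁻¹' Y : Set (PrimeSpectrum R)) = PrimeSpectrum.zeroLocus {F}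
  mem_nonZeroDivisors : ∀ j, φ j (f j) ∈ nonZeroDivisors (B j)
  dvd : ∀ j i, φ j (f j) ∣ φ j (f i)
  exists_lift : ∀ j (A : CommRingCat.{0}) (ψ : R ⟶ A), ψ (f j) ∈ nonZeroDivisors A →
      (∀ i, ψ (f j) ∣ ψ (f i)) → ∃ χ : B j ⟶ A, φ j ≫ χ = ψ
  lift_unique : ∀ j (A : CommRingCat.{0}) (χ χ' : B j ⟶ A), φ j ≫ χ = φ j ≫ χ' →
      χ (φ j (f j)) ∈ nonZeroDivisors A → χ = χ'
  G : ∀ j, B j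
  n : ℕ
  -- `G j` is the equation of the strict transform: what is left of `F` after removing `n` copies of
  -- the exceptional divisor.
  map_eq : ∀ j, φ j F = φ j (f j) ^ n * G j
  G_mem_nonZeroDivisors : ∀ j, G j ∈ nonZeroDivisors (B j)
  isRegularMod : ∀ j, IsRegularMod (Ideal.span {G j}) (φ j (f j))
  isRadical : ∀ j, (Ideal.span {G j}).IsRadical
  smooth : ∀ j, Smooth (quotientι (Ideal.span {G j}) ≫ Spec.map (φ j) ≫ u ≫ s)

theorem isRegularMod_localization {B A : Type*} [CommRing B] [CommRing A] [Algebra B A] (b : B)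
    [IsLocalization.Away b A] {G s : B} (h : IsRegularMod (Ideal.span {G}) s) :
    IsRegularMod (Ideal.span {algebraMap B A G}) (algebraMap B A s) := by
  intro a ha
  obtain ⟨⟨t, m⟩, ht⟩ := IsLocalization.surj (Submonoid.powers b) a
  have hspan : Ideal.span {algebraMap B A G} = (Ideal.span {G}).map (algebraMap B A) := by
    rw [Ideal.map_span, Set.image_singleton]
  have h1 : algebraMap B A (s * t) ∈ (Ideal.span {G}).map (algebraMap B A) := by
    rw [map_mul, ← ht, ← hspan, ← mul_assoc]
    exact Ideal.mul_mem_right _ _ ha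
  obtain ⟨k, hk, hk'⟩ := (IsLocalization.algebraMap_mem_map_algebraMap_iff
    (Submonoid.powers b) A _ _).mp h1
  have h2 : k * t ∈ Ideal.span {G} := by
    apply h
    have : s * (k * t) = k * (s * t) := by ring
    rwa [this]
  have h3 : algebraMap B A t ∈ (Ideal.span {G}).map (algebraMap B A) :=
    (IsLocalization.algebraMap_mem_map_algebraMap_iff (Submonoid.powers b) A _ _).mpr ⟨k, hk, h2⟩
  rw [← ht, ← hspan] at h3
  have hu := IsLocalization.map_units A m
  exact (Ideal.mul_unit_mem_iff_mem _ hu).mp h3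

/-- If `a` vanishes on `V(G) ∖ V(s)`, then `s a` vanishes on `V(G)`. Hence `s a` lies in the radical
ideal `(G)`, and `s` can be cancelled. -/
theorem closure_preimage_vanishingIdeal {A : Type*} [CommRing A] (G s : A)
    (hs : IsRegularMod (Ideal.span {G}) s) (hr : (Ideal.span {G}).IsRadical) :
    PrimeSpectrum.vanishingIdeal (PrimeSpectrum.zeroLocus {G} \ PrimeSpectrum.zeroLocus {s}) =
      Ideal.span {G} := by
  apply le_antisymm
  · intro a ha
    apply hs
    rw [← hr.radical, ← PrimeSpectrum.vanishingIdeal_zeroLocus_eq_radical,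
      PrimeSpectrum.mem_vanishingIdeal]
    intro p hp
    by_cases h : s ∈ p.asIdeal
    · exact Ideal.mul_mem_right _ _ h
    · refine Ideal.mul_mem_left _ _ ((PrimeSpectrum.mem_vanishingIdeal _ _).mp ha p ⟨?_, ?_⟩)
      · rwa [PrimeSpectrum.zeroLocus_span] at hp
      · rwa [PrimeSpectrum.mem_zeroLocus, Set.singleton_subset_iff]
  · rw [Ideal.span_singleton_le_iff_mem, PrimeSpectrum.mem_vanishingIdeal]
    intro p hp
    exact hp.1 rfl

/-- The strict transform of `Y` is a smooth divisor on the blowup if it is so in charts. -/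
theorem isSmoothDivisor_strictTransform {W X : Scheme.{0}} {π : W ⟶ X}
    {s : X ⟶ Spec (CommRingCat.of ℂ)} {Cn Y : Closeds X}
    (hπ : IsBlowup π (Scheme.IdealSheafData.vanishingIdeal Cn))
    (H : ∀ p : X, ∃ c : BlowupChart s Cn Y, p ∈ Set.range c.u) :
    IsSmoothDivisor (π ≫ s) (strictTransform π Cn Y) := by
  apply isSmoothDivisor_of_cover
  intro x
  obtain ⟨c, hc⟩ := H (π x)
  have := c.isOpenImmersion_u
  obtain ⟨j, A, ι, χ, b, hι, hx, hloc, hcomm⟩ := exists_blowup_chart hπ c.u c.f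
    (by
      rw [comap_vanishingIdeal_of_isOpenImmersion, globalIdeal_vanishingIdeal]
      exact c.vanishingIdeal_center) c.B c.φ
    c.mem_nonZeroDivisors c.dvd c.exists_lift c.lift_unique x hc
  let := χ.hom.toAlgebra
  have hloc' : IsLocalization.Away b A := hloc
  set t : A := χ (c.φ j (c.f j)) with ht
  have hspan : Ideal.span {χ (c.G j)} = (Ideal.span {c.G j}).map χ.hom := by
    rw [Ideal.map_span, Set.image_singleton]
  have hrad : (Ideal.span {χ (c.G j)}).IsRadical := by
    rw [hspan, ← (c.isRadical j).radical]
    change (Ideal.map (algebraMap (c.B j) A) _).IsRadical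
    rw [IsLocalization.map_radical (Submonoid.powers b)]
    exact Ideal.radical_isRadical _
  have hreg : IsRegularMod (Ideal.span {χ (c.G j)}) t :=
    isRegularMod_localization (A := A) b (c.isRegularMod j)
  refine ⟨A, ι, hι, χ (c.G j), hx, ?_, ?_, ?_⟩
  · exact IsLocalization.map_nonZeroDivisors_le (Submonoid.powers b) A
      (Submonoid.mem_map_of_mem (algebraMap (c.B j) A) (c.G_mem_nonZeroDivisors j))
  · rw [← closure_preimage_vanishingIdeal _ _ hreg hrad]
    -- In the chart, `Y ∖ Cn` is the locus where `tⁿ G` vanishes but `t` does not, that is `V(G) ∖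
    -- V(t)`. Closures are compatible with restriction to an open subset.
    have hset : (ι ⁻¹' (strictTransform π Cn Y : Set W) : Set (PrimeSpectrum A)) =
        closure (PrimeSpectrum.zeroLocus {χ (c.G j)} \ PrimeSpectrum.zeroLocus {t}) := by
      have h1 : (strictTransform π Cn Y : Set W) = closure (π ⁻¹' ((Y : Set X) \ Cn)) := rfl
      rw [h1]
      refine (ι.isOpenEmbedding.isOpenMap.preimage_closure_eq_closure_preimage ι.continuous _).trans
        (congrArg closure ?_)
      have h2 : ι ⁻¹' (π ⁻¹' ((Y : Set X) \ Cn)) =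
          Spec.map (c.φ j ≫ χ) ⁻¹' ((c.u ⁻¹' Y) \ (c.u ⁻¹' Cn)) := by
        refine Set.ext fun p => ?_
        have : π (ι p) = c.u (Spec.map (c.φ j ≫ χ) p) := by
          rw [← Scheme.Hom.comp_apply, hcomm, Scheme.Hom.comp_apply]
        change (π (ι p) ∈ (Y : Set X) ∧ ¬ π (ι p) ∈ (Cn : Set X)) ↔
          (c.u (Spec.map (c.φ j ≫ χ) p) ∈ (Y : Set X) ∧
            ¬ c.u (Spec.map (c.φ j ≫ χ) p) ∈ (Cn : Set X))
        rw [this]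
      have h3 : (c.u ⁻¹' Cn : Set (PrimeSpectrum c.R)) =
          PrimeSpectrum.zeroLocus (Set.range c.f) := by
        rw [← PrimeSpectrum.zeroLocus_span, ← c.vanishingIdeal_center,
          PrimeSpectrum.zeroLocus_vanishingIdeal_eq_closure, IsClosed.closure_eq]
        exact Cn.isClosed.preimage c.u.continuous
      refine h2.trans ?_
      ext p
      have h4 : c.u (Spec.map (c.φ j ≫ χ) p) ∈ Y ↔ χ (c.φ j c.F) ∈ p.asIdeal := by
        have : Spec.map (c.φ j ≫ χ) p ∈ (c.u ⁻¹' Y : Set (PrimeSpectrum c.R)) ↔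
            χ (c.φ j c.F) ∈ p.asIdeal := by
          rw [c.preimage_eq]
          exact Set.singleton_subset_iff
        exact this
      have h5 : c.u (Spec.map (c.φ j ≫ χ) p) ∈ Cn ↔ t ∈ p.asIdeal := by
        have : Spec.map (c.φ j ≫ χ) p ∈ (c.u ⁻¹' Cn : Set (PrimeSpectrum c.R)) ↔
            ∀ i, χ (c.φ j (c.f i)) ∈ p.asIdeal := by
          rw [h3]
          exact Set.range_subset_iff
        refine this.trans ⟨fun h => h j, fun h i => ?_⟩
        obtain ⟨d, hd⟩ := c.dvd j i
        rw [hd, map_mul]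
        exact Ideal.mul_mem_right _ _ h
      change (c.u (Spec.map (c.φ j ≫ χ) p) ∈ Y ∧ ¬ c.u (Spec.map (c.φ j ≫ χ) p) ∈ Cn) ↔
        ({χ (c.G j)} : Set A) ⊆ p.asIdeal ∧ ¬ ({t} : Set A) ⊆ p.asIdeal
      rw [Set.singleton_subset_iff,
        Set.singleton_subset_iff, SetLike.mem_coe, SetLike.mem_coe, h4, h5, c.map_eq, map_mul, map_pow, p.2.mul_mem_iff_mem_or_mem]
      constructor
      · rintro ⟨h | h, h'⟩
        · exact absurd (p.2.mem_of_pow_mem _ h) h'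
        · exact ⟨h, h'⟩
      · rintro ⟨h, h'⟩
        exact ⟨Or.inr h, h'⟩
    rw [hset, PrimeSpectrum.vanishingIdeal_closure]
  · let I := Ideal.span {c.G j}
    let I' := Ideal.span {χ (c.G j)}
    let χ' : (c.B j ⧸ I) →+* (A ⧸ I') := Ideal.quotientMap I' χ.hom (by
      rw [Ideal.span_singleton_le_iff_mem]
      exact Ideal.subset_span rfl)
    have hc' : quotientι I' ≫ ι ≫ π ≫ s =
        Spec.map (CommRingCat.ofHom χ') ≫ quotientι I ≫ Spec.map (c.φ j) ≫ c.u ≫ s := by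
      have h1 : χ ≫ CommRingCat.ofHom (Ideal.Quotient.mk I') =
        CommRingCat.ofHom (Ideal.Quotient.mk I) ≫ CommRingCat.ofHom χ' := rfl
      rw [reassoc_of% hcomm, Spec.map_comp, Category.assoc, ← Spec.map_comp_assoc χ, h1,
        Spec.map_comp_assoc]
    let := χ'.toAlgebra
    -- Localization commutes with quotients, so the strict transform in this chart is open in the
    -- model `Spec (B j / (G j))`, and smoothness restricts.
    have hl : IsLocalization.Away (Ideal.Quotient.mk I b) (A ⧸ I') := by
      have h1 : I' = I.map (algebraMap (c.B j) A) := hspan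
      have h2 := IsLocalization.of_surjective (Submonoid.powers b) A (Ideal.Quotient.mk I)
        Ideal.Quotient.mk_surjective (Ideal.Quotient.mk I') Ideal.Quotient.mk_surjective rfl
        (by rw [Ideal.mk_ker, Ideal.mk_ker, h1])
      rwa [Submonoid.map_powers] at h2
    have : IsOpenImmersion (Spec.map (CommRingCat.ofHom χ')) :=
      IsOpenImmersion.of_isLocalization (S := A ⧸ I') (Ideal.Quotient.mk I b)
    rw [hc']
    have := c.smooth j
    infer_instance

/-! ### The standard affine charts of `ℙ⁶` -/

theorem x_mem_grading (k : Fin 7) : x k ∈ grading 1 := MvPolynomial.isHomogeneous_X ℂ k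

/-- The coordinate ring of the chart `xₖ ≠ 0`. -/
abbrev ChartRing (k : Fin 7) : Type :=
  MvPolynomial (Fin 7) ℂ ⧸ Ideal.span {(x k - 1 : MvPolynomial (Fin 7) ℂ)}

/-- The quotient map to the coordinate ring of the chart `xₖ ≠ 0`. -/
abbrev toChart (k : Fin 7) : MvPolynomial (Fin 7) ℂ →+* ChartRing k := Ideal.Quotient.mk _

theorem toChart_x (k : Fin 7) : toChart k (x k) = 1 := by
  rw [← map_one (toChart k), Ideal.Quotient.mk_eq_mk_iff_sub_mem]
  exact Ideal.subset_span rfl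

/-- Setting `xₖ = 1` in a fraction of degree zero with denominator a power of `xₖ`. -/
def dehomogenize (k : Fin 7) : HomogeneousLocalization.Away grading (x k) →+* ChartRing k :=
  (IsLocalization.Away.lift (S := Localization.Away (x k)) (x k) (g := toChart k)
    (by rw [toChart_x]; exact isUnit_one)).comp
      (algebraMap (HomogeneousLocalization.Away grading (x k)) (Localization.Away (x k)))

theorem dehomogenize_mk (k : Fin 7) (n : ℕ) (a : MvPolynomial (Fin 7) ℂ)
    (ha : a ∈ grading (n • 1)) :
    dehomogenize k (HomogeneousLocalization.Away.mk grading (x_mem_grading k) n a ha) =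
      toChart k a := by
  rw [dehomogenize, RingHom.comp_apply, HomogeneousLocalization.algebraMap_apply,
    HomogeneousLocalization.Away.val_mk, Localization.mk_eq_mk', IsLocalization.Away.lift,
    IsLocalization.lift_mk'_spec, map_pow, toChart_x, one_pow, one_mul]

theorem eval₂Hom_mul_of_isHomogeneous {σ K S : Type*} [CommRing K] [CommRing S] {n : ℕ}
    {a : MvPolynomial σ K} (ha : a.IsHomogeneous n) (r : K →+* S) (g : σ → S) (t : S) :
    MvPolynomial.eval₂Hom r (fun i => t * g i) a = t ^ n * MvPolynomial.eval₂Hom r g a := by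
  rw [MvPolynomial.coe_eval₂Hom, MvPolynomial.coe_eval₂Hom, MvPolynomial.eval₂_eq,
    MvPolynomial.eval₂_eq, Finset.mul_sum]
  refine Finset.sum_congr rfl fun d hd => ?_
  have hd' : d.degree = n := by
    by_contra h
    exact MvPolynomial.mem_support_iff.mp hd (ha.coeff_eq_zero h)
  simp only [mul_pow, Finset.prod_mul_distrib, Finset.prod_pow_eq_pow_sum]
  rw [← hd', mul_left_comm]
  rfl

/-- Substituting `xᵢ / xₖ` for `xᵢ` gives a left inverse with values in the full localization.
Surjectivity holds because constants and coordinates are hit. -/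
theorem dehomogenize_bijective (k : Fin 7) : Function.Bijective (dehomogenize k) := by
  constructor
  · let L := Localization.Away (x k)
    let t : L := Localization.mk 1 ⟨x k, 1, pow_one _⟩
    have ht : t * algebraMap _ L (x k) = 1 := by
      rw [← Localization.mk_one_eq_algebraMap, Localization.mk_mul]
      simp only [one_mul, mul_one]
      exact Localization.mk_self (⟨x k, 1, pow_one _⟩ : Submonoid.powers (x k))
    let r : MvPolynomial (Fin 7) ℂ →+* L :=
      MvPolynomial.eval₂Hom ((algebraMap (MvPolynomial (Fin 7) ℂ) L).comp MvPolynomial.C)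
        (fun i => t * algebraMap (MvPolynomial (Fin 7) ℂ) L (x i))
    have hr : ∀ n a, a ∈ grading n → r a = t ^ n * algebraMap _ L a := by
      intro n a ha
      refine (eval₂Hom_mul_of_isHomogeneous ha _ _ t).trans ?_
      congr 1
      exact congrArg (fun f : MvPolynomial (Fin 7) ℂ →+* L => f a)
        (MvPolynomial.ringHom_ext (f := MvPolynomial.eval₂Hom _ _) (g := algebraMap _ L)
          (fun c => by simp) (fun i => by simp))
    let r' : ChartRing k →+* L := Ideal.Quotient.lift _ r (by
      intro a ha
      have : Ideal.span {(x k - 1 : MvPolynomial (Fin 7) ℂ)} ≤ RingHom.ker r := by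
        rw [Ideal.span_singleton_le_iff_mem, RingHom.mem_ker, map_sub, map_one, sub_eq_zero,
          hr 1 _ (x_mem_grading k), pow_one, ht]
      exact this ha)
    refine Function.Injective.of_comp (f := r') fun z z' h => ?_
    have key : ∀ z, r' (dehomogenize k z) = z.val := by
      intro z
      obtain ⟨n, a, ha, rfl⟩ := HomogeneousLocalization.Away.mk_surjective grading
        (x_mem_grading k) z
      rw [dehomogenize_mk, HomogeneousLocalization.Away.val_mk]
      refine (hr n a (by simpa using ha)).trans ?_
      have h1 : t ^ n = Localization.mk 1 (⟨x k ^ n, n, rfl⟩ : Submonoid.powers (x k)) := by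
        rw [Localization.mk_pow, one_pow]
        rfl
      rw [h1, ← Localization.mk_one_eq_algebraMap, Localization.mk_mul]
      simp
    apply HomogeneousLocalization.val_injective
    rw [← key, ← key]
    exact h
  · intro y
    obtain ⟨a, rfl⟩ := Ideal.Quotient.mk_surjective y
    change toChart k a ∈ (dehomogenize k).range
    induction a using MvPolynomial.induction_on with
    | C c =>
      exact ⟨_, dehomogenize_mk k 0 (MvPolynomial.C c)
        (by simp)⟩
    | add p q hp hq => rw [map_add]; exact add_mem hp hq
    | mul_X p i hp =>
      rw [map_mul]
      exact mul_mem hp ⟨_, dehomogenize_mk k 1 (x i) (by simpa using x_mem_grading i)⟩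

/-- The open immersion of the chart `xₖ ≠ 0`. -/
def chart (k : Fin 7) : Spec (CommRingCat.of (ChartRing k)) ⟶ P6 :=
  Spec.map (CommRingCat.ofHom (dehomogenize k)) ≫
    Proj.awayι grading (x k) (x_mem_grading k) one_pos

instance (k : Fin 7) : IsOpenImmersion (chart k) := by
  have : IsIso (CommRingCat.ofHom (dehomogenize k)) :=
    (ConcreteCategory.isIso_iff_bijective _).mpr (dehomogenize_bijective k)
  unfold chart
  infer_instance

theorem range_chart (k : Fin 7) : Set.range (chart k) = Proj.basicOpen grading (x k) := by
  have : IsIso (CommRingCat.ofHom (dehomogenize k)) :=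
    (ConcreteCategory.isIso_iff_bijective _).mpr (dehomogenize_bijective k)
  have h := Scheme.Hom.opensRange_comp_of_isIso (Spec.map (CommRingCat.ofHom (dehomogenize k)))
    (Proj.awayι grading (x k) (x_mem_grading k) one_pos)
  rw [Proj.opensRange_awayι] at h
  exact congrArg SetLike.coe h

theorem exists_mem_range_chart (p : P6) : ∃ k, p ∈ Set.range (chart k) := by
  have h := Proj.iSup_basicOpen_eq_top' grading x (fun i => ⟨1, x_mem_grading i⟩) (by
    rw [eq_top_iff]
    rintro a -
    induction a using MvPolynomial.induction_on with
    | C c =>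
      exact Subalgebra.algebraMap_mem _
        (⟨MvPolynomial.C c, MvPolynomial.isHomogeneous_C (Fin 7) c⟩ : grading 0)
    | add p q hp hq => exact add_mem hp hq
    | mul_X p i hp => exact mul_mem hp (Algebra.subset_adjoin ⟨i, rfl⟩))
  have hp : p ∈ ⨆ i, Proj.basicOpen grading (x i) := h ▸ trivial
  obtain ⟨k, hk⟩ := Opens.mem_iSup.mp hp
  exact ⟨k, (range_chart k).symm ▸ hk⟩

theorem chart_toSpec (k : Fin 7) :
    chart k ≫ P6.toSpec = Spec.map (CommRingCat.ofHom (algebraMap ℂ (ChartRing k))) := by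
  rw [chart, P6.toSpec, Category.assoc, Proj.awayι_toSpecZero_assoc, ← Spec.map_comp,
    ← Spec.map_comp]
  congr 1
  ext c
  exact dehomogenize_mk k 0 (MvPolynomial.C c) (by simp)

theorem chart_preimage_zeros (k : Fin 7) (F : Set (MvPolynomial (Fin 7) ℂ))
    (hF : ∀ f ∈ F, ∃ n, 0 < n ∧ f ∈ grading n) :
    (chart k ⁻¹' (zeros F : Set P6) : Set (PrimeSpectrum (ChartRing k))) =
      PrimeSpectrum.zeroLocus (toChart k '' F) := by
  have key : ∀ f ∈ F, ∀ p : PrimeSpectrum (ChartRing k),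
      f ∈ (chart k p : P6).asHomogeneousIdeal ↔ toChart k f ∈ p.asIdeal := by
    intro f hf p
    obtain ⟨n, hn, hfn⟩ := hF f hf
    have h := Proj.awayι_preimage_basicOpen grading (x_mem_grading k) one_pos hfn hn
    have h' := SetLike.ext_iff.mp h (Spec.map (CommRingCat.ofHom (dehomogenize k)) p)
    have h1 : dehomogenize k (HomogeneousLocalization.Away.isLocalizationElem
        (x_mem_grading k) hfn) = toChart k f := by
      rw [dehomogenize_mk, pow_one]
    rw [← h1]
    exact not_iff_not.mp h'
  ext p
  change (∀ f ∈ F, f ∈ (chart k p : P6).asHomogeneousIdeal) ↔ toChart k '' F ⊆ p.asIdeal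
  rw [Set.image_subset_iff]
  exact forall₂_congr fun f hf => key f hf p

/-! ### Ternary quadratic forms -/

section Forms

variable {R S : Type*} [CommRing R] [CommRing S]

/-- A ternary quadratic form with coefficients `a`. -/
def quad (a : Fin 6 → R) (t : Fin 3 → R) : R :=
  a 0 * t 0 ^ 2 + a 1 * (t 0 * t 1) + a 2 * (t 0 * t 2) + a 3 * t 1 ^ 2 + a 4 * (t 1 * t 2) +
    a 5 * t 2 ^ 2

/-- The gradient of a ternary quadratic form. -/
def quadGrad (a : Fin 6 → R) (t : Fin 3 → R) : Fin 3 → R :=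
  ![2 * a 0 * t 0 + a 1 * t 1 + a 2 * t 2, a 1 * t 0 + 2 * a 3 * t 1 + a 4 * t 2,
    a 2 * t 0 + a 4 * t 1 + 2 * a 5 * t 2]

/-- The sum of three coordinates. -/
def lin (t : Fin 3 → R) : R := t 0 + t 1 + t 2

theorem map_quad (f : R →+* S) (a : Fin 6 → R) (t : Fin 3 → R) :
    f (quad a t) = quad (f ∘ a) (f ∘ t) := by
  simp [quad]

theorem map_lin (f : R →+* S) (t : Fin 3 → R) : f (lin t) = lin (f ∘ t) := by
  simp [lin]

theorem quad_smul (a : Fin 6 → R) (s : R) (t : Fin 3 → R) :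
    quad a (fun i => s * t i) = s ^ 2 * quad a t := by
  simp only [quad]
  ring

theorem quad_euler (a : Fin 6 → R) (t : Fin 3 → R) :
    t 0 * quadGrad a t 0 + t 1 * quadGrad a t 1 + t 2 * quadGrad a t 2 = 2 * quad a t := by
  simp only [quad, quadGrad, Matrix.cons_val]
  ring

theorem derivation_quad {K : Type*} [CommRing K] [Algebra K R] (D : Derivation K R R)
    (a : Fin 6 → R) (ha : ∀ i, D (a i) = 0) (t : Fin 3 → R) :
    D (quad a t) = ∑ i, quadGrad a t i * D (t i) := by
  simp only [quad, quadGrad, map_add, Derivation.leibniz, Derivation.leibniz_pow, ha,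
    Fin.sum_univ_three, smul_eq_mul, nsmul_eq_mul, Matrix.cons_val]
  push_cast
  ring

/-! ### The cubic form and its pullback to the Cox ring of the blowup of the conic -/

/-- The coefficients of a cubic `Q(v) (l(u) + z) + Q'(u) (z + l(v)) + z (uMv + z α·u + z β·v)`. -/
structure CubicForm (R : Type*) where
  a : Fin 6 → R
  b : Fin 6 → R
  M : Fin 3 → Fin 3 → R
  α : Fin 3 → R
  β : Fin 3 → R

namespace CubicForm

/-- Base change of a cubic form. -/
def map (f : R →+* S) (d : CubicForm R) : CubicForm S :=
  ⟨f ∘ d.a, f ∘ d.b, fun i j => f (d.M i j), f ∘ d.α, f ∘ d.β⟩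

@[simp] theorem map_a (f : R →+* S) (d : CubicForm R) : (d.map f).a = f ∘ d.a := rfl

@[simp] theorem map_b (f : R →+* S) (d : CubicForm R) : (d.map f).b = f ∘ d.b := rfl

@[simp] theorem map_M (f : R →+* S) (d : CubicForm R) (i j : Fin 3) :
    (d.map f).M i j = f (d.M i j) := rfl

@[simp] theorem map_α (f : R →+* S) (d : CubicForm R) : (d.map f).α = f ∘ d.α := rfl

@[simp] theorem map_β (f : R →+* S) (d : CubicForm R) : (d.map f).β = f ∘ d.β := rfl

/-- The cubic form with the two triples of variables interchanged. -/
def swap (d : CubicForm R) : CubicForm R := ⟨d.b, d.a, fun i j => d.M j i, d.β, d.α⟩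

variable (d : CubicForm R)

/-- The bilinear form `uMv`. -/
def bil (u v : Fin 3 → R) : R := ∑ i, ∑ j, d.M i j * (u i * v j)

/-- The value of the cubic form. -/
def psi (u : Fin 3 → R) (z : R) (v : Fin 3 → R) : R :=
  quad d.a v * (lin u + z) + quad d.b u * (z + lin v) +
    z * (d.bil u v + z * ∑ i, d.α i * u i + z * ∑ i, d.β i * v i)

/-- The strict transform of the cubic form. -/
def cox (s : R) (u : Fin 3 → R) (z q : R) (v : Fin 3 → R) : R :=
  q * (lin u + z) + quad d.b u * (s * z + lin v) +
    z * (d.bil u v + s * z * ∑ i, d.α i * u i + z * ∑ i, d.β i * v i)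

/-- The derivative of `cox` with respect to `s`. -/
def coxS (u : Fin 3 → R) (z : R) : R := z * quad d.b u + z ^ 2 * ∑ i, d.α i * u i

/-- The derivative of `cox` with respect to `u`. -/
def coxU (s : R) (u : Fin 3 → R) (z q : R) (v : Fin 3 → R) (i : Fin 3) : R :=
  q + (s * z + lin v) * quadGrad d.b u i + z * (∑ j, d.M i j * v j + s * z * d.α i)

/-- The derivative of `cox` with respect to `z`. -/
def coxZ (s : R) (u : Fin 3 → R) (z q : R) (v : Fin 3 → R) : R :=
  q + s * quad d.b u + d.bil u v + 2 * (s * z * ∑ i, d.α i * u i) + 2 * (z * ∑ i, d.β i * v i)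

/-- The derivative of `cox` with respect to `v`. -/
def coxV (u : Fin 3 → R) (z : R) (i : Fin 3) : R :=
  quad d.b u + z * (∑ j, d.M j i * u j + z * d.β i)

theorem map_psi (f : R →+* S) (u : Fin 3 → R) (z : R) (v : Fin 3 → R) :
    f (d.psi u z v) = (d.map f).psi (f ∘ u) (f z) (f ∘ v) := by
  simp [psi, bil, map_quad, map_lin]

theorem map_cox (f : R →+* S) (s : R) (u : Fin 3 → R) (z q : R) (v : Fin 3 → R) :
    f (d.cox s u z q v) = (d.map f).cox (f s) (f ∘ u) (f z) (f q) (f ∘ v) := by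
  simp [cox, bil, map_quad, map_lin]

theorem map_bil (f : R →+* S) (u v : Fin 3 → R) :
    f (d.bil u v) = (d.map f).bil (f ∘ u) (f ∘ v) := by
  simp [bil]

theorem map_coxS (f : R →+* S) (u : Fin 3 → R) (z : R) :
    f (d.coxS u z) = (d.map f).coxS (f ∘ u) (f z) := by
  simp [coxS, map_quad]

theorem map_coxZ (f : R →+* S) (s : R) (u : Fin 3 → R) (z q : R) (v : Fin 3 → R) :
    f (d.coxZ s u z q v) = (d.map f).coxZ (f s) (f ∘ u) (f z) (f q) (f ∘ v) := by
  simp [coxZ, bil, map_quad, map_ofNat f 2]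

theorem _root_.DoubleBox.map_quadGrad (f : R →+* S) (a : Fin 6 → R) (t : Fin 3 → R) (i : Fin 3) :
    f (quadGrad a t i) = quadGrad (f ∘ a) (f ∘ t) i := by
  fin_cases i <;> simp [quadGrad, map_ofNat f 2]

theorem map_coxU (f : R →+* S) (s : R) (u : Fin 3 → R) (z q : R) (v : Fin 3 → R) (i : Fin 3) :
    f (d.coxU s u z q v i) = (d.map f).coxU (f s) (f ∘ u) (f z) (f q) (f ∘ v) i := by
  simp [coxU, map_quadGrad, map_lin]

theorem map_coxV (f : R →+* S) (u : Fin 3 → R) (z : R) (i : Fin 3) :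
    f (d.coxV u z i) = (d.map f).coxV (f ∘ u) (f z) i := by
  simp [coxV, map_quad]

theorem derivation_cox {K : Type*} [CommRing K] [Algebra K R] (D : Derivation K R R)
    (hb : ∀ i, D (d.b i) = 0) (hM : ∀ i j, D (d.M i j) = 0) (hα : ∀ i, D (d.α i) = 0)
    (hβ : ∀ i, D (d.β i) = 0) (s : R) (u : Fin 3 → R) (z q : R) (v : Fin 3 → R) :
    D (d.cox s u z q v) = d.coxS u z * D s + ∑ i, d.coxU s u z q v i * D (u i) +
      d.coxZ s u z q v * D z + (lin u + z) * D q + ∑ i, d.coxV u z i * D (v i) := by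
  simp only [cox, coxS, coxU, coxZ, coxV, bil, lin, map_add, Derivation.leibniz,
    derivation_quad D d.b hb, hM, hα, hβ, Fin.sum_univ_three, smul_eq_mul]
  ring

/-- Away from the exceptional divisor `s` may be normalized to `1`. This lets one nonsingularity
condition serve both the blowup charts and the chart `z ≠ 0`. -/
theorem psi_eq_cox (u : Fin 3 → R) (z : R) (v : Fin 3 → R) :
    d.psi u z v = d.cox 1 u z (quad d.a v) v := by
  simp [psi, cox]

/-- Euler relation of the first grading: `u`, `z`, `q` have weight `1`, `s` has weight `-1`, `v` has
weight `0`, and `cox` has weight `2`. -/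
theorem cox_euler_y (s : R) (u : Fin 3 → R) (z q : R) (v : Fin 3 → R) :
    ∑ i, u i * d.coxU s u z q v i + z * d.coxZ s u z q v + q * (lin u + z) - s * d.coxS u z =
      2 * d.cox s u z q v := by
  have := quad_euler d.b u
  simp only [cox, coxS, coxU, coxZ, bil, lin, Fin.sum_univ_three] at *
  linear_combination (s * z + (v 0 + v 1 + v 2)) * this

/-- Euler relation of the second grading: `s`, `q`, `v` have weight `1`, `u` and `z` have weight
`0`, and `cox` has weight `1`. -/
theorem cox_euler_v (s : R) (u : Fin 3 → R) (z q : R) (v : Fin 3 → R) :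
    s * d.coxS u z + q * (lin u + z) + ∑ i, v i * d.coxV u z i = d.cox s u z q v := by
  simp only [cox, coxS, coxV, bil, lin, Fin.sum_univ_three]
  ring

theorem psi_swap (u : Fin 3 → R) (z : R) (v : Fin 3 → R) : d.swap.psi v z u = d.psi u z v := by
  simp only [psi, swap, bil, Fin.sum_univ_three, lin]
  ring

end CubicForm

end Forms

/-! ### The genericity conditions. -/

/-- The genericity conditions on a cubic form needed over the conic `C`. -/
structure IsGenericSide {K : Type*} [CommRing K] (d : CubicForm K) : Prop where
  quadGrad_ne_zero : ∀ v : Fin 3 → K, v ≠ 0 → quadGrad d.a v ≠ 0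
  -- This forces the points of `𝒮` to lie on `C` or `C'`.
  bil_ne_zero : ∀ u v : Fin 3 → K, u ≠ 0 → v ≠ 0 → lin u = 0 → lin v = 0 → quad d.b u = 0 →
    quad d.a v = 0 → d.bil u v ≠ 0
  -- The Lagrange system for a singular point of `cox = 0` on `Q(v) = s q`, with multiplier `l`. The
  -- equation `cox = 0` need not be listed, since it follows from `cox_euler_v`.
  nonsingular : ∀ (s : K) (u : Fin 3 → K) (z q : K) (v : Fin 3 → K) (l : K), v ≠ 0 →
    ¬ (u = 0 ∧ z = 0 ∧ q = 0) → quad d.a v = s * q → lin u + z + l * s = 0 →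
    d.coxS u z + l * q = 0 → d.coxU s u z q v = 0 → d.coxZ s u z q v = 0 →
    (∀ i, d.coxV u z i = l * quadGrad d.a v i) → False

/-- The genericity conditions on a cubic form. -/
structure IsGeneric (d : CubicForm ℂ) : Prop where
  left : IsGenericSide d
  right : IsGenericSide d.swap
  -- The cubic always passes through the point `u = v = 0`, where its gradient consists of `α` and
  -- `β`.
  ne_zero : d.α ≠ 0 ∨ d.β ≠ 0

open MvPolynomial (eval pderiv)

/-! ### Regular elements modulo ideals cut out transversally -/

/-- The Jacobian criterion: the differentials of `g` are independent at all common zeros. -/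
def IsTransversal {ι σ : Type*} [Fintype ι] (g : ι → MvPolynomial σ ℂ) : Prop :=
  ∀ p : σ → ℂ, (∀ i, eval p (g i) = 0) → ∀ c : ι → ℂ,
    (∀ s, ∑ i, c i * eval p (pderiv s (g i)) = 0) → c = 0

theorem eval_eq_zero_of_mem_span {ι σ : Type*} {g : ι → MvPolynomial σ ℂ} {p : σ → ℂ}
    (hp : ∀ i, eval p (g i) = 0) {a : MvPolynomial σ ℂ} (ha : a ∈ Ideal.span (Set.range g)) :
    eval p a = 0 := by
  have : Ideal.span (Set.range g) ≤ RingHom.ker (eval p) := by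
    rw [Ideal.span_le]
    rintro _ ⟨i, rfl⟩
    exact hp i
  exact this ha

/-- If `f a` is in the ideal, it vanishes on every line inside the zero set. On the line from `p` to
`q` the factor `f` is not identically zero, so `a` vanishes at `p`. By transversality a polynomial
vanishing at all zeros is in the ideal. -/
theorem IsTransversal.isRegularMod {ι σ : Type*} [Fintype ι] [Fintype σ]
    {g : ι → MvPolynomial σ ℂ} (hg : IsTransversal g) {f : MvPolynomial σ ℂ}
    (h : ∀ p : σ → ℂ, (∀ i, eval p (g i) = 0) → ∃ q : σ → ℂ, eval q f ≠ 0 ∧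
      ∀ (t : ℂ) i, eval (fun i => p i + t * (q i - p i)) (g i) = 0) :
    IsRegularMod (Ideal.span (Set.range g)) f := by
  intro a ha
  refine mem_span_of_jacobian g hg a fun p hp => ?_
  obtain ⟨q, hq, hl⟩ := h p hp
  refine eval_eq_zero_of_line hq fun t => ?_
  rw [← map_mul]
  exact eval_eq_zero_of_mem_span (hl t) ha

theorem span_range_vecCons {R : Type*} [CommRing R] {n : ℕ} (a : R) (f : Fin n → R) :
    Ideal.span (Set.range (Matrix.vecCons a f)) =
      Ideal.span (Set.range f) ⊔ Ideal.span {a} := by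
  rw [Matrix.range_cons, Ideal.span_union, sup_comm]

/-! ### The blowup of the conic in Cox coordinates -/

/-- Index set for the Cox coordinates `s`, `y = (u, z, q)` and `v`. -/
abbrev CoxIndex : Type := Unit ⊕ Fin 5 ⊕ Fin 3

/-- The polynomial ring in the Cox coordinates. -/
abbrev CoxRing : Type := MvPolynomial CoxIndex ℂ

/-- The equation of the exceptional divisor. -/
abbrev cS : CoxRing := MvPolynomial.X (.inl ())

/-- The coordinates `y`. -/
abbrev cY (i : Fin 5) : CoxRing := MvPolynomial.X (.inr (.inl i))

/-- The coordinates `v`. -/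
abbrev cV (i : Fin 3) : CoxRing := MvPolynomial.X (.inr (.inr i))

/-- The coordinates `u`. -/
abbrev cU (i : Fin 3) : CoxRing := cY (Fin.castAdd 2 i)

variable (d : CubicForm ℂ) (j : Fin 5) (k : Fin 3)

/-- The relation `Q(v) = s q`. -/
def coxRel : CoxRing := quad (MvPolynomial.C ∘ d.a) cV - cS * cY 4

/-- The equation of the strict transform. -/
def coxPsi : CoxRing := (d.map MvPolynomial.C).cox cS cU (cY 3) (cY 4) cV

/-- The point with given Cox coordinates. -/
abbrev coxPoint (s : ℂ) (y : Fin 5 → ℂ) (v : Fin 3 → ℂ) : CoxIndex → ℂ :=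
  Sum.elim (fun _ => s) (Sum.elim y v)

theorem exists_coxPoint (p : CoxIndex → ℂ) : ∃ s y v, p = coxPoint s y v :=
  ⟨p (.inl ()), fun i => p (.inr (.inl i)), fun i => p (.inr (.inr i)), by
    ext (_ | _ | _) <;> rfl⟩

variable (s : ℂ) (y : Fin 5 → ℂ) (v : Fin 3 → ℂ)

theorem eval_comp_C {σ ι : Type*} (p : σ → ℂ) (a : ι → ℂ) :
    eval p ∘ MvPolynomial.C ∘ a = a := by
  ext i
  simp

theorem map_C_map_eval {σ : Type*} (p : σ → ℂ) : (d.map MvPolynomial.C).map (eval p) = d := by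
  cases d
  simp [CubicForm.map, eval_comp_C]

theorem eval_comp_cV : eval (coxPoint s y v) ∘ cV = v := by
  ext i
  simp

theorem eval_comp_cU : eval (coxPoint s y v) ∘ cU = fun i => y (Fin.castAdd 2 i) := by
  ext i
  simp

theorem eval_coxRel : eval (coxPoint s y v) (coxRel d) = quad d.a v - s * y 4 := by
  rw [coxRel, map_sub, map_quad, eval_comp_C, eval_comp_cV]
  simp

theorem eval_coxPsi : eval (coxPoint s y v) (coxPsi d) =
    d.cox s (fun i => y (Fin.castAdd 2 i)) (y 3) (y 4) v := by
  rw [coxPsi, CubicForm.map_cox, map_C_map_eval, eval_comp_cV, eval_comp_cU]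
  simp

theorem eval_pderiv_coxRel (w : CoxIndex) : eval (coxPoint s y v) (pderiv w (coxRel d)) =
    coxPoint (- y 4) (fun i => if i = 4 then - s else 0) (quadGrad d.a v) w := by
  rw [coxRel, map_sub, derivation_quad _ _ (by simp), Derivation.leibniz, map_sub, map_sum]
  simp only [map_mul, map_quadGrad, eval_comp_C, eval_comp_cV]
  rcases w with w | i | i
  · simp [MvPolynomial.pderiv_X]
  · by_cases h : i = 4 <;> simp [MvPolynomial.pderiv_X, h, eq_comm]
  · simp [MvPolynomial.pderiv_X, Pi.single_apply]

theorem eval_pderiv_coxPsi (w : CoxIndex) : eval (coxPoint s y v) (pderiv w (coxPsi d)) =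
    coxPoint (d.coxS (fun i => y (Fin.castAdd 2 i)) (y 3))
      (Fin.append (m := 3) (n := 2)
        (d.coxU s (fun i => y (Fin.castAdd 2 i)) (y 3) (y 4) v)
        ![d.coxZ s (fun i => y (Fin.castAdd 2 i)) (y 3) (y 4) v,
          lin (fun i => y (Fin.castAdd 2 i)) + y 3])
      (d.coxV (fun i => y (Fin.castAdd 2 i)) (y 3)) w := by
  rw [coxPsi, CubicForm.derivation_cox _ _ (by simp) (by simp) (by simp) (by simp)]
  simp only [map_add, map_mul, map_sum, CubicForm.map_coxS, CubicForm.map_coxU,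
    CubicForm.map_coxZ, CubicForm.map_coxV, map_lin, map_C_map_eval, eval_comp_cV, eval_comp_cU]
  rcases w with w | i | i
  · simp [MvPolynomial.pderiv_X]
  · fin_cases i <;> simp [MvPolynomial.pderiv_X, Pi.single_apply, Fin.sum_univ_three, Fin.append, Fin.addCases]
  · simp [MvPolynomial.pderiv_X, Pi.single_apply]

variable (d : CubicForm ℂ) (j : Fin 5) (k : Fin 3)

theorem eval_pderiv_cS (p : CoxIndex → ℂ) (w : CoxIndex) :
    eval p (pderiv w cS) = coxPoint 1 0 0 w := by
  rcases w with w | i | i <;> simp [MvPolynomial.pderiv_X]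

theorem eval_pderiv_cY_sub_one (p : CoxIndex → ℂ) (w : CoxIndex) :
    eval p (pderiv w (cY j - 1)) = coxPoint 0 (Pi.single j 1) 0 w := by
  rcases w with w | i | i <;> simp [MvPolynomial.pderiv_X, Pi.single_apply, eq_comm]

theorem eval_pderiv_cV_sub_one (p : CoxIndex → ℂ) (w : CoxIndex) :
    eval p (pderiv w (cV k - 1)) = coxPoint 0 0 (Pi.single k 1) w := by
  rcases w with w | i | i <;> simp [MvPolynomial.pderiv_X, Pi.single_apply, eq_comm]

theorem eval_cY_sub_one (s : ℂ) (y : Fin 5 → ℂ) (v : Fin 3 → ℂ) :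
    eval (coxPoint s y v) (cY j - 1) = y j - 1 := by
  simp

theorem eval_cV_sub_one (s : ℂ) (y : Fin 5 → ℂ) (v : Fin 3 → ℂ) :
    eval (coxPoint s y v) (cV k - 1) = v k - 1 := by
  simp

theorem eval_cS (s : ℂ) (y : Fin 5 → ℂ) (v : Fin 3 → ℂ) :
    eval (coxPoint s y v) cS = s := by
  simp

/-- The relations normalizing one of the coordinates `y` and one of the coordinates `v`. -/
abbrev normalization : Fin 2 → CoxRing := ![cY j - 1, cV k - 1]

theorem isTransversal_normalization : IsTransversal (normalization j k) := by
  intro p _ c hc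
  have h1 := hc (.inr (.inl j))
  have h2 := hc (.inr (.inr k))
  simp only [Fin.sum_univ_two, Matrix.cons_val, eval_pderiv_cY_sub_one, eval_pderiv_cV_sub_one,
    Sum.elim_inr, Sum.elim_inl, Pi.single_eq_same, Pi.zero_apply, mul_one, mul_zero, add_zero,
    zero_add] at h1 h2
  ext i
  fin_cases i
  · exact h1
  · exact h2

theorem isTransversal_cS : IsTransversal (Matrix.vecCons cS (normalization j k)) := by
  intro p _ c hc
  have h0 := hc (.inl ())
  have h1 := hc (.inr (.inl j))
  have h2 := hc (.inr (.inr k))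
  simp only [Fin.sum_univ_three, Matrix.cons_val, eval_pderiv_cY_sub_one, eval_pderiv_cV_sub_one,
    eval_pderiv_cS, Sum.elim_inr, Sum.elim_inl, Pi.single_eq_same, Pi.zero_apply, mul_one, mul_zero,
    add_zero, zero_add] at h0 h1 h2
  ext i
  fin_cases i
  · exact h0
  · exact h1
  · exact h2

theorem sum_single_eq {n : ℕ} (y : Fin n → ℂ) (c : ℂ) (j : Fin n) :
    ∑ i, y i * (c * (Pi.single j 1 : Fin n → ℂ) i) = c * y j := by
  simp [Pi.single_apply, mul_comm]

theorem sum_mul_quadGrad (a : Fin 6 → ℂ) (v : Fin 3 → ℂ) :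
    ∑ i, v i * quadGrad a v i = 2 * quad a v := by
  rw [Fin.sum_univ_three, quad_euler]

theorem ne_zero_of_apply_eq_one {ι : Type*} {v : ι → ℂ} {k : ι} (hk : v k = 1) : v ≠ 0 := by
  rintro rfl
  simp at hk

/-- On `s = 0` the `v`-derivatives involve only `Q(v)` and `vₖ - 1`. Euler's relation for `Q` kills
the multiplier of the latter, and nondegeneracy of `Q` that of the former. -/
theorem isTransversal_cS_coxRel (hd : IsGenericSide d) :
    IsTransversal (Matrix.vecCons cS (Matrix.vecCons (coxRel d) (normalization j k))) := by
  intro p hp c hc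
  obtain ⟨s, y, v, rfl⟩ := exists_coxPoint p
  have hs := hp 0
  have hg := hp 1
  have hk := hp 3
  have h0 := hc (.inl ())
  have h1 := hc (.inr (.inl j))
  have h2 := fun i => hc (.inr (.inr i))
  simp only [Matrix.cons_val, eval_cS, eval_coxRel, eval_cV_sub_one, sub_eq_zero] at hs hg hk
  simp only [Fin.sum_univ_four, Matrix.cons_val, eval_pderiv_cY_sub_one, eval_pderiv_cV_sub_one,
    eval_pderiv_cS, eval_pderiv_coxRel, Sum.elim_inr, Sum.elim_inl, Pi.single_eq_same,
    Pi.zero_apply, mul_one, mul_zero, add_zero, zero_add, hs, neg_zero, ite_self, mul_neg]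
    at h0 h1 h2
  have h3 : c 3 = 0 := by
    have := Finset.sum_congr rfl fun i (_ : i ∈ Finset.univ) => congrArg (v i * ·) (h2 i)
    simp only [mul_add, Finset.sum_add_distrib, sum_single_eq, hk, mul_zero,
      Finset.sum_const_zero, mul_left_comm _ (c 1), ← Finset.mul_sum, sum_mul_quadGrad, hg, hs,
      zero_mul, zero_add, mul_one] at this
    exact this
  have h4 : c 1 = 0 := by
    obtain ⟨i, hi⟩ := Function.ne_iff.mp (hd.quadGrad_ne_zero v (ne_zero_of_apply_eq_one hk))
    have := h2 i
    rw [h3, zero_mul, add_zero] at this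
    exact (mul_eq_zero.mp this).resolve_right hi
  rw [h4, zero_mul, neg_zero, add_zero] at h0
  ext i
  fin_cases i
  · exact h0
  · exact h4
  · exact h1
  · exact h3

/-- Both equations are homogeneous for the two gradings, so the Euler relations eliminate the
multipliers of the normalizations `yⱼ = 1` and `vₖ = 1`. What remains is the Lagrange system of
`nonsingular`. -/
theorem isTransversal_coxPsi_coxRel (hd : IsGenericSide d) :
    IsTransversal (Matrix.vecCons (coxPsi d) (Matrix.vecCons (coxRel d) (normalization j k))) := by
  intro p hp c hc
  obtain ⟨s, y, v, rfl⟩ := exists_coxPoint p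
  have hP := hp 0
  have hg := hp 1
  have hj := hp 2
  have hk := hp 3
  have h0 := hc (.inl ())
  have h1 := fun i => hc (.inr (.inl i))
  have h2 := fun i => hc (.inr (.inr i))
  simp only [Matrix.cons_val, eval_coxPsi, eval_coxRel, eval_cV_sub_one, eval_cY_sub_one,
    sub_eq_zero] at hP hg hk hj
  set u : Fin 3 → ℂ := fun i => y (Fin.castAdd 2 i) with hu
  have hyu : ∀ i, u i = y (Fin.castAdd 2 i) := fun i => rfl
  simp only [Fin.sum_univ_four, Matrix.cons_val, eval_pderiv_cY_sub_one, eval_pderiv_cV_sub_one,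
    eval_pderiv_coxPsi, eval_pderiv_coxRel, Sum.elim_inr, Sum.elim_inl,
    Pi.zero_apply, mul_zero, add_zero, ← hu]
    at h0 h1 h2
  have e1 := d.cox_euler_y s u (y 3) (y 4) v
  have e2 := d.cox_euler_v s u (y 3) (y 4) v
  rw [hP] at e1 e2
  have hy1 : ∀ i, c 0 * d.coxU s u (y 3) (y 4) v i +
      c 2 * (Pi.single j 1 : Fin 5 → ℂ) (Fin.castAdd 2 i) = 0 := by
    intro i
    have := h1 (Fin.castAdd 2 i)
    rw [Fin.append_left] at this
    fin_cases i <;> simpa using this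
  have hy3 : c 0 * d.coxZ s u (y 3) (y 4) v + c 2 * (Pi.single j 1 : Fin 5 → ℂ) 3 = 0 := by
    have := h1 (Fin.natAdd 3 (0 : Fin 2))
    rw [Fin.append_right] at this
    simpa using this
  have hy4 : c 0 * (lin u + y 3) - c 1 * s + c 2 * (Pi.single j 1 : Fin 5 → ℂ) 4 = 0 := by
    have := h1 (Fin.natAdd 3 (1 : Fin 2))
    rw [Fin.append_right] at this
    simpa [sub_eq_add_neg] using this
  -- Contraction with the Euler field of the first grading, for which `coxRel` has weight `0`.
  have h3 : c 2 = 0 := by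
    have e3 := sum_single_eq y (c 2) j
    rw [hj, mul_one] at e3
    rw [← e3, Fin.sum_univ_five]
    simp only [Fin.sum_univ_three] at e1
    have k0 : c 0 * d.coxU s u (y 3) (y 4) v 0 + c 2 * (Pi.single j 1 : Fin 5 → ℂ) 0 = 0 := hy1 0
    have k1 : c 0 * d.coxU s u (y 3) (y 4) v 1 + c 2 * (Pi.single j 1 : Fin 5 → ℂ) 1 = 0 := hy1 1
    have k2 : c 0 * d.coxU s u (y 3) (y 4) v 2 + c 2 * (Pi.single j 1 : Fin 5 → ℂ) 2 = 0 := hy1 2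
    rw [show u 0 = y 0 from rfl, show u 1 = y 1 from rfl, show u 2 = y 2 from rfl] at e1
    linear_combination y 0 * k0 + y 1 * k1 + y 2 * k2 + y 3 * hy3 + y 4 * hy4 - s * h0 -
      c 0 * e1
  -- Contraction with the Euler field of the second grading, for which `coxRel` has weight `2`.
  have h4 : c 3 = 0 := by
    have e3 := sum_single_eq v (c 3) k
    rw [hk, mul_one] at e3
    rw [← e3, Fin.sum_univ_three]
    have e4 := sum_mul_quadGrad d.a v
    simp only [Fin.sum_univ_three] at e2 e4
    linear_combination s * h0 + y 4 * hy4 + v 0 * h2 0 + v 1 * h2 1 + v 2 * h2 2 - c 0 * e2 -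
      c 1 * e4 - 2 * c 1 * hg - y 4 * (Pi.single j 1 : Fin 5 → ℂ) 4 * h3
  have hv := ne_zero_of_apply_eq_one hk
  simp only [h3, h4, zero_mul, add_zero] at hy1 hy3 hy4 h2
  have h5 : c 0 = 0 := by
    by_contra h
    refine hd.nonsingular s u (y 3) (y 4) v (-c 1 / c 0) hv ?_ hg ?_ ?_ ?_ ?_ ?_
    · rintro ⟨h6, h7, h8⟩
      have h9 : ∀ i, y i = 0 := by
        intro i
        fin_cases i
        · exact congrFun h6 0
        · exact congrFun h6 1
        · exact congrFun h6 2
        · exact h7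
        · exact h8
      rw [h9] at hj
      exact zero_ne_one hj
    · field_simp
      linear_combination hy4
    · field_simp
      linear_combination h0
    · ext i
      exact (mul_eq_zero.mp (hy1 i)).resolve_left h
    · exact (mul_eq_zero.mp hy3).resolve_left h
    · intro i
      field_simp
      linear_combination h2 i
  have h6 : c 1 = 0 := by
    obtain ⟨i, hi⟩ := Function.ne_iff.mp (hd.quadGrad_ne_zero v hv)
    have := h2 i
    rw [h5, zero_mul, zero_add] at this
    exact (mul_eq_zero.mp this).resolve_right hi
  ext i
  fin_cases i
  · exact h5
  · exact h6
  · exact h3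
  · exact h4

/-! ### The affine charts of the blowup of the conic -/

/-- A form vanishing on the whole plane `vₖ = 1` has no monomial containing `vₖ`, so its gradient at
the `k`-th unit vector would be zero. A few sample points suffice to see this. -/
theorem exists_quad_ne_zero {a : Fin 6 → ℂ} (ha : ∀ v : Fin 3 → ℂ, v ≠ 0 → quadGrad a v ≠ 0)
    (k : Fin 3) : ∃ v : Fin 3 → ℂ, v k = 1 ∧ quad a v ≠ 0 := by
  by_contra! h
  fin_cases k
  · have h1 := h ![1, 0, 0] rfl
    have h2 := h ![1, 1, 0] rfl
    have h3 := h ![1, -1, 0] rfl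
    have h4 := h ![1, 0, 1] rfl
    have h5 := h ![1, 0, -1] rfl
    apply ha ![1, 0, 0] (ne_zero_of_apply_eq_one (k := 0) rfl)
    simp only [quad, Matrix.cons_val] at h1 h2 h3 h4 h5
    ext i
    fin_cases i <;> simp [quadGrad]
    · linear_combination h1
    · linear_combination (h2 - h3) / 2
    · linear_combination (h4 - h5) / 2
  · have h1 := h ![0, 1, 0] rfl
    have h2 := h ![1, 1, 0] rfl
    have h3 := h ![-1, 1, 0] rfl
    have h4 := h ![0, 1, 1] rfl
    have h5 := h ![0, 1, -1] rfl
    apply ha ![0, 1, 0] (ne_zero_of_apply_eq_one (k := 1) rfl)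
    simp only [quad, Matrix.cons_val] at h1 h2 h3 h4 h5
    ext i
    fin_cases i <;> simp [quadGrad]
    · linear_combination (h2 - h3) / 2
    · linear_combination h1
    · linear_combination (h4 - h5) / 2
  · have h1 := h ![0, 0, 1] rfl
    have h2 := h ![1, 0, 1] rfl
    have h3 := h ![-1, 0, 1] rfl
    have h4 := h ![0, 1, 1] rfl
    have h5 := h ![0, -1, 1] rfl
    apply ha ![0, 0, 1] (ne_zero_of_apply_eq_one (k := 2) rfl)
    simp only [quad, Matrix.cons_val] at h1 h2 h3 h4 h5
    ext i
    fin_cases i <;> simp [quadGrad]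
    · linear_combination (h2 - h3) / 2
    · linear_combination (h4 - h5) / 2
    · linear_combination h1

theorem exists_add_mul_sq_ne_zero (a b : ℂ) (ha : a ≠ 0) : ∃ t : ℂ, a * t + b * t ^ 2 ≠ 0 := by
  by_contra! h
  exact ha (by linear_combination (h 1 - h (-1)) / 2)

variable (d : CubicForm ℂ) (j : Fin 5) (k : Fin 3)

/-- `cox` is affine in `q` with slope `lin u + z`, which is `1` at the unit vector `eⱼ` when `yⱼ` is
not `q`. If `yⱼ` is `q`, then on `u = (t, 0, 0)`, `z = 0` the value is a polynomial in `t` with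
linear coefficient `1`. -/
theorem exists_cox_ne_zero (v : Fin 3 → ℂ) : ∃ y : Fin 5 → ℂ, y j = 1 ∧
    d.cox 0 (fun i => y (Fin.castAdd 2 i)) (y 3) (y 4) v ≠ 0 := by
  by_cases hj : j = 4
  · subst hj
    obtain ⟨t, ht⟩ := exists_add_mul_sq_ne_zero 1 (d.b 0 * lin v) one_ne_zero
    refine ⟨![t, 0, 0, 0, 1], rfl, ?_⟩
    convert ht using 1
    simp [CubicForm.cox, quad, lin]
    ring
  · have key : ∀ t, d.cox 0 (fun i => (Pi.single j 1 + Pi.single 4 t : Fin 5 → ℂ) (Fin.castAdd 2 i))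
        ((Pi.single j 1 + Pi.single 4 t : Fin 5 → ℂ) 3)
        ((Pi.single j 1 + Pi.single 4 t : Fin 5 → ℂ) 4) v = t +
        d.cox 0 (fun i => (Pi.single j 1 : Fin 5 → ℂ) (Fin.castAdd 2 i))
        ((Pi.single j 1 : Fin 5 → ℂ) 3) ((Pi.single j 1 : Fin 5 → ℂ) 4) v := by
      intro t
      fin_cases j <;> first | exact absurd rfl hj | skip
      all_goals
        simp [CubicForm.cox, quad, lin, CubicForm.bil, Fin.sum_univ_three, Pi.single_apply]
    obtain ⟨t, ht⟩ : ∃ t : ℂ, t + d.cox 0 (fun i => (Pi.single j 1 : Fin 5 → ℂ) (Fin.castAdd 2 i))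
        ((Pi.single j 1 : Fin 5 → ℂ) 3) ((Pi.single j 1 : Fin 5 → ℂ) 4) v ≠ 0 :=
      ⟨1 - _, by rw [sub_add_cancel]; exact one_ne_zero⟩
    refine ⟨Pi.single j 1 + Pi.single 4 t, by simp [hj], ?_⟩
    rw [key]
    exact ht

theorem coxPoint_line (s s' t : ℂ) (y y' : Fin 5 → ℂ) (v v' : Fin 3 → ℂ) :
    (fun i => coxPoint s y v i + t * (coxPoint s' y' v' i - coxPoint s y v i)) =
      coxPoint (s + t * (s' - s)) (fun i => y i + t * (y' i - y i))
        (fun i => v i + t * (v' i - v i)) := by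
  ext (_ | _ | _) <;> rfl

/-- The ideal of a chart of the blowup of the conic. -/
abbrev coxIdeal : Ideal CoxRing :=
  Ideal.span (Set.range (Matrix.vecCons (coxRel d) (normalization j k)))

variable {d}

/-- Modulo `s` the relation becomes `Q(v)`, which is easily seen to be regular. Interchanging the
two members of the regular sequence gives regularity of `s` modulo the relation. -/
theorem isRegularMod_cS (hd : IsGenericSide d) : IsRegularMod (coxIdeal d j k) cS := by
  rw [coxIdeal, span_range_vecCons]
  apply IsRegularMod.swap
  · refine (isTransversal_normalization j k).isRegularMod fun p hp => ?_
    obtain ⟨s, y, v, rfl⟩ := exists_coxPoint p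
    refine ⟨coxPoint 1 y v, by simp, fun t i => ?_⟩
    have h0 := hp 0
    have h1 := hp 1
    rw [coxPoint_line]
    fin_cases i <;> simp_all [sub_eq_zero]
  · rw [← span_range_vecCons]
    refine (isTransversal_cS j k).isRegularMod fun p hp => ?_
    obtain ⟨s, y, v, rfl⟩ := exists_coxPoint p
    obtain ⟨v', hv', hv⟩ := exists_quad_ne_zero hd.quadGrad_ne_zero k
    refine ⟨coxPoint 0 y v', by simpa [eval_coxRel] using hv, fun t i => ?_⟩
    have h0 := hp 0
    have h1 := hp 1
    have h2 := hp 2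
    rw [coxPoint_line]
    fin_cases i <;> simp_all [sub_eq_zero]

/-- The same interchange: modulo `s` the ideal leaves `y` free apart from `yⱼ = 1`, so `coxPsi` can
be made nonzero by moving `y` along a line. -/
theorem isRegularMod_cS_coxPsi (hd : IsGenericSide d) :
    IsRegularMod (coxIdeal d j k ⊔ Ideal.span {coxPsi d}) cS := by
  apply (isRegularMod_cS j k hd).swap
  rw [coxIdeal, ← span_range_vecCons]
  refine (isTransversal_cS_coxRel d j k hd).isRegularMod fun p hp => ?_
  obtain ⟨s, y, v, rfl⟩ := exists_coxPoint p
  obtain ⟨y', hj, hy⟩ := exists_cox_ne_zero d j v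
  refine ⟨coxPoint 0 y' v, by rwa [eval_coxPsi], fun t i => ?_⟩
  have h0 := hp 0
  have h1 := hp 1
  have h2 := hp 2
  have h3 := hp 3
  rw [coxPoint_line]
  simp only [Matrix.cons_val, eval_cS, eval_coxRel, eval_cV_sub_one, eval_cY_sub_one,
    sub_eq_zero] at h0 h1 h2 h3
  subst h0
  fin_cases i <;> simp [eval_coxRel, *]

/-! ### Comparison of the Cox coordinates with the affine charts of `ℙ⁶` -/

/-- The variables `x₁, x₂, x₃`. -/
abbrev xU (i : Fin 3) : MvPolynomial (Fin 7) ℂ := x (Fin.castAdd 4 i)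

/-- The variables `x₅, x₆, x₇`. -/
abbrev xV (i : Fin 3) : MvPolynomial (Fin 7) ℂ := x (Fin.natAdd 4 i)

variable (d : CubicForm ℂ) (j : Fin 5) (k : Fin 3)

/-- The cubic polynomial of a cubic form. -/
def CubicForm.poly : MvPolynomial (Fin 7) ℂ := (d.map MvPolynomial.C).psi xU (x 3) xV

/-- The equations of the conic `C`. -/
def conicGens : Fin 5 → MvPolynomial (Fin 7) ℂ :=
  ![x 0, x 1, x 2, x 3, quad (MvPolynomial.C ∘ d.a) xV]

/-- A point of the affine cone of `ℙ⁶`. -/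
abbrev conePoint (u : Fin 3 → ℂ) (z : ℂ) (v : Fin 3 → ℂ) : Fin 7 → ℂ :=
  ![u 0, u 1, u 2, z, v 0, v 1, v 2]

theorem exists_conePoint (p : Fin 7 → ℂ) : ∃ u z v, p = conePoint u z v :=
  ⟨fun i => p (Fin.castAdd 4 i), p 3, fun i => p (Fin.natAdd 4 i), by
    ext i
    fin_cases i <;> rfl⟩

variable (u : Fin 3 → ℂ) (z : ℂ) (v : Fin 3 → ℂ)

theorem conePoint_castAdd (i : Fin 3) : conePoint u z v (Fin.castAdd 4 i) = u i := by
  fin_cases i <;> rfl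

theorem conePoint_natAdd (i : Fin 3) : conePoint u z v (Fin.natAdd 4 i) = v i := by
  fin_cases i <;> rfl

theorem eval_comp_xU : eval (conePoint u z v) ∘ xU = u := by
  ext i
  rw [Function.comp_apply, MvPolynomial.eval_X, conePoint_castAdd]

theorem eval_comp_xV : eval (conePoint u z v) ∘ xV = v := by
  ext i
  rw [Function.comp_apply, MvPolynomial.eval_X, conePoint_natAdd]

theorem eval_poly : eval (conePoint u z v) d.poly = d.psi u z v := by
  rw [CubicForm.poly, CubicForm.map_psi, map_C_map_eval, eval_comp_xU, eval_comp_xV]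
  simp

theorem eval_conicGens : (fun i => eval (conePoint u z v) (conicGens d i)) =
    ![u 0, u 1, u 2, z, quad d.a v] := by
  ext i
  fin_cases i <;> simp [conicGens, map_quad, eval_comp_C, eval_comp_xV]

theorem isTransversal_x_sub_one (k : Fin 7) : IsTransversal ![x k - 1] := by
  intro p _ c hc
  have := hc k
  ext i
  fin_cases i
  simpa using this

theorem isRegularMod_x_sub_one {f : MvPolynomial (Fin 7) ℂ} {q : Fin 7 → ℂ} (k : Fin 7)
    (hk : q k = 1) (hq : eval q f ≠ 0) : IsRegularMod (Ideal.span {x k - 1}) f := by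
  have h := (isTransversal_x_sub_one k).isRegularMod (f := f) fun p hp => ⟨q, hq, fun t i => by
    have h0 := hp 0
    fin_cases i
    simp_all [sub_eq_zero]⟩
  rwa [Matrix.range_cons, Matrix.range_empty, Set.union_empty] at h

variable {d}

theorem isRegularMod_poly (hd : IsGenericSide d) :
    IsRegularMod (Ideal.span {x (Fin.natAdd 4 k) - 1}) d.poly := by
  obtain ⟨v, hk, hv⟩ := exists_quad_ne_zero hd.quadGrad_ne_zero k
  -- At `u = (t, 0, 0)`, `z = 0` the cubic has the value `Q(v) t + b₀ lin(v) t²`.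
  obtain ⟨t, ht⟩ := exists_add_mul_sq_ne_zero (quad d.a v) (d.b 0 * lin v) hv
  refine isRegularMod_x_sub_one (q := conePoint ![t, 0, 0] 0 v) _
    (by rw [conePoint_natAdd, hk]) ?_
  rw [eval_poly]
  convert ht using 1
  simp [CubicForm.psi, quad, lin]
  ring

theorem isRegularMod_conicGens (hd : IsGenericSide d) :
    IsRegularMod (Ideal.span {x (Fin.natAdd 4 k) - 1}) (conicGens d j) := by
  obtain ⟨v, hk, hv⟩ := exists_quad_ne_zero hd.quadGrad_ne_zero k
  refine isRegularMod_x_sub_one (q := conePoint 1 1 v) _ (by rw [conePoint_natAdd, hk]) ?_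
  rw [congrFun (eval_conicGens d 1 1 v) j]
  fin_cases j <;> simp [hv]

/-- Expressing the coordinates of `ℙ⁶` in Cox coordinates. -/
def coxSubst : MvPolynomial (Fin 7) ℂ →ₐ[ℂ] CoxRing :=
  MvPolynomial.aeval ![cS * cY 0, cS * cY 1, cS * cY 2, cS * cY 3, cV 0, cV 1, cV 2]

theorem coxSubst_xU (i : Fin 3) : coxSubst (xU i) = cS * cU i := by
  fin_cases i <;> simp [coxSubst]

theorem coxSubst_xV (i : Fin 3) : coxSubst (xV i) = cV i := by
  fin_cases i <;> simp [coxSubst]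

theorem coxSubst_x3 : coxSubst (x 3) = cS * cY 3 := by
  simp [coxSubst]

theorem coxSubst_comp_C {ι : Type*} (a : ι → ℂ) :
    (coxSubst : MvPolynomial (Fin 7) ℂ →+* CoxRing) ∘ MvPolynomial.C ∘ a =
      MvPolynomial.C ∘ a := by
  ext1 i
  exact coxSubst.commutes (a i)

theorem coxSubst_quad (a : Fin 6 → ℂ) :
    coxSubst (quad (MvPolynomial.C ∘ a) xV) = quad (MvPolynomial.C ∘ a) cV := by
  have h := map_quad (coxSubst : MvPolynomial (Fin 7) ℂ →+* CoxRing) (MvPolynomial.C ∘ a) xV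
  rw [coxSubst_comp_C] at h
  refine h.trans (congrArg _ ?_)
  ext1 i
  exact coxSubst_xV i

theorem coxSubst_poly (d : CubicForm ℂ) : coxSubst d.poly =
    (d.map MvPolynomial.C).psi (fun i => cS * cU i) (cS * cY 3) cV := by
  have h := CubicForm.map_psi (d.map MvPolynomial.C)
    (coxSubst : MvPolynomial (Fin 7) ℂ →+* CoxRing) xU (x 3) xV
  have h1 : (d.map MvPolynomial.C).map (coxSubst : MvPolynomial (Fin 7) ℂ →+* CoxRing) =
      d.map MvPolynomial.C := by
    simp only [CubicForm.map, coxSubst_comp_C]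
    congr 1
    ext1 i
    ext1 j
    exact coxSubst.commutes _
  rw [h1] at h
  refine h.trans ?_
  congr 1
  · ext1 i
    exact coxSubst_xU i
  · exact coxSubst_x3
  · ext1 i
    exact coxSubst_xV i

theorem eval_coxSubst (s : ℂ) (y : Fin 5 → ℂ) (v : Fin 3 → ℂ) (r : MvPolynomial (Fin 7) ℂ) :
    eval (coxPoint s y v) (coxSubst r) =
      eval (conePoint (fun i => s * y (Fin.castAdd 2 i)) (s * y 3) v) r := by
  rw [coxSubst, MvPolynomial.aeval_def, MvPolynomial.eval_eval₂]
  have h : (eval (coxPoint s y v)).comp (algebraMap ℂ CoxRing) = RingHom.id ℂ := by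
    ext1 c
    simp
  rw [h]
  change MvPolynomial.eval₂ _ _ _ = MvPolynomial.eval₂ _ _ _
  congr 1
  ext i
  fin_cases i <;> simp

/-! ### Coordinate rings of the charts of the blowup of the conic. -/

/-- The coordinate ring of a chart of the blowup of the conic. -/
abbrev CoxChart (d : CubicForm ℂ) (j : Fin 5) (k : Fin 3) : Type := CoxRing ⧸ coxIdeal d j k

/-- The quotient map to the coordinate ring of a chart of the blowup of the conic. -/
abbrev toCoxChart (d : CubicForm ℂ) (j : Fin 5) (k : Fin 3) : CoxRing →+* CoxChart d j k :=
  Ideal.Quotient.mk _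

variable (d)

theorem toCoxChart_coxRel : toCoxChart d j k (coxRel d) = 0 :=
  Ideal.Quotient.eq_zero_iff_mem.mpr (Ideal.subset_span ⟨0, rfl⟩)

theorem toCoxChart_cY : toCoxChart d j k (cY j) = 1 := by
  rw [← sub_eq_zero, ← map_one (toCoxChart d j k), ← map_sub]
  exact Ideal.Quotient.eq_zero_iff_mem.mpr (Ideal.subset_span ⟨1, rfl⟩)

theorem toCoxChart_cV : toCoxChart d j k (cV k) = 1 := by
  rw [← sub_eq_zero, ← map_one (toCoxChart d j k), ← map_sub]
  exact Ideal.Quotient.eq_zero_iff_mem.mpr (Ideal.subset_span ⟨2, rfl⟩)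

theorem toCoxChart_coxSubst_conicGens (i : Fin 5) :
    toCoxChart d j k (coxSubst (conicGens d i)) =
      toCoxChart d j k cS * toCoxChart d j k (cY i) := by
  by_cases h : i = 4
  · subst h
    have h1 : coxSubst (conicGens d 4) = coxRel d + cS * cY 4 := by
      rw [coxRel, sub_add_cancel]
      exact coxSubst_quad d.a
    rw [h1, map_add, toCoxChart_coxRel, zero_add, map_mul]
  · have h1 : coxSubst (conicGens d i) = cS * cY i := by
      fin_cases i <;> first | exact absurd rfl h | simp [conicGens, coxSubst]
    rw [h1, map_mul]

theorem toCoxChart_coxSubst_poly :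
    toCoxChart d j k (coxSubst d.poly) =
      toCoxChart d j k cS ^ 2 * toCoxChart d j k (coxPsi d) := by
  rw [← map_pow, ← map_mul, ← sub_eq_zero, ← map_sub]
  have h : coxSubst d.poly - cS ^ 2 * coxPsi d = coxRel d * (cS * (lin cU + cY 3)) := by
    rw [coxSubst_poly, coxPsi]
    simp only [CubicForm.psi, CubicForm.cox, coxRel, quad_smul, CubicForm.map_a, CubicForm.bil,
      Fin.sum_univ_three, lin]
    ring
  rw [h, map_mul, toCoxChart_coxRel, zero_mul]

variable {d}

/-- The chart agrees with `ℙ⁶` after inverting `s`: both `s` and all `s yᵢ` are images of equations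
of the conic. -/
theorem exists_pow_mul_eq_coxSubst (b : CoxChart d j k) : ∃ (n : ℕ) (r : MvPolynomial (Fin 7) ℂ),
    toCoxChart d j k cS ^ n * b = toCoxChart d j k (coxSubst r) := by
  obtain ⟨a, rfl⟩ := Ideal.Quotient.mk_surjective b
  have hs : toCoxChart d j k cS = toCoxChart d j k (coxSubst (conicGens d j)) := by
    rw [toCoxChart_coxSubst_conicGens, toCoxChart_cY, mul_one]
  induction a using MvPolynomial.induction_on with
  | C c => exact ⟨0, MvPolynomial.C c, by
      rw [pow_zero, one_mul]
      exact congrArg _ (coxSubst.commutes c).symm⟩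
  | add p q hp hq =>
    obtain ⟨n, r, h⟩ := hp
    obtain ⟨m, r', h'⟩ := hq
    refine ⟨n + m, conicGens d j ^ m * r + conicGens d j ^ n * r', ?_⟩
    simp only [map_add, map_mul, map_pow, ← h, ← h', ← hs]
    ring
  | mul_X p i hp =>
    obtain ⟨n, r, h⟩ := hp
    rcases i with i | i | i
    · refine ⟨n, r * conicGens d j, ?_⟩
      rw [map_mul, map_mul, map_mul, ← h, ← hs, mul_assoc]
    · refine ⟨n + 1, r * conicGens d i, ?_⟩
      rw [map_mul, map_mul, map_mul, ← h, toCoxChart_coxSubst_conicGens]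
      ring
    · refine ⟨n, r * xV i, ?_⟩
      rw [map_mul, map_mul, map_mul, ← h, coxSubst_xV, mul_assoc]

/-- The chart dominates the corresponding chart of `ℙ⁶`. A point where the `j`-th equation of the
conic is nonzero lifts to Cox coordinates, so `r` vanishes there. Hence the product of `r` with this
equation vanishes on the whole chart, and the equation is a nonzerodivisor. -/
theorem mem_span_of_coxSubst_mem (hd : IsGenericSide d) {r : MvPolynomial (Fin 7) ℂ}
    (hr : coxSubst r ∈ coxIdeal d j k) : r ∈ Ideal.span {x (Fin.natAdd 4 k) - 1} := by
  apply isRegularMod_conicGens j k hd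
  have h := mem_span_of_jacobian _ (isTransversal_x_sub_one (Fin.natAdd 4 k)) (conicGens d j * r)
    fun p hp => ?_
  · rwa [Matrix.range_cons, Matrix.range_empty, Set.union_empty] at h
  obtain ⟨u, z, v, rfl⟩ := exists_conePoint p
  have h0 := hp 0
  simp only [Matrix.cons_val_fin_one, map_sub, MvPolynomial.eval_X, conePoint_natAdd, map_one,
    sub_eq_zero] at h0
  rw [map_mul]
  set s := eval (conePoint u z v) (conicGens d j) with hs
  by_cases h1 : s = 0
  · rw [h1, zero_mul]
  · let y : Fin 5 → ℂ := fun i => s⁻¹ * eval (conePoint u z v) (conicGens d i)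
    have hy : ∀ i, s * y i = (![u 0, u 1, u 2, z, quad d.a v] : Fin 5 → ℂ) i := fun i => by
      rw [mul_inv_cancel_left₀ h1]
      exact congrFun (eval_conicGens d u z v) i
    have h2 : eval (coxPoint s y v) (coxSubst r) = 0 := by
      refine eval_eq_zero_of_mem_span (fun i => ?_) hr
      fin_cases i
      · change eval _ (coxRel d) = 0
        rw [eval_coxRel, hy 4]
        exact sub_self _
      · change MvPolynomial.eval _ (cY j - 1) = 0
        rw [eval_cY_sub_one, sub_eq_zero]
        exact inv_mul_cancel₀ h1
      · change MvPolynomial.eval _ (cV k - 1) = 0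
        rw [eval_cV_sub_one, h0, sub_self]
    rw [eval_coxSubst, hy 3] at h2
    have h3 : (fun i => s * y (Fin.castAdd 2 i)) = u := by
      ext i
      rw [hy]
      fin_cases i <;> rfl
    rw [h3] at h2
    rw [show eval (conePoint u z v) r = 0 from h2, mul_zero]

theorem toCoxChart_cS_mem_nonZeroDivisors (hd : IsGenericSide d) :
    toCoxChart d j k cS ∈ nonZeroDivisors (CoxChart d j k) := by
  rw [mem_nonZeroDivisors_iff_right]
  intro b hb
  obtain ⟨a, rfl⟩ := Ideal.Quotient.mk_surjective b
  rw [mul_comm, ← map_mul, Ideal.Quotient.eq_zero_iff_mem] at hb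
  exact Ideal.Quotient.eq_zero_iff_mem.mpr (isRegularMod_cS j k hd _ hb)

/-- An element killed by `coxPsi` becomes, after multiplication by a power of `s`, the image of an
element of the chart of `ℙ⁶` killed by the cubic. That element is zero, and `s` can be cancelled. -/
theorem toCoxChart_coxPsi_mem_nonZeroDivisors (hd : IsGenericSide d) :
    toCoxChart d j k (coxPsi d) ∈ nonZeroDivisors (CoxChart d j k) := by
  rw [mem_nonZeroDivisors_iff_right]
  intro b hb
  obtain ⟨n, r, hr⟩ := exists_pow_mul_eq_coxSubst j k b
  have h1 : toCoxChart d j k (coxSubst (d.poly * r)) = 0 := by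
    rw [map_mul, map_mul, ← hr, toCoxChart_coxSubst_poly]
    linear_combination toCoxChart d j k cS ^ (2 + n) * hb
  have h2 := isRegularMod_poly k hd _
    (mem_span_of_coxSubst_mem j k hd (Ideal.Quotient.eq_zero_iff_mem.mp h1))
  obtain ⟨r', rfl⟩ := Ideal.mem_span_singleton'.mp h2
  rw [map_mul, map_mul, map_sub, map_sub, map_one, map_one, coxSubst_xV, toCoxChart_cV, sub_self,
    mul_zero] at hr
  exact (mem_nonZeroDivisors_iff.mp (pow_mem (toCoxChart_cS_mem_nonZeroDivisors j k hd) n)).1 _ hr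

theorem IsTransversal.isRadical {ι σ : Type*} [Fintype ι] [Fintype σ]
    {g : ι → MvPolynomial σ ℂ} (hg : IsTransversal g) :
    (Ideal.span (Set.range g)).IsRadical := by
  rintro a ⟨n, ha⟩
  refine mem_span_of_jacobian g hg a fun p hp => ?_
  have := eval_eq_zero_of_mem_span hp ha
  rw [map_pow] at this
  exact eq_zero_of_pow_eq_zero this

theorem isRadical_map_mk {R : Type*} [CommRing R] {I J : Ideal R} (h : (J ⊔ I).IsRadical) :
    (J.map (Ideal.Quotient.mk I)).IsRadical := by
  rintro b ⟨n, hb⟩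
  obtain ⟨a, rfl⟩ := Ideal.Quotient.mk_surjective b
  rw [← map_pow, Ideal.mem_quotient_iff_mem_sup] at hb
  exact Ideal.mem_quotient_iff_mem_sup.mpr (h ⟨n, hb⟩)

theorem IsRegularMod.map_mk {R : Type*} [CommRing R] {I J : Ideal R} {s : R}
    (h : IsRegularMod (J ⊔ I) s) :
    IsRegularMod (J.map (Ideal.Quotient.mk I)) (Ideal.Quotient.mk I s) := by
  intro b hb
  obtain ⟨a, rfl⟩ := Ideal.Quotient.mk_surjective b
  rw [← map_mul, Ideal.mem_quotient_iff_mem_sup] at hb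
  exact Ideal.mem_quotient_iff_mem_sup.mpr (h _ hb)

theorem span_singleton_mk {R : Type*} [CommRing R] (I : Ideal R) (a : R) :
    Ideal.span {Ideal.Quotient.mk I a} = (Ideal.span {a}).map (Ideal.Quotient.mk I) := by
  rw [Ideal.map_span, Set.image_singleton]

theorem smooth_spec_of_algebra {R : Type} [CommRing R] [Algebra ℂ R] [h : Algebra.Smooth ℂ R] :
    Smooth (Spec.map (CommRingCat.ofHom (algebraMap ℂ R))) :=
  HasRingHomProperty.Spec_iff.mpr (RingHom.smooth_algebraMap.mpr h)

theorem smooth_quotient_quotient {σ : Type} [Fintype σ] {n : ℕ} {f : MvPolynomial σ ℂ}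
    {g : Fin n → MvPolynomial σ ℂ} (h : IsTransversal (Matrix.vecCons f g)) :
    Algebra.Smooth ℂ ((MvPolynomial σ ℂ ⧸ Ideal.span (Set.range g)) ⧸
      Ideal.span {Ideal.Quotient.mk (Ideal.span (Set.range g)) f}) := by
  have h1 := smooth_of_jacobian _ h
  rw [span_range_vecCons] at h1
  rw [span_singleton_mk]
  exact Algebra.Smooth.of_equiv (DoubleQuot.quotQuotEquivQuotSupₐ ℂ (Ideal.span (Set.range g))
    (Ideal.span {f})).symm

variable (d : CubicForm ℂ) (j : Fin 5) (k : Fin 3)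

theorem eval_pderiv_quad_xV (u : Fin 3 → ℂ) (z : ℂ) (v : Fin 3 → ℂ) (w : Fin 7) :
    eval (conePoint u z v) (pderiv w (quad (MvPolynomial.C ∘ d.a) xV)) =
      conePoint 0 0 (quadGrad d.a v) w := by
  rw [derivation_quad _ _ (by simp), map_sum]
  simp only [map_mul, map_quadGrad, eval_comp_C, eval_comp_xV, Fin.sum_univ_three]
  fin_cases w <;> simp [MvPolynomial.pderiv_X]

/-- Transversality makes the ideal generated by the equations of `C` radical, so they generate the
ideal of the reduced centre used in the blowup. -/
theorem isTransversal_conicGens (hd : IsGenericSide d) :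
    IsTransversal (Matrix.vecCons (x (Fin.natAdd 4 k) - 1) (conicGens d)) := by
  intro p hp c hc
  obtain ⟨u, z, v, rfl⟩ := exists_conePoint p
  have hk := hp 0
  have hq := hp 5
  simp only [Matrix.cons_val, conicGens, map_quad, eval_comp_C, eval_comp_xV, map_sub,
    MvPolynomial.eval_X, conePoint_natAdd, map_one, sub_eq_zero] at hk hq
  have hD : ∀ w, c 0 * (Pi.single (Fin.natAdd 4 k) 1 : Fin 7 → ℂ) w +
      (c 1 * (Pi.single 0 1 : Fin 7 → ℂ) w + c 2 * (Pi.single 1 1 : Fin 7 → ℂ) w +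
        c 3 * (Pi.single 2 1 : Fin 7 → ℂ) w + c 4 * (Pi.single 3 1 : Fin 7 → ℂ) w) +
        c 5 * conePoint 0 0 (quadGrad d.a v) w = 0 := by
    intro w
    refine Eq.trans ?_ (hc w)
    rw [Fin.sum_univ_six]
    simp only [Matrix.cons_val, conicGens, eval_pderiv_quad_xV, map_sub,
      Derivation.map_one_eq_zero, sub_zero, MvPolynomial.pderiv_X]
    have : ∀ i : Fin 7, eval (conePoint u z v) ((Pi.single w 1 : Fin 7 → MvPolynomial (Fin 7) ℂ) i) =
        (Pi.single i 1 : Fin 7 → ℂ) w := by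
      intro i
      by_cases h : i = w
      · subst h
        simp
      · rw [Pi.single_eq_of_ne h, Pi.single_eq_of_ne (Ne.symm h), map_zero]
    simp only [this]
    ring
  have hv : ∀ i, c 0 * (Pi.single k 1 : Fin 3 → ℂ) i + c 5 * quadGrad d.a v i = 0 := by
    intro i
    have := hD (Fin.natAdd 4 i)
    rw [conePoint_natAdd] at this
    fin_cases i <;> fin_cases k <;> simpa [Pi.single_apply] using this
  have h0 : c 0 = 0 := by
    have e1 := sum_single_eq v (c 0) k
    have e2 := sum_mul_quadGrad d.a v
    rw [hk, mul_one] at e1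
    rw [← e1]
    simp only [Fin.sum_univ_three] at e2 ⊢
    linear_combination v 0 * hv 0 + v 1 * hv 1 + v 2 * hv 2 - c 5 * e2 - 2 * c 5 * hq
  have h5 : c 5 = 0 := by
    obtain ⟨i, hi⟩ := Function.ne_iff.mp (hd.quadGrad_ne_zero v (ne_zero_of_apply_eq_one hk))
    have := hv i
    rw [h0, zero_mul, zero_add] at this
    exact (mul_eq_zero.mp this).resolve_right hi
  have h1 := hD 0
  have h2 := hD 1
  have h3 := hD 2
  have h4 := hD 3
  simp [h0, h5] at h1 h2 h3 h4
  ext i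
  fin_cases i
  exacts [h0, h1, h2, h3, h4, h5]

/-- The comparison between charts of `ℙ⁶` and of the blowup of the conic. -/
def chartToCoxChart : ChartRing (Fin.natAdd 4 k) →+* CoxChart d j k :=
  Ideal.Quotient.lift _ ((toCoxChart d j k).comp (coxSubst : MvPolynomial (Fin 7) ℂ →+* CoxRing))
    (fun a ha => by
      obtain ⟨b, rfl⟩ := Ideal.mem_span_singleton'.mp ha
      have h : toCoxChart d j k (coxSubst (xV k - 1)) = 0 := by
        rw [map_sub, map_one, map_sub, map_one, coxSubst_xV, toCoxChart_cV, sub_self]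
      rw [map_mul]
      exact (congrArg _ h).trans (mul_zero _))

theorem chartToCoxChart_conicGens (i : Fin 5) :
    chartToCoxChart d j k (toChart _ (conicGens d i)) =
      toCoxChart d j k cS * toCoxChart d j k (cY i) :=
  toCoxChart_coxSubst_conicGens d j k i

theorem chartToCoxChart_conicGens_self :
    chartToCoxChart d j k (toChart _ (conicGens d j)) = toCoxChart d j k cS := by
  rw [chartToCoxChart_conicGens, toCoxChart_cY, mul_one]

/-- `s` goes to the image of the `j`-th equation and `yᵢ` to the quotient of the `i`-th by it. The
relation `Q(v) = s q` is then automatic, and `yⱼ = 1` follows by cancelling a nonzerodivisor. -/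
theorem exists_lift_coxChart {A : Type*} [CommRing A] (ψ : ChartRing (Fin.natAdd 4 k) →+* A)
    (h : ψ (toChart _ (conicGens d j)) ∈ nonZeroDivisors A)
    (h' : ∀ i, ψ (toChart _ (conicGens d j)) ∣ ψ (toChart _ (conicGens d i))) :
    ∃ χ : CoxChart d j k →+* A, χ.comp (chartToCoxChart d j k) = ψ := by
  choose y hy using h'
  set s := ψ (toChart _ (conicGens d j)) with hs
  let r : ℂ →+* A := (ψ.comp (toChart _)).comp MvPolynomial.C
  let χ₀ : CoxRing →+* A := MvPolynomial.eval₂Hom r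
    (Sum.elim (fun _ => s) (Sum.elim y (fun i => ψ (toChart _ (xV i)))))
  have hC : ∀ a : Fin 6 → ℂ, χ₀ ∘ MvPolynomial.C ∘ a = r ∘ a := fun a => by
    ext i
    exact MvPolynomial.eval₂Hom_C _ _ _
  have hV : ∀ i, χ₀ (cV i) = ψ (toChart _ (xV i)) := fun i => MvPolynomial.eval₂Hom_X' _ _ _
  have hY : ∀ i, χ₀ (cY i) = y i := fun i => MvPolynomial.eval₂Hom_X' _ _ _
  have hS : χ₀ cS = s := MvPolynomial.eval₂Hom_X' _ _ _
  have hQ : χ₀ (quad (MvPolynomial.C ∘ d.a) cV) = s * y 4 := by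
    rw [map_quad, hC, ← hy]
    change _ = (ψ.comp (toChart _)) (quad (MvPolynomial.C ∘ d.a) xV)
    rw [map_quad]
    congr 1
    ext i
    exact hV i
  refine ⟨Ideal.Quotient.lift _ χ₀ fun a ha => ?_, ?_⟩
  · have : coxIdeal d j k ≤ RingHom.ker χ₀ := by
      rw [Ideal.span_le]
      rintro _ ⟨i, rfl⟩
      fin_cases i
      · change χ₀ (coxRel d) = 0
        rw [coxRel, map_sub, hQ, map_mul, hS, hY, sub_self]
      · change χ₀ (cY j - 1) = 0
        have h1 := hy j
        rw [map_sub, map_one, hY, sub_eq_zero]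
        exact ((mem_nonZeroDivisors_iff.mp h).1 (y j - 1) (by rw [mul_sub, ← h1, mul_one, sub_self]) |>
          sub_eq_zero.mp)
      · change χ₀ (cV k - 1) = 0
        rw [map_sub, map_one, hV, toChart_x, map_one, sub_self]
    exact this ha
  · refine Ideal.Quotient.ringHom_ext (MvPolynomial.ringHom_ext (fun c => ?_) fun i => ?_)
    · change χ₀ (coxSubst (MvPolynomial.C c)) = _
      rw [← MvPolynomial.algebraMap_eq, coxSubst.commutes]
      exact MvPolynomial.eval₂Hom_C _ _ _
    · change χ₀ (coxSubst (MvPolynomial.X i)) = ψ (toChart _ (x i))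
      have h1 : ∀ i : Fin 3, χ₀ (coxSubst (xV i)) = ψ (toChart _ (xV i)) := fun i => by
        rw [coxSubst_xV, hV]
      fin_cases i
      · exact (by simp [coxSubst, hS, hY] : χ₀ (coxSubst (x 0)) = s * y 0).trans (hy 0).symm
      · exact (by simp [coxSubst, hS, hY] : χ₀ (coxSubst (x 1)) = s * y 1).trans (hy 1).symm
      · exact (by simp [coxSubst, hS, hY] : χ₀ (coxSubst (x 2)) = s * y 2).trans (hy 2).symm
      · exact (by simp [coxSubst, hS, hY] : χ₀ (coxSubst (x 3)) = s * y 3).trans (hy 3).symm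
      · exact h1 0
      · exact h1 1
      · exact h1 2

theorem coxChart_hom_ext {A : Type*} [CommRing A] {χ χ' : CoxChart d j k →+* A}
    (h : χ.comp (chartToCoxChart d j k) = χ'.comp (chartToCoxChart d j k))
    (hs : χ (chartToCoxChart d j k (toChart _ (conicGens d j))) ∈ nonZeroDivisors A) : χ = χ' := by
  have h' : ∀ r, χ (toCoxChart d j k (coxSubst r)) = χ' (toCoxChart d j k (coxSubst r)) :=
    fun r => RingHom.congr_fun h (toChart _ r)
  have hS : χ (toCoxChart d j k cS) = χ' (toCoxChart d j k cS) := by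
    rw [← chartToCoxChart_conicGens_self]
    exact h' _
  rw [chartToCoxChart_conicGens_self] at hs
  refine Ideal.Quotient.ringHom_ext (MvPolynomial.ringHom_ext (fun c => ?_) fun i => ?_)
  · have := h' (MvPolynomial.C c)
    rwa [← MvPolynomial.algebraMap_eq, coxSubst.commutes] at this
  · rcases i with i | i | i
    · exact hS
    · change χ (toCoxChart d j k (cY i)) = χ' (toCoxChart d j k (cY i))
      have := h' (conicGens d i)
      rw [toCoxChart_coxSubst_conicGens, map_mul, map_mul, ← hS] at this
      exact sub_eq_zero.mp ((mem_nonZeroDivisors_iff.mp hs).1 _ (by rw [mul_sub, this, sub_self]))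
    · have := h' (xV i)
      rwa [coxSubst_xV] at this

/-- The blowup and the strict transform over a chart of `ℙ⁶` meeting the conic. -/
def conicChart {d : CubicForm ℂ} (hd : IsGenericSide d) (k : Fin 3) {Cn Y : Closeds P6}
    (u : Spec (CommRingCat.of (ChartRing (Fin.natAdd 4 k))) ⟶ P6) (hu : IsOpenImmersion u)
    (hs : u ≫ P6.toSpec =
      Spec.map (CommRingCat.ofHom (algebraMap ℂ (ChartRing (Fin.natAdd 4 k)))))
    (hC : (u ⁻¹' Cn : Set (PrimeSpectrum (ChartRing (Fin.natAdd 4 k)))) =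
      PrimeSpectrum.zeroLocus (Set.range fun i => toChart _ (conicGens d i)))
    (hY : (u ⁻¹' Y : Set (PrimeSpectrum (ChartRing (Fin.natAdd 4 k)))) =
      PrimeSpectrum.zeroLocus {toChart _ d.poly}) :
    BlowupChart P6.toSpec Cn Y where
  R := CommRingCat.of (ChartRing (Fin.natAdd 4 k))
  u := u
  isOpenImmersion_u := hu
  J := Fin 5
  f i := toChart _ (conicGens d i)
  F := toChart _ d.poly
  B j := CommRingCat.of (CoxChart d j k)
  φ j := CommRingCat.ofHom (chartToCoxChart d j k)
  vanishingIdeal_center := by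
    have h := (isTransversal_conicGens d k hd).isRadical
    rw [span_range_vecCons] at h
    have h' := (isRadical_map_mk h).radical
    rw [Ideal.map_span, ← Set.range_comp] at h'
    refine (congrArg _ hC).trans ?_
    rw [← PrimeSpectrum.zeroLocus_span, PrimeSpectrum.vanishingIdeal_zeroLocus_eq_radical]
    exact h'
  preimage_eq := hY
  mem_nonZeroDivisors j := by
    change chartToCoxChart d j k _ ∈ nonZeroDivisors (CoxChart d j k)
    rw [chartToCoxChart_conicGens_self]
    exact toCoxChart_cS_mem_nonZeroDivisors j k hd
  dvd j i := by
    change chartToCoxChart d j k _ ∣ chartToCoxChart d j k _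
    rw [chartToCoxChart_conicGens_self, chartToCoxChart_conicGens]
    exact dvd_mul_right _ _
  exists_lift j A ψ h h' := by
    obtain ⟨χ, hχ⟩ := exists_lift_coxChart d j k ψ.hom h h'
    exact ⟨CommRingCat.ofHom χ, CommRingCat.hom_ext hχ⟩
  lift_unique j A χ χ' h hs :=
    CommRingCat.hom_ext (coxChart_hom_ext d j k (congrArg CommRingCat.Hom.hom h) hs)
  G j := toCoxChart d j k (coxPsi d)
  -- The cubic lies in the square of the ideal `(u, z, Q(v))`.
  n := 2
  map_eq j := by
    change chartToCoxChart d j k _ = chartToCoxChart d j k _ ^ 2 * _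
    rw [chartToCoxChart_conicGens_self]
    exact toCoxChart_coxSubst_poly d j k
  G_mem_nonZeroDivisors j := toCoxChart_coxPsi_mem_nonZeroDivisors j k hd
  isRegularMod j := by
    change IsRegularMod (Ideal.span {toCoxChart d j k (coxPsi d)}) (chartToCoxChart d j k _)
    rw [chartToCoxChart_conicGens_self, span_singleton_mk]
    apply IsRegularMod.map_mk
    rw [sup_comm]
    exact isRegularMod_cS_coxPsi j k hd
  isRadical j := by
    have := smooth_quotient_quotient (isTransversal_coxPsi_coxRel d j k hd)
    exact (Ideal.isRadical_iff_quotient_reduced _).mpr (isReduced_of_smooth ℂ _)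
  smooth j := by
    have := smooth_quotient_quotient (isTransversal_coxPsi_coxRel d j k hd)
    have h : quotientι (A := CommRingCat.of (CoxChart d j k))
        (Ideal.span {toCoxChart d j k (coxPsi d)} : Ideal (CoxChart d j k)) ≫
        Spec.map (CommRingCat.ofHom (chartToCoxChart d j k)) ≫ u ≫ P6.toSpec =
        Spec.map (CommRingCat.ofHom (algebraMap ℂ
          (CoxChart d j k ⧸ Ideal.span {toCoxChart d j k (coxPsi d)}))) := by
      rw [hs, ← Spec.map_comp, ← Spec.map_comp]
      congr 1
      ext c
      exact congrArg (fun t => Ideal.Quotient.mk _ (toCoxChart d j k t)) (coxSubst.commutes c)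
    exact h ▸ smooth_spec_of_algebra

/-! ### The chart containing the point `u = v = 0` -/

theorem quadGrad_zero (a : Fin 6 → ℂ) : quadGrad a 0 = 0 := by
  ext i
  fin_cases i <;> simp [quadGrad]

section

variable (d : CubicForm ℂ) (u : Fin 3 → ℂ) (z : ℂ) (v : Fin 3 → ℂ)

theorem eval_pderiv_poly (w : Fin 7) : eval (conePoint u z v) (pderiv w d.poly) =
    conePoint (d.coxU 1 u z (quad d.a v) v) (d.coxZ 1 u z (quad d.a v) v)
      (fun i => (lin u + z) * quadGrad d.a v i + d.coxV u z i) w := by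
  rw [CubicForm.poly, CubicForm.psi_eq_cox, CubicForm.derivation_cox _ _ (by simp) (by simp)
    (by simp) (by simp), CubicForm.map_a, derivation_quad _ _ (by simp)]
  simp only [map_add, map_mul, CubicForm.map_coxS, CubicForm.map_coxU,
    CubicForm.map_coxZ, CubicForm.map_coxV, map_lin, map_C_map_eval, eval_comp_xV, eval_comp_xU,
    map_quad, map_quadGrad, eval_comp_C, Fin.sum_univ_three]
  fin_cases w <;> simp [MvPolynomial.pderiv_X]

/-- Such a point has Cox coordinates `s = 1`, `q = Q(v)`, and the chain rule for `psi_eq_cox`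
produces the multiplier `l = -(lin u + z)`. -/
theorem false_of_singular (hd : IsGenericSide d) (hv : v ≠ 0) (hz : z ≠ 0) (h : d.psi u z v = 0)
    (hD : ∀ w, eval (conePoint u z v) (pderiv w d.poly) = 0) : False := by
  have hU : ∀ i, d.coxU 1 u z (quad d.a v) v i = 0 := fun i => by
    have := hD (Fin.castAdd 4 i)
    rwa [eval_pderiv_poly, conePoint_castAdd] at this
  have hZ : d.coxZ 1 u z (quad d.a v) v = 0 := by
    have := hD 3
    rwa [eval_pderiv_poly] at this
  have hV : ∀ i, (lin u + z) * quadGrad d.a v i + d.coxV u z i = 0 := fun i => by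
    have := hD (Fin.natAdd 4 i)
    rwa [eval_pderiv_poly, conePoint_natAdd] at this
  refine hd.nonsingular 1 u z (quad d.a v) v (-(lin u + z)) hv (fun h => hz h.2.1)
    (one_mul _).symm (by ring) ?_ (funext hU) hZ fun i => by linear_combination hV i
  have := d.cox_euler_y 1 u z (quad d.a v) v
  rw [← d.psi_eq_cox, h] at this
  simp only [hU, hZ, mul_zero, Finset.sum_const_zero] at this
  linear_combination -this

/-! ### The symmetry exchanging the two conics. -/

/-- Interchanging the two triples of variables. -/
def swapVar : Fin 7 → Fin 7 := ![4, 5, 6, 3, 0, 1, 2]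

theorem swapVar_swapVar (i : Fin 7) : swapVar (swapVar i) = i := by
  fin_cases i <;> rfl

theorem swapVar_castAdd (i : Fin 3) : swapVar (Fin.castAdd 4 i) = Fin.natAdd 4 i := by
  fin_cases i <;> rfl

theorem swapVar_natAdd (i : Fin 3) : swapVar (Fin.natAdd 4 i) = Fin.castAdd 4 i := by
  fin_cases i <;> rfl

theorem conePoint_comp_swapVar : conePoint u z v ∘ swapVar = conePoint v z u := by
  ext i
  fin_cases i <;> rfl

/-- The automorphism of the polynomial ring interchanging the two triples of variables. -/
def renameSwap : MvPolynomial (Fin 7) ℂ ≃ₐ[ℂ] MvPolynomial (Fin 7) ℂ :=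
  MvPolynomial.renameEquiv ℂ ⟨swapVar, swapVar, swapVar_swapVar, swapVar_swapVar⟩

theorem renameSwap_x (i : Fin 7) : renameSwap (x i) = x (swapVar i) :=
  MvPolynomial.rename_X _ _

theorem renameSwap_xU (i : Fin 3) : renameSwap (xU i) = xV i := by
  rw [renameSwap_x, swapVar_castAdd]

theorem renameSwap_xV (i : Fin 3) : renameSwap (xV i) = xU i := by
  rw [renameSwap_x, swapVar_natAdd]

theorem renameSwap_C (c : ℂ) : renameSwap (MvPolynomial.C c) = MvPolynomial.C c :=
  renameSwap.commutes c

theorem renameSwap_poly : renameSwap d.poly = d.swap.poly := by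
  have h : ∀ r : MvPolynomial (Fin 7) ℂ →+* MvPolynomial (Fin 7) ℂ, (∀ a, r (.C a) = .C a) →
      (d.map MvPolynomial.C).map r = d.map MvPolynomial.C := by
    intro r hr
    simp only [CubicForm.map, hr, Function.comp_def]
  have h1 := CubicForm.map_psi (d.map MvPolynomial.C)
    (renameSwap : MvPolynomial (Fin 7) ℂ →+* MvPolynomial (Fin 7) ℂ) xU (x 3) xV
  rw [h _ renameSwap_C] at h1
  refine h1.trans ?_
  rw [CubicForm.poly, ← CubicForm.psi_swap]
  congr 1
  · ext1 i
    exact renameSwap_xV i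
  · exact renameSwap_x 3
  · ext1 i
    exact renameSwap_xU i

theorem eval_pderiv_swap_poly (w : Fin 7) :
    eval (conePoint v z u) (pderiv w d.swap.poly) =
      eval (conePoint u z v) (pderiv (swapVar w) d.poly) := by
  have h : Function.Injective swapVar :=
    Function.LeftInverse.injective swapVar_swapVar
  have h1 : d.swap.poly = MvPolynomial.rename swapVar d.poly := (renameSwap_poly d).symm
  rw [h1]
  conv_lhs => rw [← swapVar_swapVar w]
  rw [MvPolynomial.pderiv_rename h, MvPolynomial.eval_rename, conePoint_comp_swapVar]

theorem isTransversal_poly (hd : IsGeneric d) : IsTransversal ![d.poly, x 3 - 1] := by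
  intro p hp c hc
  obtain ⟨u, z, v, rfl⟩ := exists_conePoint p
  have h0 := hp 0
  have h1 := hp 1
  simp only [Matrix.cons_val, map_sub, MvPolynomial.eval_X, map_one, sub_eq_zero] at h0 h1
  rw [eval_poly] at h0
  subst h1
  have hD : ∀ w, c 0 * eval (conePoint u 1 v) (pderiv w d.poly) +
      c 1 * (Pi.single 3 1 : Fin 7 → ℂ) w = 0 := by
    intro w
    refine Eq.trans ?_ (hc w)
    rw [Fin.sum_univ_two]
    simp only [Matrix.cons_val, map_sub, Derivation.map_one_eq_zero, sub_zero,
      MvPolynomial.pderiv_X]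
    congr 2
    by_cases h : w = 3
    · subst h
      simp
    · rw [Pi.single_eq_of_ne h, Pi.single_eq_of_ne (Ne.symm h), map_zero]
  have hU : ∀ i, c 0 * d.coxU 1 u 1 (quad d.a v) v i = 0 := fun i => by
    have := hD (Fin.castAdd 4 i)
    rw [eval_pderiv_poly, conePoint_castAdd, Pi.single_eq_of_ne (by fin_cases i <;> decide)] at this
    rw [← this, mul_zero, add_zero]
  have hZ : c 0 * d.coxZ 1 u 1 (quad d.a v) v + c 1 = 0 := by
    have := hD 3
    rw [eval_pderiv_poly, Pi.single_eq_same, mul_one] at this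
    exact this
  have hV : ∀ i, c 0 * ((lin u + 1) * quadGrad d.a v i + d.coxV u 1 i) = 0 := fun i => by
    have := hD (Fin.natAdd 4 i)
    rw [eval_pderiv_poly, conePoint_natAdd, Pi.single_eq_of_ne (by fin_cases i <;> decide)] at this
    rw [← this, mul_zero, add_zero]
  have e1 := d.cox_euler_y 1 u 1 (quad d.a v) v
  have e2 := d.cox_euler_v 1 u 1 (quad d.a v) v
  have e3 := sum_mul_quadGrad d.a v
  rw [← d.psi_eq_cox, h0] at e1 e2
  -- Euler's relation for the cubic, assembled from the two Euler relations of `cox` and that of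
  -- `Q`.
  have hc1 : c 1 = 0 := by
    simp only [Fin.sum_univ_three] at e1 e2 e3
    linear_combination hZ + u 0 * hU 0 + u 1 * hU 1 + u 2 * hU 2 + v 0 * hV 0 + v 1 * hV 1 +
      v 2 * hV 2 - c 0 * (e1 + e2 + (lin u + 1) * e3)
  have hc0 : c 0 = 0 := by
    by_contra hne
    have hD' : ∀ w, eval (conePoint u 1 v) (pderiv w d.poly) = 0 := fun w => by
      have := hD w
      rw [hc1, zero_mul, add_zero] at this
      exact (mul_eq_zero.mp this).resolve_left hne
    -- The condition over `C` handles `v ≠ 0`, the one over `C'` handles `u ≠ 0`, and the remaining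
    -- point is excluded by `ne_zero`.
    by_cases hv : v = 0
    · by_cases hu : u = 0
      · subst hu hv
        have h2 : ∀ i, d.α i = 0 := fun i => by
          simpa [hne, CubicForm.coxU, quad, lin, quadGrad_zero] using hU i
        have h3 : ∀ i, d.β i = 0 := fun i => by
          simpa [hne, CubicForm.coxV, quad, lin, quadGrad_zero] using hV i
        exact hd.ne_zero.elim (fun h => h (funext h2)) (fun h => h (funext h3))
      · exact false_of_singular d.swap v 1 u hd.right hu one_ne_zero (by rw [d.psi_swap, h0])
          fun w => by rw [eval_pderiv_swap_poly, hD']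
    · exact false_of_singular d u 1 v hd.left hv one_ne_zero h0 hD'
  ext i
  fin_cases i
  · exact hc0
  · exact hc1

end

theorem toChart_poly_mem_nonZeroDivisors {d : CubicForm ℂ} (hd : IsGeneric d) :
    toChart 3 d.poly ∈ nonZeroDivisors (ChartRing 3) := by
  have h : IsRegularMod (Ideal.span {x 3 - 1}) d.poly := by
    obtain ⟨u, -, hu⟩ := exists_quad_ne_zero hd.right.quadGrad_ne_zero 0
    obtain ⟨t, ht⟩ := exists_add_mul_sq_ne_zero (quad d.b u) (∑ i, d.α i * u i) hu
    have ht0 : t ≠ 0 := by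
      rintro rfl
      simp at ht
    refine isRegularMod_x_sub_one (q := conePoint (fun i => t⁻¹ * u i) 1 0) 3 rfl ?_
    rw [eval_poly]
    -- `t³` times the value of the cubic at this point is `Q'(u) t + (α · u) t²`.
    intro h0
    apply ht
    have : d.psi (fun i => t⁻¹ * u i) 1 0 =
        t⁻¹ ^ 2 * quad d.b u + t⁻¹ * ∑ i, d.α i * u i := by
      simp only [CubicForm.psi, quad_smul, CubicForm.bil, Fin.sum_univ_three]
      simp [quad, lin]
      ring
    rw [this] at h0
    field_simp at h0
    linear_combination t * h0
  rw [mem_nonZeroDivisors_iff_right]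
  intro b hb
  obtain ⟨a, rfl⟩ := Ideal.Quotient.mk_surjective b
  rw [mul_comm, ← map_mul, Ideal.Quotient.eq_zero_iff_mem] at hb
  exact Ideal.Quotient.eq_zero_iff_mem.mpr (h _ hb)

/-- The cubic over the chart `x₄ ≠ 0` of `ℙ⁶`, which does not meet the centre. -/
def middleChart {d : CubicForm ℂ} (hd : IsGeneric d) {Cn Y : Closeds P6}
    (hC : (chart 3 ⁻¹' Cn : Set (PrimeSpectrum (ChartRing 3))) = ∅)
    (hY : (chart 3 ⁻¹' Y : Set (PrimeSpectrum (ChartRing 3))) =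
      PrimeSpectrum.zeroLocus {toChart _ d.poly}) :
    BlowupChart P6.toSpec Cn Y where
  R := CommRingCat.of (ChartRing 3)
  u := chart 3
  isOpenImmersion_u := inferInstance
  J := Unit
  -- The centre is empty here, so the ideal is the unit ideal and the blowup is the identity.
  f _ := 1
  F := toChart _ d.poly
  B _ := CommRingCat.of (ChartRing 3)
  φ _ := 𝟙 _
  vanishingIdeal_center := by
    refine (congrArg _ hC).trans ?_
    rw [PrimeSpectrum.vanishingIdeal_empty, Set.range_const, Ideal.span_singleton_one]
  preimage_eq := hY
  mem_nonZeroDivisors _ := one_mem _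
  dvd _ _ := dvd_rfl
  exists_lift _ A ψ _ _ := ⟨ψ, Category.id_comp _⟩
  lift_unique _ A χ χ' h _ := by rwa [Category.id_comp, Category.id_comp] at h
  G _ := toChart _ d.poly
  n := 0
  map_eq _ := by rw [pow_zero, one_mul]; rfl
  G_mem_nonZeroDivisors _ := toChart_poly_mem_nonZeroDivisors hd
  isRegularMod _ := fun a ha => by rwa [map_one, one_mul] at ha
  isRadical _ := by
    have := smooth_quotient_quotient (isTransversal_poly d hd)
    rw [Matrix.range_cons, Matrix.range_empty, Set.union_empty] at this
    exact (Ideal.isRadical_iff_quotient_reduced _).mpr (isReduced_of_smooth ℂ _)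
  smooth _ := by
    have := smooth_quotient_quotient (isTransversal_poly d hd)
    rw [Matrix.range_cons, Matrix.range_empty, Set.union_empty] at this
    have h : quotientι (A := CommRingCat.of (ChartRing 3))
        (Ideal.span {toChart 3 d.poly} : Ideal (ChartRing 3)) ≫
        Spec.map (𝟙 _) ≫ chart 3 ≫ P6.toSpec =
        Spec.map (CommRingCat.ofHom (algebraMap ℂ
          (ChartRing 3 ⧸ Ideal.span {toChart 3 d.poly}))) := by
      rw [chart_toSpec, Spec.map_id, Category.id_comp, ← Spec.map_comp]
      rfl
    exact h ▸ smooth_spec_of_algebra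

/-! ### From coefficients to cubic forms -/

/-- The six monomials of degree two in three variables. -/
abbrev quadIndex : Fin 6 → QuadIndex :=
  ![⟨(0, 0), by decide⟩, ⟨(0, 1), by decide⟩, ⟨(0, 2), by decide⟩, ⟨(1, 1), by decide⟩,
    ⟨(1, 2), by decide⟩, ⟨(2, 2), by decide⟩]

theorem sum_quadIndex {M : Type*} [AddCommMonoid M] (f : QuadIndex → M) :
    ∑ p, f p = ∑ i, f (quadIndex i) := by
  have h : Function.Bijective quadIndex := by decide
  exact (h.sum_comp f).symm

/-- The fifteen monomials of the quadric `𝒜`. -/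
abbrev bilinIndex : (Fin 3 × Fin 3) ⊕ Fin 3 ⊕ Fin 3 → BilinIndex :=
  Sum.elim (fun p => ⟨(p.1.castSucc, p.2.succ), by
      intro h
      have := congrArg Prod.snd h
      exact Fin.succ_ne_zero _ this⟩)
    (Sum.elim (fun i => ⟨(i.castSucc, 0), by
        intro h
        have := congrArg Prod.fst h
        exact (Fin.castSucc_lt_last i).ne this⟩)
      (fun j => ⟨(3, j.succ), by
        intro h
        have := congrArg Prod.snd h
        exact Fin.succ_ne_zero _ this⟩))

theorem sum_bilinIndex {M : Type*} [AddCommMonoid M] (f : BilinIndex → M) :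
    ∑ p, f p = ∑ i, f (bilinIndex i) := by
  have h : Function.Bijective bilinIndex := by decide
  exact (h.sum_comp f).symm

/-- The cubic form with given coefficients. -/
def ofCoeff (c : CoeffIndex → ℂ) : CubicForm ℂ where
  a i := c (.inl (quadIndex i))
  b i := c (.inr (.inl (quadIndex i)))
  M i j := c (.inr (.inr (bilinIndex (.inl (i, j)))))
  α i := c (.inr (.inr (bilinIndex (.inr (.inl i)))))
  β j := c (.inr (.inr (bilinIndex (.inr (.inr j)))))

variable (c : CoeffIndex → ℂ)

theorem Q_eq : Q c = quad (MvPolynomial.C ∘ (ofCoeff c).a) xV := by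
  rw [Q, sum_quadIndex]
  simp only [Fin.sum_univ_six, quad, ofCoeff, pow_two, Function.comp_apply, Matrix.cons_val]

theorem Q'_eq : Q' c = quad (MvPolynomial.C ∘ (ofCoeff c).b) xU := by
  rw [Q', sum_quadIndex]
  simp only [Fin.sum_univ_six, quad, ofCoeff, pow_two, Function.comp_apply, Matrix.cons_val]

/-- The quadric `𝒜` of a cubic form. -/
def CubicForm.quadric (d : CubicForm ℂ) : MvPolynomial (Fin 7) ℂ :=
  (d.map MvPolynomial.C).bil xU xV + x 3 * ∑ i, MvPolynomial.C (d.α i) * xU i +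
    x 3 * ∑ i, MvPolynomial.C (d.β i) * xV i

theorem x_castAdd_castSucc (i : Fin 3) : x (Fin.castAdd 3 i.castSucc) = xU i := by
  fin_cases i <;> rfl

theorem x_natAdd_succ (i : Fin 3) : x (Fin.natAdd 3 i.succ) = xV i := by
  fin_cases i <;> rfl

theorem x_natAdd_zero : x (Fin.natAdd 3 (0 : Fin 4)) = x 3 := rfl

theorem x_castAdd_three : x (Fin.castAdd 3 (3 : Fin 4)) = x 3 := rfl

theorem A_eq : A c = (ofCoeff c).quadric := by
  rw [A, sum_bilinIndex]
  simp only [Fintype.sum_sum_type, Fintype.sum_prod_type, CubicForm.quadric, CubicForm.bil,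
    Finset.mul_sum, bilinIndex, Sum.elim_inl, Sum.elim_inr, x_castAdd_castSucc, x_natAdd_succ,
    x_natAdd_zero, x_castAdd_three, CubicForm.map_M, ofCoeff]
  rw [← add_assoc]
  refine congrArg₂ _ (congrArg₂ _ rfl ?_) ?_ <;>
  · refine Finset.sum_congr rfl fun i _ => ?_
    ring

theorem lin_xU : lin xU = x 0 + x 1 + x 2 := rfl

theorem lin_xV : lin xV = x 4 + x 5 + x 6 := rfl

theorem Psi_eq : Psi c = (ofCoeff c).poly := by
  have h : (ofCoeff c).poly = quad (MvPolynomial.C ∘ (ofCoeff c).a) xV * (lin xU + x 3) +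
      quad (MvPolynomial.C ∘ (ofCoeff c).b) xU * (x 3 + lin xV) +
      x 3 * (ofCoeff c).quadric := rfl
  rw [h, Psi, A_eq, Q_eq, Q'_eq, lin_xU, lin_xV]
  ring

/-! ### The centre and the cubic in charts -/

/-- A polynomial vanishing at all complex zeros of a subset of a prime ideal is in the ideal. -/
theorem mem_of_vanishing {σ : Type*} [Finite σ] {P : Ideal (MvPolynomial σ ℂ)} (hP : P.IsPrime)
    {T : Set (MvPolynomial σ ℂ)} (hT : T ⊆ P) {f : MvPolynomial σ ℂ}
    (hf : ∀ p : σ → ℂ, (∀ t ∈ T, eval p t = 0) → eval p f = 0) : f ∈ P := by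
  have h : f ∈ (Ideal.span T).radical := by
    rw [← MvPolynomial.vanishingIdeal_zeroLocus_eq_radical (K := ℂ)]
    intro p hp
    exact hf p fun t ht => hp t (Ideal.subset_span ht)
  exact (hP.radical_le_iff.mpr (Ideal.span_le.mpr hT)) h

variable (d : CubicForm ℂ)

/-- The equations of the conic `C'`. -/
def conicGens' : Set (MvPolynomial (Fin 7) ℂ) :=
  {quad (MvPolynomial.C ∘ d.b) xU, x 3, x 4, x 5, x 6}

/-- The equations of `𝒮`. -/
def nodeGens : Set (MvPolynomial (Fin 7) ℂ) :=
  {quad (MvPolynomial.C ∘ d.a) xV, quad (MvPolynomial.C ∘ d.b) xU, x 3, lin xU, lin xV, d.quadric}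

theorem eval_quadric (u : Fin 3 → ℂ) (z : ℂ) (v : Fin 3 → ℂ) :
    eval (conePoint u z v) d.quadric =
      d.bil u v + z * ∑ i, d.α i * u i + z * ∑ i, d.β i * v i := by
  simp only [CubicForm.quadric, CubicForm.bil, map_add, map_mul, map_sum, CubicForm.map_M,
    MvPolynomial.eval_C, MvPolynomial.eval_X, conePoint_castAdd, conePoint_natAdd]
  rfl

/-- `C'` has `v = 0` and so misses the chart. A point of `𝒮` in the chart has `v ≠ 0`, so
`bil_ne_zero` forces `u = 0`, and it lies on `C`. -/
theorem zeroLocus_conicGens (hd : IsGenericSide d) (k : Fin 3) :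
    PrimeSpectrum.zeroLocus (toChart (Fin.natAdd 4 k) '' Set.range (conicGens d)) ∪
        PrimeSpectrum.zeroLocus (toChart (Fin.natAdd 4 k) '' conicGens' d) ∪
        PrimeSpectrum.zeroLocus (toChart (Fin.natAdd 4 k) '' nodeGens d) =
      PrimeSpectrum.zeroLocus (Set.range fun i => toChart (Fin.natAdd 4 k) (conicGens d i)) := by
  have h0 : (Set.range fun i => toChart (Fin.natAdd 4 k) (conicGens d i)) =
    toChart (Fin.natAdd 4 k) '' Set.range (conicGens d) := Set.range_comp _ _
  rw [h0]
  refine Set.Subset.antisymm (Set.union_subset (Set.union_subset subset_rfl ?_) ?_)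
    (Set.subset_union_left.trans Set.subset_union_left)
  · intro p hp
    refine (p.2.ne_top ((Ideal.eq_top_iff_one _).mpr ?_)).elim
    rw [← toChart_x (Fin.natAdd 4 k)]
    refine hp ⟨_, ?_, rfl⟩
    fin_cases k <;> simp [conicGens']
  · intro p hp
    let P := p.asIdeal.comap (toChart (Fin.natAdd 4 k))
    have hP : P.IsPrime := Ideal.comap_isPrime _ _
    have h1 : insert (x (Fin.natAdd 4 k) - 1) (nodeGens d) ⊆ P := by
      rw [Set.insert_subset_iff]
      refine ⟨?_, fun t ht => hp ⟨t, ht, rfl⟩⟩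
      change toChart _ (x (Fin.natAdd 4 k) - 1) ∈ p.asIdeal
      rw [map_sub, toChart_x, map_one, sub_self]
      exact zero_mem _
    rintro _ ⟨_, ⟨i, rfl⟩, rfl⟩
    refine mem_of_vanishing hP h1 (f := conicGens d i) fun pt hpt => ?_
    obtain ⟨u, z, v, rfl⟩ := exists_conePoint pt
    simp only [Set.mem_insert_iff, nodeGens, Set.mem_singleton_iff, forall_eq_or_imp, forall_eq,
      map_sub, map_one, MvPolynomial.eval_X, conePoint_natAdd, sub_eq_zero, map_quad, map_lin,
      eval_comp_C, eval_comp_xU, eval_comp_xV, eval_quadric] at hpt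
    obtain ⟨h1, h2, h3, h4, h5, h6, h7⟩ := hpt
    have hz : z = 0 := h4
    subst hz
    have hu : u = 0 := by
      by_contra hu
      exact hd.bil_ne_zero u v hu (ne_zero_of_apply_eq_one h1) h5 h6 h3 h2 (by simpa using h7)
    subst hu
    rw [congrFun (eval_conicGens d 0 0 v) i, h2]
    fin_cases i <;> rfl

variable (c : CoeffIndex → ℂ)

theorem conic_gens_eq : ({Q c, x 0, x 1, x 2, x 3} : Set (MvPolynomial (Fin 7) ℂ)) =
    Set.range (conicGens (ofCoeff c)) := by
  rw [Q_eq, conicGens]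
  simp only [Matrix.range_cons, Matrix.range_empty, Set.union_empty]
  ext
  simp only [Set.mem_insert_iff, Set.mem_singleton_iff, Set.mem_union]
  tauto

theorem conic'_gens_eq : ({Q' c, x 3, x 4, x 5, x 6} : Set (MvPolynomial (Fin 7) ℂ)) =
    conicGens' (ofCoeff c) := by
  rw [Q'_eq, conicGens']

theorem nodes_gens_eq : ({Q c, Q' c, x 3, x 0 + x 1 + x 2, x 4 + x 5 + x 6, A c} :
    Set (MvPolynomial (Fin 7) ℂ)) = nodeGens (ofCoeff c) := by
  rw [Q_eq, Q'_eq, A_eq, nodeGens, lin_xU, lin_xV]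

theorem Q_mem_grading : Q c ∈ grading 2 :=
  sum_mem fun _ _ => ((MvPolynomial.isHomogeneous_C _ _).mul
    ((x_mem_grading _).mul (x_mem_grading _)) : MvPolynomial.IsHomogeneous _ (0 + (1 + 1)))

theorem Q'_mem_grading : Q' c ∈ grading 2 :=
  sum_mem fun _ _ => ((MvPolynomial.isHomogeneous_C _ _).mul
    ((x_mem_grading _).mul (x_mem_grading _)) : MvPolynomial.IsHomogeneous _ (0 + (1 + 1)))

theorem A_mem_grading : A c ∈ grading 2 :=
  sum_mem fun _ _ => ((MvPolynomial.isHomogeneous_C _ _).mul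
    ((x_mem_grading _).mul (x_mem_grading _)) : MvPolynomial.IsHomogeneous _ (0 + (1 + 1)))

theorem Psi_mem_grading : Psi c ∈ grading 3 := by
  have h1 := x_mem_grading
  refine add_mem (add_mem ?_ ?_) ?_
  · exact ((Q_mem_grading c).mul (add_mem (add_mem (add_mem (h1 0) (h1 1)) (h1 2)) (h1 3)) :
      MvPolynomial.IsHomogeneous _ (2 + 1))
  · exact ((Q'_mem_grading c).mul (add_mem (add_mem (add_mem (h1 3) (h1 4)) (h1 5)) (h1 6)) :
      MvPolynomial.IsHomogeneous _ (2 + 1))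
  · exact ((h1 3).mul (A_mem_grading c) : MvPolynomial.IsHomogeneous _ (1 + 2))

theorem preimage_cubic {R : CommRingCat.{0}} {u : Spec R ⟶ P6}
    {r : Set (MvPolynomial (Fin 7) ℂ) → Set R}
    (h : ∀ F : Set (MvPolynomial (Fin 7) ℂ), (∀ f ∈ F, ∃ n, 0 < n ∧ f ∈ grading n) →
      (u ⁻¹' (zeros F : Set P6) : Set (PrimeSpectrum R)) = PrimeSpectrum.zeroLocus (r F)) :
    (u ⁻¹' (cubic c : Set P6) : Set (PrimeSpectrum R)) =
      PrimeSpectrum.zeroLocus (r {(ofCoeff c).poly}) := by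
  rw [cubic, h, Psi_eq]
  rintro f rfl
  exact ⟨3, by norm_num, Psi_mem_grading c⟩

theorem preimage_center {R : CommRingCat.{0}} {u : Spec R ⟶ P6}
    {r : Set (MvPolynomial (Fin 7) ℂ) → Set R}
    (h : ∀ F : Set (MvPolynomial (Fin 7) ℂ), (∀ f ∈ F, ∃ n, 0 < n ∧ f ∈ grading n) →
      (u ⁻¹' (zeros F : Set P6) : Set (PrimeSpectrum R)) = PrimeSpectrum.zeroLocus (r F)) :
    (u ⁻¹' (center c : Set P6) : Set (PrimeSpectrum R)) =
      PrimeSpectrum.zeroLocus (r (Set.range (conicGens (ofCoeff c)))) ∪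
        PrimeSpectrum.zeroLocus (r (conicGens' (ofCoeff c))) ∪
        PrimeSpectrum.zeroLocus (r (nodeGens (ofCoeff c))) := by
  have h1 := x_mem_grading
  rw [← conic_gens_eq, ← conic'_gens_eq, ← nodes_gens_eq, ← h, ← h,
    ← h]
  · rfl
  · rintro f (rfl | rfl | rfl | rfl | rfl | rfl)
    exacts [⟨2, two_pos, Q_mem_grading c⟩, ⟨2, two_pos, Q'_mem_grading c⟩, ⟨1, one_pos, h1 3⟩,
      ⟨1, one_pos, add_mem (add_mem (h1 0) (h1 1)) (h1 2)⟩,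
      ⟨1, one_pos, add_mem (add_mem (h1 4) (h1 5)) (h1 6)⟩, ⟨2, two_pos, A_mem_grading c⟩]
  · rintro f (rfl | rfl | rfl | rfl | rfl)
    exacts [⟨2, two_pos, Q'_mem_grading c⟩, ⟨1, one_pos, h1 3⟩, ⟨1, one_pos, h1 4⟩,
      ⟨1, one_pos, h1 5⟩, ⟨1, one_pos, h1 6⟩]
  · rintro f (rfl | rfl | rfl | rfl | rfl)
    exacts [⟨2, two_pos, Q_mem_grading c⟩, ⟨1, one_pos, h1 0⟩, ⟨1, one_pos, h1 1⟩,
      ⟨1, one_pos, h1 2⟩, ⟨1, one_pos, h1 3⟩]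

theorem renameSwap_quad_xV (a : Fin 6 → ℂ) : renameSwap (quad (MvPolynomial.C ∘ a) xV) =
    quad (MvPolynomial.C ∘ a) xU := by
  refine (map_quad (renameSwap : MvPolynomial (Fin 7) ℂ →+* MvPolynomial (Fin 7) ℂ) _ _).trans ?_
  congr 1
  · ext1 i
    exact renameSwap_C _
  · ext1 i
    exact renameSwap_xV i

theorem renameSwap_quad_xU (a : Fin 6 → ℂ) : renameSwap (quad (MvPolynomial.C ∘ a) xU) =
    quad (MvPolynomial.C ∘ a) xV := by
  refine (map_quad (renameSwap : MvPolynomial (Fin 7) ℂ →+* MvPolynomial (Fin 7) ℂ) _ _).trans ?_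
  congr 1
  · ext1 i
    exact renameSwap_C _
  · ext1 i
    exact renameSwap_xU i

theorem renameSwap_quadric : renameSwap d.quadric = d.swap.quadric := by
  simp only [CubicForm.quadric, CubicForm.bil, map_add, map_mul, CubicForm.map_M,
    renameSwap_C, renameSwap_xU, renameSwap_xV, renameSwap_x 3, CubicForm.swap,
    Fin.sum_univ_three]
  simp only [swapVar, Matrix.cons_val]
  ring

theorem renameSwap_lin_xU : renameSwap (lin xU) = lin xV := by
  simp only [lin, map_add, renameSwap_xU]

theorem renameSwap_lin_xV : renameSwap (lin xV) = lin xU := by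
  simp only [lin, map_add, renameSwap_xV]

theorem range_conicGens : Set.range (conicGens d) =
    {quad (MvPolynomial.C ∘ d.a) xV, x 3, x 0, x 1, x 2} := by
  rw [conicGens]
  simp only [Matrix.range_cons, Matrix.range_empty, Set.union_empty]
  ext
  simp only [Set.mem_insert_iff, Set.mem_singleton_iff, Set.mem_union]
  tauto

theorem renameSwap_conicGens : renameSwap '' Set.range (conicGens d) = conicGens' d.swap := by
  rw [range_conicGens, conicGens']
  simp only [Set.image_insert_eq, Set.image_singleton, renameSwap_quad_xV, renameSwap_x]
  rfl

theorem renameSwap_conicGens' : renameSwap '' conicGens' d = Set.range (conicGens d.swap) := by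
  rw [range_conicGens, conicGens']
  simp only [Set.image_insert_eq, Set.image_singleton, renameSwap_quad_xU, renameSwap_x]
  rfl

theorem renameSwap_nodeGens : renameSwap '' nodeGens d = nodeGens d.swap := by
  have h : nodeGens d.swap = {quad (MvPolynomial.C ∘ d.b) xV, quad (MvPolynomial.C ∘ d.a) xU, x 3,
    lin xU, lin xV, d.swap.quadric} := rfl
  have h3 : renameSwap (x 3) = x 3 := renameSwap_x 3
  rw [nodeGens, h]
  simp only [Set.image_insert_eq, Set.image_singleton, renameSwap_quad_xU, renameSwap_quad_xV,
    h3, renameSwap_quadric, renameSwap_lin_xU, renameSwap_lin_xV]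
  rw [Set.insert_comm (quad _ xU), Set.insert_comm (lin xV)]

/-! ### Charts around the second conic, and assembly of all charts. -/

/-- The isomorphism between two charts of `ℙ⁶` interchanging the two triples of variables. -/
def swapChartEquiv (k : Fin 3) : ChartRing (Fin.castAdd 4 k) ≃+* ChartRing (Fin.natAdd 4 k) :=
  Ideal.quotientEquiv _ _ renameSwap.toRingEquiv (by
    rw [Ideal.map_span, Set.image_singleton]
    congr 2
    exact ((map_sub renameSwap _ _).trans (by rw [renameSwap_xU, map_one])).symm)

theorem swapChartEquiv_toChart (k : Fin 3) (f : MvPolynomial (Fin 7) ℂ) :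
    swapChartEquiv k (toChart _ f) = toChart _ (renameSwap f) :=
  Ideal.quotientEquiv_mk _ _ _ _ _

/-- The chart `xₖ ≠ 0` for `k ≤ 3`, with the two triples of variables interchanged. -/
def swapChart (k : Fin 3) : Spec (CommRingCat.of (ChartRing (Fin.natAdd 4 k))) ⟶ P6 :=
  Spec.map (CommRingCat.ofHom (swapChartEquiv k).toRingHom) ≫ chart (Fin.castAdd 4 k)

instance (k : Fin 3) : IsIso (CommRingCat.ofHom (swapChartEquiv k).toRingHom) :=
  (ConcreteCategory.isIso_iff_bijective _).mpr (swapChartEquiv k).bijective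

instance (k : Fin 3) : IsOpenImmersion (swapChart k) := by
  unfold swapChart
  infer_instance

theorem swapChart_toSpec (k : Fin 3) : swapChart k ≫ P6.toSpec =
    Spec.map (CommRingCat.ofHom (algebraMap ℂ (ChartRing (Fin.natAdd 4 k)))) := by
  have h : (swapChartEquiv k).toRingHom.comp (algebraMap ℂ (ChartRing (Fin.castAdd 4 k))) =
      algebraMap ℂ (ChartRing (Fin.natAdd 4 k)) := RingHom.ext fun a =>
    (swapChartEquiv_toChart k (MvPolynomial.C a)).trans (congrArg (toChart _) (renameSwap_C a))
  rw [swapChart, Category.assoc, chart_toSpec, ← Spec.map_comp, ← CommRingCat.ofHom_comp, h]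

theorem preimage_eq_zeroLocus_comp {R S : Type} [CommRing R] [CommRing S] (e : R →+* S)
    {X : Scheme.{0}} (u : Spec (CommRingCat.of R) ⟶ X) (Z : Set X) (T : Set R)
    (h : (u ⁻¹' Z : Set (PrimeSpectrum R)) = PrimeSpectrum.zeroLocus T) :
    ((Spec.map (CommRingCat.ofHom e) ≫ u) ⁻¹' Z : Set (PrimeSpectrum S)) =
      PrimeSpectrum.zeroLocus (e '' T) := by
  rw [← PrimeSpectrum.preimage_comap_zeroLocus, ← h]
  rfl

theorem image_swapChartEquiv (k : Fin 3) (F : Set (MvPolynomial (Fin 7) ℂ)) :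
    (swapChartEquiv k).toRingHom '' (toChart _ '' F) = toChart _ '' (renameSwap '' F) := by
  rw [Set.image_image, Set.image_image]
  exact Set.image_congr fun f _ => swapChartEquiv_toChart k f

theorem swapChart_preimage_zeros (k : Fin 3) (F : Set (MvPolynomial (Fin 7) ℂ))
    (hF : ∀ f ∈ F, ∃ n, 0 < n ∧ f ∈ grading n) :
    (swapChart k ⁻¹' (zeros F : Set P6) : Set (PrimeSpectrum (ChartRing (Fin.natAdd 4 k)))) =
      PrimeSpectrum.zeroLocus (toChart _ '' (renameSwap '' F)) := by
  rw [← image_swapChartEquiv]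
  exact preimage_eq_zeroLocus_comp _ _ _ _ (chart_preimage_zeros (Fin.castAdd 4 k) F hF)

theorem range_swapChart (k : Fin 3) :
    Set.range (swapChart k) = Set.range (chart (Fin.castAdd 4 k)) := by
  have h := Scheme.Hom.opensRange_comp_of_isIso
    (Spec.map (CommRingCat.ofHom (swapChartEquiv k).toRingHom)) (chart (Fin.castAdd 4 k))
  exact congrArg SetLike.coe h

theorem chart_three_preimage_center : (chart 3 ⁻¹' (center c : Set P6) :
    Set (PrimeSpectrum (ChartRing 3))) = ∅ := by
  rw [preimage_center c (chart_preimage_zeros 3)]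
  have key : ∀ T : Set (MvPolynomial (Fin 7) ℂ), x 3 ∈ T →
      PrimeSpectrum.zeroLocus (toChart 3 '' T) = ∅ := by
    intro T hT
    rw [Set.eq_empty_iff_forall_notMem]
    intro p hp
    refine p.2.ne_top ((Ideal.eq_top_iff_one _).mpr ?_)
    rw [← toChart_x 3]
    exact hp ⟨_, hT, rfl⟩
  rw [key (Set.range (conicGens _)) ⟨3, rfl⟩, key (conicGens' _) (by simp [conicGens']), key (nodeGens _) (by simp [nodeGens]), Set.union_empty,
    Set.union_empty]

theorem swapChart_preimage_center (k : Fin 3) (h : IsGenericSide (ofCoeff c).swap) :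
    (swapChart k ⁻¹' (center c : Set P6) : Set (PrimeSpectrum (ChartRing (Fin.natAdd 4 k)))) =
      PrimeSpectrum.zeroLocus
        (Set.range fun i => toChart (Fin.natAdd 4 k) (conicGens (ofCoeff c).swap i)) := by
  rw [preimage_center c (swapChart_preimage_zeros k), renameSwap_conicGens, renameSwap_conicGens', renameSwap_nodeGens,
    Set.union_comm (PrimeSpectrum.zeroLocus (toChart (Fin.natAdd 4 k) '' conicGens' _))]
  exact zeroLocus_conicGens _ h k

theorem swapChart_preimage_cubic (k : Fin 3) : (swapChart k ⁻¹' (cubic c : Set P6) :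
    Set (PrimeSpectrum (ChartRing (Fin.natAdd 4 k)))) =
      PrimeSpectrum.zeroLocus {toChart (Fin.natAdd 4 k) (ofCoeff c).swap.poly} := by
  rw [preimage_cubic c (swapChart_preimage_zeros k), ← renameSwap_poly, Set.image_singleton,
    Set.image_singleton]

theorem chart_preimage_cubic (k : Fin 7) : (chart k ⁻¹' (cubic c : Set P6) :
    Set (PrimeSpectrum (ChartRing k))) =
      PrimeSpectrum.zeroLocus {toChart k (ofCoeff c).poly} := by
  rw [preimage_cubic c (chart_preimage_zeros k), Set.image_singleton]

theorem conicChart_u {d : CubicForm ℂ} (hd : IsGenericSide d) (k : Fin 3) {Cn Y : Closeds P6}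
    (u : Spec (CommRingCat.of (ChartRing (Fin.natAdd 4 k))) ⟶ P6) (hu hs hC hY) :
    (conicChart hd k (Cn := Cn) (Y := Y) u hu hs hC hY).u = u := rfl

theorem exists_chart_index (k : Fin 7) :
    (∃ i : Fin 3, k = Fin.castAdd 4 i) ∨ k = 3 ∨ ∃ i : Fin 3, k = Fin.natAdd 4 i := by
  revert k
  decide

theorem strictTransformIsSmoothDivisor_of_isGeneric (h : IsGeneric (ofCoeff c)) :
    StrictTransformIsSmoothDivisor c := by
  intro W π hπ
  refine isSmoothDivisor_strictTransform hπ fun p => ?_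
  obtain ⟨k, hk⟩ := exists_mem_range_chart p
  rcases exists_chart_index k with ⟨i, rfl⟩ | rfl | ⟨i, rfl⟩
  · refine ⟨conicChart h.right i (swapChart i) inferInstance
      (swapChart_toSpec i) (swapChart_preimage_center c i h.right) (swapChart_preimage_cubic c i),
      ?_⟩
    rw [conicChart_u]
    exact (range_swapChart i).symm ▸ hk
  · exact ⟨middleChart h (chart_three_preimage_center c) (chart_preimage_cubic c 3), hk⟩
  · refine ⟨conicChart h.left i (chart _) inferInstance (chart_toSpec _)
      ((preimage_center c (chart_preimage_zeros _)).trans (zeroLocus_conicGens _ h.left i))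
      (chart_preimage_cubic c _), ?_⟩
    rw [conicChart_u]
    exact hk

/-! ### Counting parameters by transcendence degree -/

-- The field is algebraic over the algebra generated by `s`, which is a quotient of a polynomial
-- ring with one variable for each element of `s`.
open scoped IntermediateField.algebraAdjoinAdjoin in
theorem trdeg_intermediateField_adjoin_le {K F : Type*} [Field K] [Field F] [Algebra K F]
    (s : Set F) : Algebra.trdeg K (IntermediateField.adjoin K s) ≤ Cardinal.mk s := by
  have h : Algebra.trdeg K (Algebra.adjoin K s) ≤ Cardinal.mk s := by
    have := lift_trdeg_le_of_surjective (MvPolynomial.aeval (R := K) (fun i : s =>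
      (⟨i, Algebra.subset_adjoin i.2⟩ : Algebra.adjoin K s))) ?_
    · simpa using this
    · rw [← AlgHom.range_eq_top, ← Algebra.adjoin_range_eq_range_aeval]
      rw [← Algebra.adjoin_adjoin_coe_preimage (R := K) (s := s)]
      congr 1
      ext x
      constructor
      · rintro ⟨i, rfl⟩
        exact i.2
      · intro hx
        exact ⟨⟨x, hx⟩, rfl⟩
  have alg : Algebra.IsAlgebraic (Algebra.adjoin K s) (IntermediateField.adjoin K s) :=
    IsLocalization.isAlgebraic _ (nonZeroDivisors (Algebra.adjoin K s))
  rw [← trdeg_add_eq K (Algebra.adjoin K s), trdeg_eq_zero (R := Algebra.adjoin K s), add_zero]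
  exact h

/-- Algebraically independent elements cannot be expressed through fewer other elements. -/
theorem false_of_forall_mem {T F ι ν : Type*} [Finite T] [Fintype ι] [Fintype ν] [Field F] [Algebra ℂ F]
    {t : T → F} (ht : AlgebraicIndependent ℂ t) (e : ι → T) (he : Function.Injective e)
    (y : ν → F) (hc : Fintype.card ν < Fintype.card ι)
    (h : ∀ L : IntermediateField ℂ F, (∀ i, i ∉ Set.range e → t i ∈ L) → (∀ k, y k ∈ L) →
      ∀ i, t (e i) ∈ L) : False := by
  classical
  have := Fintype.ofFinite T
  -- The field `L` generated by the unsolved `t` and the `y` contains all of `t`, yet has fewer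
  -- generators than `T` has elements.
  set s : Set F := t '' (Set.range e)ᶜ ∪ Set.range y with hs
  set L := IntermediateField.adjoin ℂ s with hL
  have hsub : s ⊆ L := IntermediateField.subset_adjoin ℂ s
  have h1 : ∀ i, i ∉ Set.range e → t i ∈ L := fun i hi => hsub (Or.inl ⟨i, hi, rfl⟩)
  have h2 : ∀ i, t i ∈ L := by
    intro i
    by_cases hi : i ∈ Set.range e
    · obtain ⟨k, rfl⟩ := hi
      exact h L h1 (fun k => hsub (Or.inr ⟨k, rfl⟩)) k
    · exact h1 i hi
  have h3 : AlgebraicIndependent ℂ (fun i => (⟨t i, h2 i⟩ : L)) :=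
    AlgebraicIndependent.of_comp L.val ht
  have h4 := h3.lift_cardinalMk_le_trdeg.trans
    (Cardinal.lift_le.mpr (trdeg_intermediateField_adjoin_le s))
  have h5 : s.Finite := ((Set.toFinite _).image t).union (Set.finite_range y)
  have h6 : Fintype.card T ≤ s.ncard := by
    have := h5.fintype
    rw [Set.ncard_eq_toFinset_card', Set.toFinset_card]
    simpa using h4
  have h7 : s.ncard ≤ (Fintype.card T - Fintype.card ι) + Fintype.card ν := by
    refine (Set.ncard_union_le _ _).trans (add_le_add ?_ ?_)
    · refine (Set.ncard_image_le (Set.toFinite _)).trans_eq ?_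
      rw [Set.ncard_compl, Set.ncard_range_of_injective he, Nat.card_eq_fintype_card,
        Nat.card_eq_fintype_card]
    · rw [← Set.image_univ]
      refine (Set.ncard_image_le (Set.toFinite _)).trans_eq ?_
      rw [Set.ncard_univ, Nat.card_eq_fintype_card]
  have h8 : Fintype.card ι ≤ Fintype.card T := Fintype.card_le_of_injective e he
  omega

/-! ### Ternary quadratic forms with algebraically independent coefficients -/

/-- The positions of the squares among the six monomials of degree two. -/
def sqIndex : Fin 3 → Fin 6 := ![0, 3, 5]

/-- The position of the monomial of degree two in the other two variables. -/
def oppIndex : Fin 3 → Fin 6 := ![4, 2, 1]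

theorem Fin.sum_univ_cyclic {M : Type*} [AddCommMonoid M] (f : Fin 3 → M) (j : Fin 3) :
    ∑ k, f k = f j + f (j + 1) + f (j + 2) := by
  rw [Fin.sum_univ_three]
  fin_cases j
  · rfl
  · exact add_rotate _ _ _
  · exact (add_rotate _ _ _).symm

theorem Fin.forall_cyclic {P : Fin 3 → Prop} (j : Fin 3) (h0 : P j) (h1 : P (j + 1))
    (h2 : P (j + 2)) : ∀ k, P k := by
  intro k
  have key : ∀ j k : Fin 3, k = j ∨ k = j + 1 ∨ k = j + 2 := by decide
  rcases key j k with rfl | rfl | rfl <;> assumption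

section Ring

variable {R : Type*} [CommRing R] (a : Fin 6 → R) (t : Fin 3 → R) (j : Fin 3)

theorem lin_eq_cyclic : lin t = t j + t (j + 1) + t (j + 2) := by
  rw [← Fin.sum_univ_cyclic, Fin.sum_univ_three, lin]

theorem quad_eq_cyclic : quad a t = a (sqIndex j) * t j ^ 2 + a (sqIndex (j + 1)) * t (j + 1) ^ 2 +
    a (sqIndex (j + 2)) * t (j + 2) ^ 2 + a (oppIndex j) * (t (j + 1) * t (j + 2)) +
    a (oppIndex (j + 1)) * (t (j + 2) * t j) + a (oppIndex (j + 2)) * (t j * t (j + 1)) := by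
  fin_cases j <;> simp [quad, sqIndex, oppIndex] <;> ring

theorem quadGrad_eq_cyclic : quadGrad a t j = 2 * a (sqIndex j) * t j +
    a (oppIndex (j + 2)) * t (j + 1) + a (oppIndex (j + 1)) * t (j + 2) := by
  fin_cases j <;> simp [quadGrad, sqIndex, oppIndex] <;> ring

theorem quadGrad_eq_cyclic_one : quadGrad a t (j + 1) = 2 * a (sqIndex (j + 1)) * t (j + 1) +
    a (oppIndex j) * t (j + 2) + a (oppIndex (j + 2)) * t j := by
  fin_cases j <;> simp [quadGrad, sqIndex, oppIndex] <;> ring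

theorem quadGrad_eq_cyclic_two : quadGrad a t (j + 2) = 2 * a (sqIndex (j + 2)) * t (j + 2) +
    a (oppIndex j) * t (j + 1) + a (oppIndex (j + 1)) * t j := by
  fin_cases j <;> simp [quadGrad, sqIndex, oppIndex] <;> ring

end Ring

variable {F : Type*} [Field F] [Algebra ℂ F]

theorem mem_of_mul_add_eq_zero {L : IntermediateField ℂ F} {p x r : F} (hp : p ∈ L) (hr : r ∈ L)
    (h0 : p ≠ 0) (h : p * x + r = 0) : x ∈ L := by
  have : x = -r / p := by
    field_simp
    linear_combination h
  rw [this]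
  exact div_mem (neg_mem hr) hp

variable {T : Type*} [Finite T] {t : T → F}

/-- With `vⱼ = 1` the three gradient equations determine the coefficients of the three monomials
containing `tⱼ`. They would then be rational in the other coefficients and only two quantities `y`.
-/
theorem false_of_quadGrad_eq (ht : AlgebraicIndependent ℂ t) {ε : Fin 6 → T}
    (hε : Function.Injective ε) {v r : Fin 3 → F} (j : Fin 3) (hv : v j = 1)
    (hr : ∀ k, quadGrad (t ∘ ε) v k = r k) (y : Fin 2 → F)
    (h : ∀ L : IntermediateField ℂ F, (∀ i, i ∉ Set.range ε → t i ∈ L) → (∀ k, y k ∈ L) →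
      ∀ k, v k ∈ L ∧ r k ∈ L) : False := by
  have h2 : (2 : F) ≠ 0 := by
    have := charZero_of_injective_algebraMap (algebraMap ℂ F).injective
    exact two_ne_zero
  have hinj : ∀ j : Fin 3,
      Function.Injective ![sqIndex j, oppIndex (j + 1), oppIndex (j + 2)] := by decide
  have hn : ∀ j : Fin 3, ∀ k ∈ [sqIndex (j + 1), sqIndex (j + 2), oppIndex j],
      ∀ m, ![sqIndex j, oppIndex (j + 1), oppIndex (j + 2)] m ≠ k := by decide
  refine false_of_forall_mem ht _ (hε.comp (hinj j)) y (by simp) fun L hL hy => ?_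
  have hk : ∀ k ∈ [sqIndex (j + 1), sqIndex (j + 2), oppIndex j], t (ε k) ∈ L := by
    intro k hk
    refine hL _ ?_
    rintro ⟨m, hm⟩
    exact hn j k hk m (hε hm)
  have h1 := hk (sqIndex (j + 1)) (by simp)
  have h3 := hk (sqIndex (j + 2)) (by simp)
  have h4 := hk (oppIndex j) (by simp)
  have hvr := h L (fun i hi => hL i fun ⟨m, hm⟩ => hi ⟨_, hm⟩) hy
  have hv1 := (hvr (j + 1)).1
  have hv2 := (hvr (j + 2)).1
  have hr0 := (hvr j).2
  have hr1 := (hvr (j + 1)).2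
  have hr2 := (hvr (j + 2)).2
  have two : (2 : F) ∈ L := ofNat_mem L 2
  clear hvr hk hL
  have e0 := hr j
  have e1 := hr (j + 1)
  have e2 := hr (j + 2)
  rw [quadGrad_eq_cyclic, hv] at e0
  rw [quadGrad_eq_cyclic_one, hv] at e1
  rw [quadGrad_eq_cyclic_two, hv] at e2
  simp only [Function.comp_apply] at e0 e1 e2
  have m2 : t (ε (oppIndex (j + 2))) ∈ L := by
    refine mem_of_mul_add_eq_zero (p := 1)
      (r := 2 * t (ε (sqIndex (j + 1))) * v (j + 1) + t (ε (oppIndex j)) * v (j + 2) - r (j + 1))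
      (one_mem _) ?_ one_ne_zero (by linear_combination e1)
    apply_rules [add_mem, sub_mem, mul_mem]
  have m1 : t (ε (oppIndex (j + 1))) ∈ L := by
    refine mem_of_mul_add_eq_zero (p := 1)
      (r := 2 * t (ε (sqIndex (j + 2))) * v (j + 2) + t (ε (oppIndex j)) * v (j + 1) - r (j + 2))
      (one_mem _) ?_ one_ne_zero (by linear_combination e2)
    apply_rules [add_mem, sub_mem, mul_mem]
  have m0 : t (ε (sqIndex j)) ∈ L := by
    refine mem_of_mul_add_eq_zero (p := 2)
      (r := t (ε (oppIndex (j + 2))) * v (j + 1) + t (ε (oppIndex (j + 1))) * v (j + 2) - r j)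
      two ?_ h2 (by linear_combination e0)
    apply_rules [add_mem, sub_mem, mul_mem]
  intro i
  fin_cases i
  exacts [m0, m1, m2]

theorem quadGrad_smul {R : Type*} [CommRing R] (a : Fin 6 → R) (s : R) (v : Fin 3 → R)
    (k : Fin 3) : quadGrad a (fun i => s * v i) k = s * quadGrad a v k := by
  fin_cases k <;> simp [quadGrad] <;> ring

/-- A generic conic is nonsingular: after scaling, `v` has two free coordinates against three
equations. -/
theorem eq_zero_of_quadGrad_eq_zero (ht : AlgebraicIndependent ℂ t) {ε : Fin 6 → T}
    (hε : Function.Injective ε) {v : Fin 3 → F} (h : quadGrad (t ∘ ε) v = 0) : v = 0 := by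
  by_contra hv
  obtain ⟨j, hj⟩ := Function.ne_iff.mp hv
  refine false_of_quadGrad_eq ht hε (v := fun i => (v j)⁻¹ * v i) (r := 0) j
    (inv_mul_cancel₀ hj) (fun k => by rw [quadGrad_smul, h]; simp)
    ![(v j)⁻¹ * v (j + 1), (v j)⁻¹ * v (j + 2)] fun L _ hy => fun k => ⟨?_, zero_mem L⟩
  exact Fin.forall_cyclic (P := fun k => (v j)⁻¹ * v k ∈ L) j
    (by rw [inv_mul_cancel₀ hj]; exact one_mem L) (hy 0) (hy 1) k

/-- A generic conic is not tangent to the line `γ · v = 0`. The line leaves one coordinate of the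
scaled `v` free, and the factor `c` is the second parameter. -/
theorem eq_zero_of_quadGrad_eq_smul (ht : AlgebraicIndependent ℂ t) {ε : Fin 6 → T}
    (hε : Function.Injective ε) {v γ : Fin 3 → F} {c : F} (hγ : ∀ k, γ k ≠ 0)
    (hγL : ∀ L : IntermediateField ℂ F, (∀ i, i ∉ Set.range ε → t i ∈ L) → ∀ k, γ k ∈ L)
    (h : ∀ k, quadGrad (t ∘ ε) v k = c * γ k) (hγv : ∑ k, γ k * v k = 0) : v = 0 := by
  by_contra hv
  obtain ⟨j, hj⟩ := Function.ne_iff.mp hv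
  replace hj : v j ≠ 0 := hj
  refine false_of_quadGrad_eq ht hε (v := fun i => (v j)⁻¹ * v i)
    (r := fun k => (v j)⁻¹ * c * γ k) j
    (inv_mul_cancel₀ hj) (fun k => by rw [quadGrad_smul, h, mul_assoc])
    ![(v j)⁻¹ * v (j + 2), (v j)⁻¹ * c] fun L hL hy => ?_
  have hg := hγL L hL
  have h2 : (v j)⁻¹ * v (j + 2) ∈ L := hy 0
  have h0 : (v j)⁻¹ * v j ∈ L := by rw [inv_mul_cancel₀ hj]; exact one_mem L
  have h1 : (v j)⁻¹ * v (j + 1) ∈ L := by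
    refine mem_of_mul_add_eq_zero (hg (j + 1))
      (r := γ j * ((v j)⁻¹ * v j) + γ (j + 2) * ((v j)⁻¹ * v (j + 2))) ?_ (hγ _) ?_
    · exact add_mem (mul_mem (hg _) h0) (mul_mem (hg _) h2)
    · rw [Fin.sum_univ_cyclic _ j] at hγv
      linear_combination (v j)⁻¹ * hγv
  have hvL := Fin.forall_cyclic (P := fun k => (v j)⁻¹ * v k ∈ L) j h0 h1 h2
  exact fun k => ⟨hvL k, mul_mem (hy 1) (hg k)⟩

/-! ### Cubic forms with algebraically independent coefficients -/

/-- Index set for the coefficients of two quadratic forms and one bilinear form. -/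
abbrev FormIndex : Type := Fin 6 ⊕ Fin 6 ⊕ Fin 3 × Fin 3

/-- The cubic form with given parameters, where the coefficients of `z² uᵢ` and `z² vⱼ` may
coincide. -/
def CubicForm.ofParams {R κ : Type*} (p q : Fin 3 → κ) (t : FormIndex ⊕ κ → R) : CubicForm R where
  a k := t (.inl (.inl k))
  b k := t (.inl (.inr (.inl k)))
  M i j := t (.inl (.inr (.inr (i, j))))
  α i := t (.inr (p i))
  β j := t (.inr (q j))

variable {F κ : Type*} [Field F] [Algebra ℂ F] [Finite κ] {t : FormIndex ⊕ κ → F}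
  {p q : Fin 3 → κ}

/-- Seven coefficients that are determined by the others at a singular point. -/
abbrev solvedIndex (i j : Fin 3) : Fin 7 → FormIndex :=
  ![.inl (sqIndex j), .inr (.inl (sqIndex i)), .inr (.inr (i, j)), .inr (.inr (i, j + 1)),
    .inr (.inr (i, j + 2)), .inr (.inr (i + 1, j)), .inr (.inr (i + 2, j))]

theorem solvedIndex_injective : ∀ i j, Function.Injective (solvedIndex i j) := by
  decide

set_option maxRecDepth 4000 in
theorem solvedIndex_ne : ∀ i j, ∀ k ∈ ([.inl (sqIndex (j + 1)), .inl (sqIndex (j + 2)),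
    .inl (oppIndex j), .inl (oppIndex (j + 1)), .inl (oppIndex (j + 2)),
    .inr (.inl (sqIndex (i + 1))), .inr (.inl (sqIndex (i + 2))), .inr (.inl (oppIndex i)),
    .inr (.inl (oppIndex (i + 1))), .inr (.inl (oppIndex (i + 2))),
    .inr (.inr (i + 1, j + 1)), .inr (.inr (i + 1, j + 2)), .inr (.inr (i + 2, j + 1)),
    .inr (.inr (i + 2, j + 2))] : List FormIndex), ∀ m, solvedIndex i j m ≠ k := by
  decide

-- The core of the parameter count: the system is solved for seven coefficients, while `u`, `v`,
-- `s`, `l`, `r` depend on only six quantities. Neither the `j`-th equation in `e6` nor the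
-- `z`-derivative is used here; the latter serves to reduce seven quantities to six.
open CubicForm in
theorem false_of_singular_of_mem (ht : AlgebraicIndependent ℂ t) {s z r l : F} {u v : Fin 3 → F}
    {i j : Fin 3} (hu : u i = 1) (hv : v j = 1) (hz : z ≠ 0)
    (e1 : quad (ofParams p q t).a v = s * r) (e2 : lin u + z + l * s = 0)
    (e3 : (ofParams p q t).coxS u z + l * r = 0) (e4 : (ofParams p q t).coxU s u z r v = 0)
    (e6 : ∀ k, (ofParams p q t).coxV u z k = l * quadGrad (ofParams p q t).a v k)
    (y : Fin 6 → F)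
    (h : ∀ L : IntermediateField ℂ F, (∀ k, t (.inr k) ∈ L) → (∀ k, y k ∈ L) →
      (∀ k, u k ∈ L) ∧ (∀ k, v k ∈ L) ∧ s ∈ L ∧ l ∈ L ∧ r ∈ L) : False := by
  refine false_of_forall_mem ht (Sum.inl ∘ solvedIndex i j)
    (Sum.inl_injective.comp (solvedIndex_injective i j)) y (by simp) fun L hL hy => ?_
  have hκ : ∀ k, t (.inr k) ∈ L := fun k => hL _ (by rintro ⟨m, hm⟩; cases hm)
  have hk : ∀ k, (∀ m, solvedIndex i j m ≠ k) → t (.inl k) ∈ L := by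
    intro k hk
    refine hL _ ?_
    rintro ⟨m, hm⟩
    exact hk m (Sum.inl_injective hm)
  obtain ⟨hu', hv', hs, hl, hr⟩ := h L hκ hy
  set d := ofParams p q t with hd
  have hα : ∀ k, d.α k ∈ L := fun k => hκ _
  have hβ : ∀ k, d.β k ∈ L := fun k => hκ _
  have a1 : d.a (sqIndex (j + 1)) ∈ L := hk _ (solvedIndex_ne i j _ (by simp))
  have a2 : d.a (sqIndex (j + 2)) ∈ L := hk _ (solvedIndex_ne i j _ (by simp))
  have a3 : d.a (oppIndex j) ∈ L := hk _ (solvedIndex_ne i j _ (by simp))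
  have a4 : d.a (oppIndex (j + 1)) ∈ L := hk _ (solvedIndex_ne i j _ (by simp))
  have a5 : d.a (oppIndex (j + 2)) ∈ L := hk _ (solvedIndex_ne i j _ (by simp))
  have b1 : d.b (sqIndex (i + 1)) ∈ L := hk _ (solvedIndex_ne i j _ (by simp))
  have b2 : d.b (sqIndex (i + 2)) ∈ L := hk _ (solvedIndex_ne i j _ (by simp))
  have b3 : d.b (oppIndex i) ∈ L := hk _ (solvedIndex_ne i j _ (by simp))
  have b4 : d.b (oppIndex (i + 1)) ∈ L := hk _ (solvedIndex_ne i j _ (by simp))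
  have b5 : d.b (oppIndex (i + 2)) ∈ L := hk _ (solvedIndex_ne i j _ (by simp))
  have m11 : d.M (i + 1) (j + 1) ∈ L := hk _ (solvedIndex_ne i j _ (by simp))
  have m12 : d.M (i + 1) (j + 2) ∈ L := hk _ (solvedIndex_ne i j _ (by simp))
  have m21 : d.M (i + 2) (j + 1) ∈ L := hk _ (solvedIndex_ne i j _ (by simp))
  have m22 : d.M (i + 2) (j + 2) ∈ L := hk _ (solvedIndex_ne i j _ (by simp))
  clear hκ hk hL h hy
  have two : (2 : F) ∈ L := ofNat_mem L 2
  have one : (1 : F) ∈ L := one_mem L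
  have e4' : ∀ k, d.coxU s u z r v k = 0 := congrFun e4
  have hlu : lin u ∈ L := by
    rw [lin]
    apply_rules [add_mem]
  have hlv : lin v ∈ L := by
    rw [lin]
    apply_rules [add_mem]
  have hzL : z ∈ L := mem_of_mul_add_eq_zero (r := lin u + l * s) one
    (add_mem hlu (mul_mem hl hs)) one_ne_zero (by linear_combination e2)
  have hαu : ∑ k, d.α k * u k ∈ L := sum_mem fun k _ => mul_mem (hα k) (hu' k)
  have hQ : quad d.b u ∈ L := by
    rw [coxS] at e3
    refine mem_of_mul_add_eq_zero (r := z ^ 2 * ∑ k, d.α k * u k + l * r) hzL ?_ hz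
      (by linear_combination e3)
    apply_rules [add_mem, mul_mem, pow_mem]
  have b0 : d.b (sqIndex i) ∈ L := by
    have e := quad_eq_cyclic d.b u i
    rw [hu] at e
    refine mem_of_mul_add_eq_zero (r := d.b (sqIndex (i + 1)) * u (i + 1) ^ 2 +
      d.b (sqIndex (i + 2)) * u (i + 2) ^ 2 + d.b (oppIndex i) * (u (i + 1) * u (i + 2)) +
      d.b (oppIndex (i + 1)) * (u (i + 2) * 1) + d.b (oppIndex (i + 2)) * (1 * u (i + 1)) -
      quad d.b u) one ?_ one_ne_zero (by linear_combination -e)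
    apply_rules [add_mem, sub_mem, mul_mem, pow_mem]
  have hb0 : quadGrad d.b u i ∈ L := by
    rw [quadGrad_eq_cyclic]
    apply_rules [add_mem, mul_mem]
  have hb1 : quadGrad d.b u (i + 1) ∈ L := by
    rw [quadGrad_eq_cyclic_one]
    apply_rules [add_mem, mul_mem]
  have hb2 : quadGrad d.b u (i + 2) ∈ L := by
    rw [quadGrad_eq_cyclic_two]
    apply_rules [add_mem, mul_mem]
  have ha1 : quadGrad d.a v (j + 1) ∈ L := by
    rw [quadGrad_eq_cyclic_one]
    apply_rules [add_mem, mul_mem]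
  have ha2 : quadGrad d.a v (j + 2) ∈ L := by
    rw [quadGrad_eq_cyclic_two]
    apply_rules [add_mem, mul_mem]
  have a0 : d.a (sqIndex j) ∈ L := by
    rw [quad_eq_cyclic d.a v j, hv] at e1
    refine mem_of_mul_add_eq_zero (r := d.a (sqIndex (j + 1)) * v (j + 1) ^ 2 +
      d.a (sqIndex (j + 2)) * v (j + 2) ^ 2 + d.a (oppIndex j) * (v (j + 1) * v (j + 2)) +
      d.a (oppIndex (j + 1)) * (v (j + 2) * 1) + d.a (oppIndex (j + 2)) * (1 * v (j + 1)) -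
      s * r) one ?_ one_ne_zero (by linear_combination e1)
    apply_rules [add_mem, sub_mem, mul_mem, pow_mem]
  have hMv : ∀ k, d.M k (j + 1) ∈ L → d.M k (j + 2) ∈ L → quadGrad d.b u k ∈ L → d.M k j ∈ L := by
    intro k h1 h2 h3
    have e := e4' k
    rw [coxU, Fin.sum_univ_cyclic _ j, hv] at e
    refine mem_of_mul_add_eq_zero (r := r + (s * z + lin v) * quadGrad d.b u k +
      z * (d.M k (j + 1) * v (j + 1) + d.M k (j + 2) * v (j + 2) + s * z * d.α k)) hzL ?_ hz
      (by linear_combination e)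
    apply_rules [add_mem, mul_mem]
  have hMu : ∀ k, d.M (i + 1) k ∈ L → d.M (i + 2) k ∈ L → quadGrad d.a v k ∈ L → d.M i k ∈ L := by
    intro k h1 h2 h3
    have e := e6 k
    rw [coxV, Fin.sum_univ_cyclic _ i, hu] at e
    refine mem_of_mul_add_eq_zero (r := quad d.b u +
      z * (d.M (i + 1) k * u (i + 1) + d.M (i + 2) k * u (i + 2) + z * d.β k) -
      l * quadGrad d.a v k) hzL ?_ hz (by linear_combination e)
    apply_rules [add_mem, sub_mem, mul_mem]
  -- First row `i` off column `j` from the `v`-derivatives, then column `j` from the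
  -- `u`-derivatives; both systems are linear in `M` with factor `z ≠ 0`.
  have m01 := hMu _ m11 m21 ha1
  have m02 := hMu _ m12 m22 ha2
  have m10 := hMv _ m11 m12 hb1
  have m20 := hMv _ m21 m22 hb2
  have m00 := hMv _ m01 m02 hb0
  intro k
  fin_cases k
  exacts [a0, b0, m00, m01, m02, m10, m20]

-- After normalization seven quantities remain: two coordinates each of `u` and `v`, and `s`, `l`,
-- `r`. Combining the Euler relation in `v` with the `z`-derivative gives an equation with no
-- coefficients other than `α` and `β`, linear in `r` with factor `l lin(v) - z lin(u)`. If this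
-- factor is nonzero it determines `r`; if it is zero, its vanishing determines a coordinate of `v`.
open CubicForm in
theorem false_of_singular_of_eq_one (ht : AlgebraicIndependent ℂ t) {s z r l : F}
    {u v : Fin 3 → F} {i j : Fin 3} (hu : u i = 1) (hv : v j = 1) (hz : z ≠ 0)
    (e1 : quad (ofParams p q t).a v = s * r) (e2 : lin u + z + l * s = 0)
    (e3 : (ofParams p q t).coxS u z + l * r = 0) (e4 : (ofParams p q t).coxU s u z r v = 0)
    (e5 : (ofParams p q t).coxZ s u z r v = 0)
    (e6 : ∀ k, (ofParams p q t).coxV u z k = l * quadGrad (ofParams p q t).a v k) : False := by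
  have hlu := lin_eq_cyclic u i
  have hlv := lin_eq_cyclic v j
  rw [hu] at hlu
  rw [hv] at hlv
  by_cases hδ : l * lin v - z * lin u = 0
  · have hl : l ≠ 0 := by
      rintro rfl
      have : z * lin u = 0 := by linear_combination -hδ
      have h0 : lin u = 0 := (mul_eq_zero.mp this).resolve_left hz
      exact hz (by linear_combination e2 - h0)
    refine false_of_singular_of_mem ht hu hv hz e1 e2 e3 e4 e6
      ![u (i + 1), u (i + 2), v (j + 2), s, l, r] fun L hκ hy => ?_
    have u1 : u (i + 1) ∈ L := hy 0
    have u2 : u (i + 2) ∈ L := hy 1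
    have v2 : v (j + 2) ∈ L := hy 2
    have hs : s ∈ L := hy 3
    have hlL : l ∈ L := hy 4
    have hr : r ∈ L := hy 5
    have one : (1 : F) ∈ L := one_mem L
    clear hκ hy
    have hluL : lin u ∈ L := by
      rw [hlu]
      apply_rules [add_mem]
    have hzL : z ∈ L := mem_of_mul_add_eq_zero (r := lin u + l * s) one
      (add_mem hluL (mul_mem hlL hs)) one_ne_zero (by linear_combination e2)
    have v1 : v (j + 1) ∈ L := by
      refine mem_of_mul_add_eq_zero (r := l * (1 + v (j + 2)) - z * lin u) hlL ?_ hl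
        (by linear_combination hδ - l * hlv)
      apply_rules [add_mem, sub_mem, mul_mem]
    exact ⟨Fin.forall_cyclic i (hu.symm ▸ one) u1 u2, Fin.forall_cyclic j (hv.symm ▸ one) v1 v2,
      hs, hlL, hr⟩
  · refine false_of_singular_of_mem ht hu hv hz e1 e2 e3 e4 e6
      ![u (i + 1), u (i + 2), v (j + 1), v (j + 2), s, l] fun L hκ hy => ?_
    have u1 : u (i + 1) ∈ L := hy 0
    have u2 : u (i + 2) ∈ L := hy 1
    have v1 : v (j + 1) ∈ L := hy 2
    have v2 : v (j + 2) ∈ L := hy 3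
    have hs : s ∈ L := hy 4
    have hlL : l ∈ L := hy 5
    have one : (1 : F) ∈ L := one_mem L
    have hu' := Fin.forall_cyclic (P := fun k => u k ∈ L) i (hu.symm ▸ one) u1 u2
    have hv' := Fin.forall_cyclic (P := fun k => v k ∈ L) j (hv.symm ▸ one) v1 v2
    have hα : ∑ k, (ofParams p q t).α k * u k ∈ L := sum_mem fun k _ => mul_mem (hκ _) (hu' k)
    have hβ : ∑ k, (ofParams p q t).β k * v k ∈ L := sum_mem fun k _ => mul_mem (hκ _) (hv' k)
    clear hκ hy
    have hluL : lin u ∈ L := by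
      rw [hlu]
      apply_rules [add_mem]
    have hlvL : lin v ∈ L := by
      rw [hlv]
      apply_rules [add_mem]
    have hzL : z ∈ L := mem_of_mul_add_eq_zero (r := lin u + l * s) one
      (add_mem hluL (mul_mem hlL hs)) one_ne_zero (by linear_combination e2)
    refine ⟨hu', hv', hs, hlL, mem_of_mul_add_eq_zero
      (r := s * z ^ 3 * ∑ k, (ofParams p q t).α k * u k +
        z ^ 2 * lin v * ∑ k, (ofParams p q t).α k * u k +
        z ^ 3 * ∑ k, (ofParams p q t).β k * v k)
      (sub_mem (mul_mem hlL hlvL) (mul_mem hzL hluL)) ?_ hδ ?_⟩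
    · apply_rules [add_mem, mul_mem, pow_mem]
    · have euler := quad_euler (ofParams p q t).a v
      have f0 := e6 0
      have f1 := e6 1
      have f2 := e6 2
      rw [coxS] at e3
      rw [coxZ] at e5
      simp only [coxV, bil, Fin.sum_univ_three, lin] at *
      -- The term `uMv` cancels between `e5` and the contraction of `e6` with `v`; then `e3` removes
      -- `Q'(u)`.
      linear_combination z ^ 2 * e5 - z * (v 0 * f0 + v 1 * f1 + v 2 * f2 + l * euler + 2 * l * e1) -
        (s * z - (v 0 + v 1 + v 2)) * e3 - z * r * e2

-- After scaling, the two linear equations leave one coordinate in each of `u` and `v`, against the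
-- three equations `Q' = Q = uMv = 0`, each of which determines one coefficient.
open CubicForm in
theorem bil_ofParams_ne_zero (ht : AlgebraicIndependent ℂ t) {u v : Fin 3 → F} (hu : u ≠ 0)
    (hv : v ≠ 0) (hlu : lin u = 0) (hlv : lin v = 0) (hQ : quad (ofParams p q t).b u = 0)
    (hQ' : quad (ofParams p q t).a v = 0) : (ofParams p q t).bil u v ≠ 0 := by
  intro hB
  obtain ⟨i, hi⟩ := Function.ne_iff.mp hu
  obtain ⟨j, hj⟩ := Function.ne_iff.mp hv
  replace hi : u i ≠ 0 := hi
  replace hj : v j ≠ 0 := hj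
  wlog h1 : u i = 1 ∧ v j = 1 generalizing u v
  · refine this (u := fun k => (u i)⁻¹ * u k) (v := fun k => (v j)⁻¹ * v k) ?_ ?_ ?_ ?_ ?_ ?_ ?_
      ?_ ?_ ?_
    · exact fun h => one_ne_zero ((inv_mul_cancel₀ hi).symm.trans (congrFun h i))
    · exact fun h => one_ne_zero ((inv_mul_cancel₀ hj).symm.trans (congrFun h j))
    · simp only [lin] at hlu ⊢
      linear_combination (u i)⁻¹ * hlu
    · simp only [lin] at hlv ⊢
      linear_combination (v j)⁻¹ * hlv
    · rw [quad_smul, hQ, mul_zero]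
    · rw [quad_smul, hQ', mul_zero]
    · simp only [bil, Fin.sum_univ_three] at hB ⊢
      linear_combination (u i)⁻¹ * (v j)⁻¹ * hB
    · exact mul_ne_zero (inv_ne_zero hi) hi
    · exact mul_ne_zero (inv_ne_zero hj) hj
    · exact ⟨inv_mul_cancel₀ hi, inv_mul_cancel₀ hj⟩
  obtain ⟨hui, hvj⟩ := h1
  have hinj : ∀ i j : Fin 3, Function.Injective (![.inr (.inr (i, j)), .inr (.inl (sqIndex i)),
      .inl (sqIndex j)] : Fin 3 → FormIndex) := by decide
  refine false_of_forall_mem ht _ (Sum.inl_injective.comp (hinj i j))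
    ![u (i + 2), v (j + 2)] (by simp) fun L hL hy => ?_
  have hk : ∀ k ∈ ([.inl (sqIndex (j + 1)), .inl (sqIndex (j + 2)),
      .inl (oppIndex j), .inl (oppIndex (j + 1)), .inl (oppIndex (j + 2)),
      .inr (.inl (sqIndex (i + 1))), .inr (.inl (sqIndex (i + 2))), .inr (.inl (oppIndex i)),
      .inr (.inl (oppIndex (i + 1))), .inr (.inl (oppIndex (i + 2))),
      .inr (.inr (i, j + 1)), .inr (.inr (i, j + 2)),
      .inr (.inr (i + 1, j)), .inr (.inr (i + 1, j + 1)), .inr (.inr (i + 1, j + 2)),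
      .inr (.inr (i + 2, j)), .inr (.inr (i + 2, j + 1)), .inr (.inr (i + 2, j + 2))] :
      List FormIndex), t (.inl k) ∈ L := by
    intro k hk
    refine hL _ ?_
    rintro ⟨m, hm⟩
    have hm' := Sum.inl_injective hm
    have key : ∀ i j, ∀ k ∈ ([.inl (sqIndex (j + 1)), .inl (sqIndex (j + 2)),
      .inl (oppIndex j), .inl (oppIndex (j + 1)), .inl (oppIndex (j + 2)),
      .inr (.inl (sqIndex (i + 1))), .inr (.inl (sqIndex (i + 2))), .inr (.inl (oppIndex i)),
      .inr (.inl (oppIndex (i + 1))), .inr (.inl (oppIndex (i + 2))),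
      .inr (.inr (i, j + 1)), .inr (.inr (i, j + 2)),
      .inr (.inr (i + 1, j)), .inr (.inr (i + 1, j + 1)), .inr (.inr (i + 1, j + 2)),
      .inr (.inr (i + 2, j)), .inr (.inr (i + 2, j + 1)), .inr (.inr (i + 2, j + 2))] :
      List FormIndex), ∀ m, (![.inr (.inr (i, j)), .inr (.inl (sqIndex i)),
      .inl (sqIndex j)] : Fin 3 → FormIndex) m ≠ k := by decide
    exact key i j k hk m hm'
  set d := ofParams p q t with hd
  have a1 : d.a (sqIndex (j + 1)) ∈ L := hk _ (by simp)
  have a2 : d.a (sqIndex (j + 2)) ∈ L := hk _ (by simp)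
  have a3 : d.a (oppIndex j) ∈ L := hk _ (by simp)
  have a4 : d.a (oppIndex (j + 1)) ∈ L := hk _ (by simp)
  have a5 : d.a (oppIndex (j + 2)) ∈ L := hk _ (by simp)
  have b1 : d.b (sqIndex (i + 1)) ∈ L := hk _ (by simp)
  have b2 : d.b (sqIndex (i + 2)) ∈ L := hk _ (by simp)
  have b3 : d.b (oppIndex i) ∈ L := hk _ (by simp)
  have b4 : d.b (oppIndex (i + 1)) ∈ L := hk _ (by simp)
  have b5 : d.b (oppIndex (i + 2)) ∈ L := hk _ (by simp)
  have m01 : d.M i (j + 1) ∈ L := hk _ (by simp)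
  have m02 : d.M i (j + 2) ∈ L := hk _ (by simp)
  have m10 : d.M (i + 1) j ∈ L := hk _ (by simp)
  have m11 : d.M (i + 1) (j + 1) ∈ L := hk _ (by simp)
  have m12 : d.M (i + 1) (j + 2) ∈ L := hk _ (by simp)
  have m20 : d.M (i + 2) j ∈ L := hk _ (by simp)
  have m21 : d.M (i + 2) (j + 1) ∈ L := hk _ (by simp)
  have m22 : d.M (i + 2) (j + 2) ∈ L := hk _ (by simp)
  have u2 : u (i + 2) ∈ L := hy 0
  have v2 : v (j + 2) ∈ L := hy 1
  have one : (1 : F) ∈ L := one_mem L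
  clear hk hL hy
  rw [lin_eq_cyclic _ i, hui] at hlu
  rw [lin_eq_cyclic _ j, hvj] at hlv
  rw [quad_eq_cyclic _ _ i, hui] at hQ
  rw [quad_eq_cyclic _ _ j, hvj] at hQ'
  rw [bil, Fin.sum_univ_cyclic _ i, Fin.sum_univ_cyclic _ j, Fin.sum_univ_cyclic _ j,
    Fin.sum_univ_cyclic _ j, hui, hvj] at hB
  have u1 : u (i + 1) ∈ L := mem_of_mul_add_eq_zero (r := 1 + u (i + 2)) one
    (add_mem one u2) one_ne_zero (by linear_combination hlu)
  have v1 : v (j + 1) ∈ L := mem_of_mul_add_eq_zero (r := 1 + v (j + 2)) one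
    (add_mem one v2) one_ne_zero (by linear_combination hlv)
  have b0 : d.b (sqIndex i) ∈ L := by
    refine mem_of_mul_add_eq_zero (r := d.b (sqIndex (i + 1)) * u (i + 1) ^ 2 +
      d.b (sqIndex (i + 2)) * u (i + 2) ^ 2 + d.b (oppIndex i) * (u (i + 1) * u (i + 2)) +
      d.b (oppIndex (i + 1)) * (u (i + 2) * 1) + d.b (oppIndex (i + 2)) * (1 * u (i + 1)))
      one ?_ one_ne_zero (by linear_combination hQ)
    apply_rules [add_mem, mul_mem, pow_mem]
  have a0 : d.a (sqIndex j) ∈ L := by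
    refine mem_of_mul_add_eq_zero (r := d.a (sqIndex (j + 1)) * v (j + 1) ^ 2 +
      d.a (sqIndex (j + 2)) * v (j + 2) ^ 2 + d.a (oppIndex j) * (v (j + 1) * v (j + 2)) +
      d.a (oppIndex (j + 1)) * (v (j + 2) * 1) + d.a (oppIndex (j + 2)) * (1 * v (j + 1)))
      one ?_ one_ne_zero (by linear_combination hQ')
    apply_rules [add_mem, mul_mem, pow_mem]
  have m00 : d.M i j ∈ L := by
    refine mem_of_mul_add_eq_zero (r := d.M i (j + 1) * (1 * v (j + 1)) +
      d.M i (j + 2) * (1 * v (j + 2)) + (d.M (i + 1) j * (u (i + 1) * 1) +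
      d.M (i + 1) (j + 1) * (u (i + 1) * v (j + 1)) +
      d.M (i + 1) (j + 2) * (u (i + 1) * v (j + 2))) + (d.M (i + 2) j * (u (i + 2) * 1) +
      d.M (i + 2) (j + 1) * (u (i + 2) * v (j + 1)) +
      d.M (i + 2) (j + 2) * (u (i + 2) * v (j + 2))))
      one ?_ one_ne_zero (by linear_combination hB)
    apply_rules [add_mem, mul_mem]
  intro k
  fin_cases k
  exacts [m00, b0, a0]

-- The two-dimensional torus of the Cox gradings acts on the Lagrange system, and serves to
-- normalize `uᵢ = vⱼ = 1`. The multiplier `l` scales by `c² / e`.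
open CubicForm in
theorem false_of_singular_ofParams (ht : AlgebraicIndependent ℂ t) {s z r l : F}
    {u v : Fin 3 → F} (hu : u ≠ 0) (hv : v ≠ 0) (hz : z ≠ 0)
    (e1 : quad (ofParams p q t).a v = s * r) (e2 : lin u + z + l * s = 0)
    (e3 : (ofParams p q t).coxS u z + l * r = 0) (e4 : (ofParams p q t).coxU s u z r v = 0)
    (e5 : (ofParams p q t).coxZ s u z r v = 0)
    (e6 : ∀ k, (ofParams p q t).coxV u z k = l * quadGrad (ofParams p q t).a v k) : False := by
  obtain ⟨i, hi⟩ := Function.ne_iff.mp hu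
  obtain ⟨j, hj⟩ := Function.ne_iff.mp hv
  replace hi : u i ≠ 0 := hi
  replace hj : v j ≠ 0 := hj
  set c := (u i)⁻¹ with hc
  set e := (v j)⁻¹ with he
  have hc0 : c ≠ 0 := inv_ne_zero hi
  have he0 : e ≠ 0 := inv_ne_zero hj
  have e4' := congrFun e4
  refine false_of_singular_of_eq_one (p := p) (q := q) ht (s := s * e * c⁻¹) (z := c * z)
    (r := c * e * r) (l := c ^ 2 * e⁻¹ * l) (u := fun k => c * u k) (v := fun k => e * v k)
    (i := i) (j := j) (inv_mul_cancel₀ hi) (inv_mul_cancel₀ hj) (mul_ne_zero hc0 hz) ?_ ?_ ?_ ?_ ?_ ?_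
  · rw [quad_smul, e1]
    field_simp
  · simp only [lin] at e2 ⊢
    field_simp
    linear_combination c * e2
  · simp only [coxS, quad_smul, Fin.sum_univ_three] at e3 ⊢
    field_simp
    linear_combination c ^ 3 * e3
  · funext k
    have e4k := e4' k
    simp only [coxU, quadGrad_smul, Fin.sum_univ_three, lin, Pi.zero_apply] at e4k ⊢
    field_simp
    linear_combination c * e * e4k
  · simp only [coxZ, quad_smul, bil, Fin.sum_univ_three] at e5 ⊢
    field_simp
    linear_combination c * e * e5
  · intro k
    have e6k := e6 k
    simp only [coxV, quad_smul, quadGrad_smul, Fin.sum_univ_three] at e6k ⊢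
    field_simp
    linear_combination e6k

variable {F κ : Type*} [Field F] [Algebra ℂ F] [Finite κ] {t : FormIndex ⊕ κ → F}
  {p q : Fin 3 → κ}

theorem quad_zero {R : Type*} [CommRing R] (a : Fin 6 → R) : quad a 0 = 0 := by
  simp [quad]

theorem lin_zero {R : Type*} [CommRing R] : lin (0 : Fin 3 → R) = 0 := by
  simp [lin]

-- The general count needs `z`, `u`, `v` nonzero; the strata `z = 0` and `u = 0` reduce to
-- nondegeneracy and nontangency of the two conics and to `bil_ofParams_ne_zero`.
open CubicForm in
theorem isGenericSide_ofParams (ht : AlgebraicIndependent ℂ t) :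
    IsGenericSide (ofParams p q t) := by
  have inja : Function.Injective fun k => (Sum.inl (Sum.inl k) : FormIndex ⊕ κ) :=
    Sum.inl_injective.comp Sum.inl_injective
  have injb : Function.Injective fun k => (Sum.inl (Sum.inr (Sum.inl k)) : FormIndex ⊕ κ) :=
    Sum.inl_injective.comp (Sum.inr_injective.comp Sum.inl_injective)
  have ha0 : ∀ v, quadGrad (ofParams p q t).a v = 0 → v = 0 := fun v h =>
    eq_zero_of_quadGrad_eq_zero ht inja h
  have hb0 : ∀ v, quadGrad (ofParams p q t).b v = 0 → v = 0 := fun v h =>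
    eq_zero_of_quadGrad_eq_zero ht injb h
  have ha1 : ∀ v c, (∀ k, quadGrad (ofParams p q t).a v k = c) → lin v = 0 → v = 0 := by
    intro v c h hv
    refine eq_zero_of_quadGrad_eq_smul ht inja (γ := 1) (c := c) (fun k => one_ne_zero)
      (fun L _ _ => one_mem L) (fun k => (h k).trans (mul_one c).symm) ?_
    simpa [Fin.sum_univ_three, lin] using hv
  have hb1 : ∀ v c, (∀ k, quadGrad (ofParams p q t).b v k = c) → lin v = 0 → v = 0 := by
    intro v c h hv
    refine eq_zero_of_quadGrad_eq_smul ht injb (γ := 1) (c := c) (fun k => one_ne_zero)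
      (fun L _ _ => one_mem L) (fun k => (h k).trans (mul_one c).symm) ?_
    simpa [Fin.sum_univ_three, lin] using hv
  refine ⟨fun v hv h => hv (ha0 v h), fun u v hu hv h1 h2 h3 h4 =>
    bil_ofParams_ne_zero ht hu hv h1 h2 h3 h4, ?_⟩
  intro s u z r v l hv hne e1 e2 e3 e4 e5 e6
  have e4' := congrFun e4
  by_cases hz : z = 0
  · subst hz
    simp only [coxS, coxU, coxZ, coxV, zero_mul, mul_zero, add_zero, zero_add, Pi.zero_apply,
      ne_eq, OfNat.ofNat_ne_zero, not_false_eq_true, zero_pow] at e2 e3 e4' e5 e6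
    by_cases hl : l = 0
    · subst hl
      simp only [zero_mul, add_zero, forall_const] at e2 e6
      rw [e6, mul_zero, add_zero] at e5
      by_cases hu : u = 0
      · subst hu
        refine hne ⟨rfl, rfl, ?_⟩
        simpa [bil] using e5
      · have h0 : (fun k => lin v * u k) = 0 := by
          refine hb1 _ (-r) (fun k => ?_) ?_
          · rw [quadGrad_smul]
            linear_combination e4' k
          · simp only [lin] at e2 ⊢
            linear_combination (v 0 + v 1 + v 2) * e2
        obtain ⟨k, hk⟩ := Function.ne_iff.mp hu
        have hlv : lin v = 0 := (mul_eq_zero.mp (congrFun h0 k)).resolve_right hk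
        have hr : r = 0 := by
          have := e4' 0
          rwa [hlv, zero_mul, add_zero] at this
        subst hr
        rw [mul_zero] at e1
        rw [zero_add] at e5
        exact bil_ofParams_ne_zero ht hu hv e2 hlv e6 e1 e5
    · have hr : r = 0 := (mul_eq_zero.mp e3).resolve_left hl
      subst hr
      simp only [zero_add] at e4'
      by_cases hlv : lin v = 0
      · refine hv (ha1 v (l⁻¹ * quad (ofParams p q t).b u) (fun k => ?_) hlv)
        rw [e6 k, inv_mul_cancel_left₀ hl]
      · have hu : u = 0 :=
          hb0 u (funext fun k => (mul_eq_zero.mp (e4' k)).resolve_left hlv)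
        exact hne ⟨hu, rfl, rfl⟩
  · by_cases hu : u = 0
    · subst hu
      have h2 : (2 : F) ≠ 0 := by
        have := charZero_of_injective_algebraMap (algebraMap ℂ F).injective
        exact two_ne_zero
      simp only [coxS, coxZ, coxV, bil, quad_zero, lin_zero, zero_mul, mul_zero, add_zero, zero_add,
        Pi.zero_apply, Finset.sum_const_zero] at e2 e3 e5 e6
      have hl : l ≠ 0 := by
        rintro rfl
        exact hz (by simpa using e2)
      have hr : r = 0 := (mul_eq_zero.mp e3).resolve_left hl
      rw [hr, zero_add] at e5
      have hβ : ∑ k, (ofParams p q t).β k * v k = 0 :=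
        (mul_eq_zero.mp ((mul_eq_zero.mp e5).resolve_left h2)).resolve_left hz
      -- With `u = 0` the conic `Q` would be tangent to the line `β · v = 0`. The `β` are
      -- independent of the coefficients of `Q` and nonzero, even if some of them coincide.
      refine hv (eq_zero_of_quadGrad_eq_smul ht inja (γ := (ofParams p q t).β)
        (c := l⁻¹ * z ^ 2) (fun k => ht.ne_zero _) (fun L hL k => hL _ ?_) (fun k => ?_) hβ)
      · rintro ⟨m, hm⟩
        cases hm
      · have := e6 k
        change quadGrad (ofParams p q t).a v k = _
        field_simp
        linear_combination -this
    · exact false_of_singular_ofParams ht hu hv hz e1 e2 e3 e4 e5 e6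

theorem isGenericSide_swap_ofParams (ht : AlgebraicIndependent ℂ t) :
    IsGenericSide (CubicForm.ofParams p q t).swap := by
  let e : FormIndex ⊕ κ → FormIndex ⊕ κ :=
    Sum.map (Sum.elim (Sum.inr ∘ Sum.inl) (Sum.elim Sum.inl (Sum.inr ∘ Sum.inr ∘ Prod.swap))) id
  have he : Function.Injective e := by
    refine Sum.map_injective.mpr ⟨?_, Function.injective_id⟩
    decide
  exact isGenericSide_ofParams (p := q) (q := p) (ht.comp e he)

/-! ### From algebraically independent coefficients to generic complex coefficients -/

section Ultraproduct

open Filter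

theorem exists_ultrafilter_of_directed {ι Ω : Type*} [Nonempty ι] (B : ι → Set Ω)
    (hB : ∀ i j, ∃ k, B k ⊆ B i ∩ B j) (hn : ∀ i, (B i).Nonempty) :
    ∃ U : Ultrafilter Ω, ∀ i, ∀ᶠ ω in U, ω ∈ B i := by
  have hf : (⨅ i, 𝓟 (B i)).NeBot := by
    refine iInf_neBot_of_directed' ?_ fun i => principal_neBot_iff.mpr (hn i)
    intro i j
    obtain ⟨k, hk⟩ := hB i j
    exact ⟨k, principal_mono.mpr (hk.trans Set.inter_subset_left),
      principal_mono.mpr (hk.trans Set.inter_subset_right)⟩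
  exact ⟨Ultrafilter.of (⨅ i, 𝓟 (B i)), fun i => Ultrafilter.of_le (⨅ i, 𝓟 (B i))
    (mem_iInf_of_mem i (mem_principal_self (B i)))⟩

/-- If no `G` works, the sets where `G ≠ 0` and `P` fails are all nonempty, and directed because
products of nonzero polynomials are nonzero. An ultrafilter containing them contradicts the
hypothesis. -/
theorem exists_ne_zero_of_forall_ultrafilter {T : Type*} {P : (T → ℂ) → Prop}
    (h : ∀ U : Ultrafilter (T → ℂ),
      (∀ G : MvPolynomial T ℂ, G ≠ 0 → ∀ᶠ ω in U, MvPolynomial.eval ω G ≠ 0) → ∀ᶠ ω in U, P ω) :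
    ∃ G : MvPolynomial T ℂ, G ≠ 0 ∧ ∀ ω, MvPolynomial.eval ω G ≠ 0 → P ω := by
  by_contra! hc
  have : Nonempty {G : MvPolynomial T ℂ // G ≠ 0} := ⟨⟨1, one_ne_zero⟩⟩
  obtain ⟨U, hU⟩ := exists_ultrafilter_of_directed
    (fun G : {G : MvPolynomial T ℂ // G ≠ 0} => {ω | MvPolynomial.eval ω G.1 ≠ 0 ∧ ¬ P ω})
    (by
      rintro ⟨G, hG⟩ ⟨H, hH⟩
      refine ⟨⟨G * H, mul_ne_zero hG hH⟩, fun ω hω => ?_⟩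
      have h1 : MvPolynomial.eval ω (G * H) ≠ 0 := hω.1
      rw [map_mul] at h1
      exact ⟨⟨left_ne_zero_of_mul h1, hω.2⟩, ⟨right_ne_zero_of_mul h1, hω.2⟩⟩)
    (fun G => hc G.1 G.2)
  have h1 := h U fun G hG => (hU ⟨G, hG⟩).mono fun ω hω => hω.1
  obtain ⟨ω, h2, h3⟩ := ((hU ⟨1, one_ne_zero⟩).and h1).exists
  exact h2.2 h3

variable {T Ω : Type*} (U : Ultrafilter Ω)

/-- The ring homomorphism from complex functions to their germs along an ultrafilter. -/
abbrev germHom : (Ω → ℂ) →+* Germ (U : Filter Ω) ℂ := Germ.coeRingHom _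

/-- The algebra structure on germs given by constant functions. -/
abbrev germAlgebra : Algebra ℂ (Germ (U : Filter Ω) ℂ) :=
  ((germHom U).comp (Pi.constRingHom Ω ℂ)).toAlgebra

variable {U}

theorem germHom_eq_zero_iff {f : Ω → ℂ} : germHom U f = 0 ↔ ∀ᶠ ω in U, f ω = 0 :=
  Germ.coe_eq

theorem germHom_eq_iff {f g : Ω → ℂ} : germHom U f = germHom U g ↔ ∀ᶠ ω in U, f ω = g ω :=
  Germ.coe_eq

/-- A relation between the germs is a polynomial vanishing on a large set, whereas the ultrafilter
lives off the zero set of each nonzero polynomial. -/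
theorem algebraicIndependent_germHom {t : T → Ω → ℂ}
    (h : ∀ G : MvPolynomial T ℂ, G ≠ 0 → ∀ᶠ ω in U, MvPolynomial.eval (fun i => t i ω) G ≠ 0) :
    letI := germAlgebra U
    AlgebraicIndependent ℂ fun i => germHom U (t i) := by
  let := germAlgebra U
  rw [algebraicIndependent_iff]
  intro G hG
  by_contra h0
  have h1 : germHom U (fun ω => MvPolynomial.eval (fun i => t i ω) G) = 0 := by
    have h2 : (fun ω => MvPolynomial.eval (fun i => t i ω) G) =
        MvPolynomial.eval₂ (Pi.constRingHom Ω ℂ) t G := by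
      funext ω
      exact (MvPolynomial.eval₂_comp_left (Pi.evalRingHom (fun _ => ℂ) ω)
        (Pi.constRingHom Ω ℂ) t G).symm
    rw [h2, MvPolynomial.eval₂_comp_left]
    exact hG
  obtain ⟨ω, h2, h3⟩ := ((germHom_eq_zero_iff.mp h1).and (h G h0)).exists
  exact h3 h2

theorem germHom_comp_eq_zero_iff {f : Fin 3 → Ω → ℂ} :
    germHom U ∘ f = 0 ↔ ∀ᶠ ω in U, (fun i => f i ω) = 0 := by
  simp only [funext_iff, eventually_all]
  exact forall_congr' fun i => germHom_eq_zero_iff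

/-- The relevant instance of Łoś's theorem: if a condition fails for almost all `ω`, choosing a
counterexample for each `ω` gives a counterexample over the field of germs. -/
theorem eventually_isGenericSide (d : CubicForm (Ω → ℂ)) (h : IsGenericSide (d.map (germHom U))) :
    ∀ᶠ ω in U, IsGenericSide (d.map (Pi.evalRingHom (fun _ => ℂ) ω)) := by
  have ev : ∀ (v : Ω → Fin 3 → ℂ) (ω : Ω),
      ⇑(Pi.evalRingHom (fun _ => ℂ) ω) ∘ (fun k ω => v ω k) = v ω := fun _ _ => rfl
  have hzero : ∀ {v : Ω → Fin 3 → ℂ}, (germHom U ∘ fun k ω => v ω k) = 0 ↔ ∀ᶠ ω in U, v ω = 0 :=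
    germHom_comp_eq_zero_iff
  have hne : ∀ {v : Ω → Fin 3 → ℂ}, (∀ᶠ ω in U, v ω ≠ 0) → (germHom U ∘ fun k ω => v ω k) ≠ 0 :=
    fun hv h0 => Ultrafilter.eventually_not.mp hv (hzero.mp h0)
  have h1 : ∀ᶠ ω in U, ∀ v : Fin 3 → ℂ, v ≠ 0 →
      quadGrad (d.map (Pi.evalRingHom (fun _ => ℂ) ω)).a v ≠ 0 := by
    by_contra hc
    rw [← Ultrafilter.eventually_not] at hc
    push Not at hc
    obtain ⟨v, hv⟩ := skolem.mp hc
    refine h.quadGrad_ne_zero _ (hne (hv.mono fun ω hω => hω.1)) ?_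
    funext k
    rw [CubicForm.map_a, ← map_quadGrad]
    refine germHom_eq_zero_iff.mpr (hv.mono fun ω hω => ?_)
    exact (map_quadGrad (Pi.evalRingHom (fun _ => ℂ) ω) d.a (fun k ω => v ω k) k).trans (congrFun hω.2 k)
  have h2 : ∀ᶠ ω in U, ∀ u v : Fin 3 → ℂ, u ≠ 0 → v ≠ 0 → lin u = 0 → lin v = 0 →
      quad (d.map (Pi.evalRingHom (fun _ => ℂ) ω)).b u = 0 →
      quad (d.map (Pi.evalRingHom (fun _ => ℂ) ω)).a v = 0 →
      (d.map (Pi.evalRingHom (fun _ => ℂ) ω)).bil u v ≠ 0 := by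
    by_contra hc
    rw [← Ultrafilter.eventually_not] at hc
    push Not at hc
    obtain ⟨u, hc⟩ := skolem.mp hc
    obtain ⟨v, hv⟩ := skolem.mp hc
    refine h.bil_ne_zero _ _ (hne (hv.mono fun ω hω => hω.1))
      (hne (hv.mono fun ω hω => hω.2.1)) ?_ ?_ ?_ ?_ ?_
    · rw [← map_lin]
      exact germHom_eq_zero_iff.mpr (hv.mono fun ω hω => hω.2.2.1)
    · rw [← map_lin]
      exact germHom_eq_zero_iff.mpr (hv.mono fun ω hω => hω.2.2.2.1)
    · rw [CubicForm.map_b, ← map_quad]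
      refine germHom_eq_zero_iff.mpr (hv.mono fun ω hω => ?_)
      exact (map_quad (Pi.evalRingHom (fun _ => ℂ) ω) d.b fun k ω => u ω k).trans hω.2.2.2.2.1
    · rw [CubicForm.map_a, ← map_quad]
      refine germHom_eq_zero_iff.mpr (hv.mono fun ω hω => ?_)
      exact (map_quad (Pi.evalRingHom (fun _ => ℂ) ω) d.a fun k ω => v ω k).trans hω.2.2.2.2.2.1
    · rw [← CubicForm.map_bil]
      refine germHom_eq_zero_iff.mpr (hv.mono fun ω hω => ?_)
      exact (d.map_bil (Pi.evalRingHom (fun _ => ℂ) ω) (fun k ω => u ω k) fun k ω => v ω k).trans hω.2.2.2.2.2.2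
  have h3 : ∀ᶠ ω in U, ∀ (s : ℂ) (u : Fin 3 → ℂ) (z q : ℂ) (v : Fin 3 → ℂ) (l : ℂ), v ≠ 0 →
      ¬ (u = 0 ∧ z = 0 ∧ q = 0) → quad (d.map (Pi.evalRingHom (fun _ => ℂ) ω)).a v = s * q →
      lin u + z + l * s = 0 → (d.map (Pi.evalRingHom (fun _ => ℂ) ω)).coxS u z + l * q = 0 →
      (d.map (Pi.evalRingHom (fun _ => ℂ) ω)).coxU s u z q v = 0 →
      (d.map (Pi.evalRingHom (fun _ => ℂ) ω)).coxZ s u z q v = 0 →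
      (∀ i, (d.map (Pi.evalRingHom (fun _ => ℂ) ω)).coxV u z i =
        l * quadGrad (d.map (Pi.evalRingHom (fun _ => ℂ) ω)).a v i) → False := by
    by_contra hc
    rw [← Ultrafilter.eventually_not] at hc
    simp only [not_forall, exists_prop, not_false_eq_true, and_true] at hc
    obtain ⟨s, hc⟩ := skolem.mp hc
    obtain ⟨u, hc⟩ := skolem.mp hc
    obtain ⟨z, hc⟩ := skolem.mp hc
    obtain ⟨q, hc⟩ := skolem.mp hc
    obtain ⟨v, hc⟩ := skolem.mp hc
    obtain ⟨l, hv⟩ := skolem.mp hc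
    refine h.nonsingular (germHom U s) (germHom U ∘ fun k ω => u ω k) (germHom U z) (germHom U q)
      (germHom U ∘ fun k ω => v ω k) (germHom U l)
      (hne (hv.mono fun ω hω => hω.1)) ?_ ?_ ?_ ?_ ?_ ?_ ?_
    · rintro ⟨hu, hz, hq⟩
      obtain ⟨ω, h5, h6, h7, h8⟩ := (hv.and ((hzero.mp hu).and
        ((germHom_eq_zero_iff.mp hz).and (germHom_eq_zero_iff.mp hq)))).exists
      exact h5.2.1 ⟨h6, h7, h8⟩
    · rw [CubicForm.map_a, ← map_quad, ← map_mul]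
      refine germHom_eq_iff.mpr (hv.mono fun ω hω => ?_)
      exact (map_quad (Pi.evalRingHom (fun _ => ℂ) ω) d.a fun k ω => v ω k).trans hω.2.2.1
    · rw [← map_lin, ← map_add, ← map_mul, ← map_add]
      exact germHom_eq_zero_iff.mpr (hv.mono fun ω hω => hω.2.2.2.1)
    · rw [← CubicForm.map_coxS, ← map_mul, ← map_add]
      refine germHom_eq_zero_iff.mpr (hv.mono fun ω hω => ?_)
      exact (congrArg (· + l ω * q ω) (d.map_coxS (Pi.evalRingHom (fun _ => ℂ) ω) (fun k ω => u ω k) z)).trans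
        hω.2.2.2.2.1
    · funext k
      rw [← CubicForm.map_coxU]
      refine germHom_eq_zero_iff.mpr (hv.mono fun ω hω => ?_)
      exact (d.map_coxU (Pi.evalRingHom (fun _ => ℂ) ω) s (fun k ω => u ω k) z q (fun k ω => v ω k) k).trans
        (congrFun hω.2.2.2.2.2.1 k)
    · rw [← CubicForm.map_coxZ]
      refine germHom_eq_zero_iff.mpr (hv.mono fun ω hω => ?_)
      exact (d.map_coxZ (Pi.evalRingHom (fun _ => ℂ) ω) s (fun k ω => u ω k) z q fun k ω => v ω k).trans hω.2.2.2.2.2.2.1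
    · intro k
      rw [← CubicForm.map_coxV, CubicForm.map_a, ← map_quadGrad, ← map_mul]
      refine germHom_eq_iff.mpr (hv.mono fun ω hω => ?_)
      refine (d.map_coxV (Pi.evalRingHom (fun _ => ℂ) ω) (fun k ω => u ω k) z k).trans
        ((hω.2.2.2.2.2.2.2 k).trans ?_)
      exact congrArg (l ω * ·) (map_quadGrad (Pi.evalRingHom (fun _ => ℂ) ω) d.a (fun k ω => v ω k) k).symm
  filter_upwards [h1, h2, h3] with ω a1 a2 a3
  exact ⟨a1, a2, a3⟩

/-- A cubic form with generic parameters satisfies the genericity conditions over both conics. -/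
theorem exists_ne_zero_isGenericSide_ofParams {κ : Type*} [Finite κ] (p q : Fin 3 → κ) :
    ∃ G : MvPolynomial (FormIndex ⊕ κ) ℂ, G ≠ 0 ∧ ∀ t, MvPolynomial.eval t G ≠ 0 →
      IsGenericSide (CubicForm.ofParams p q t) ∧ IsGenericSide (CubicForm.ofParams p q t).swap := by
  refine exists_ne_zero_of_forall_ultrafilter fun U hU => ?_
  let := germAlgebra U
  -- The coordinate functions on the parameter space; their germs are the generic coefficients.
  let x : FormIndex ⊕ κ → (FormIndex ⊕ κ → ℂ) → ℂ := fun i ω => ω i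
  have ht : AlgebraicIndependent ℂ fun i => germHom U (x i) := algebraicIndependent_germHom hU
  exact (eventually_isGenericSide (CubicForm.ofParams p q x) (isGenericSide_ofParams ht)).and
    (eventually_isGenericSide (CubicForm.ofParams p q x).swap (isGenericSide_swap_ofParams ht))

end Ultraproduct

/-! ### Connectivity of the double box graph with some edges cut -/

/-- One end of an edge. -/
def edgeSrc : Fin 7 → Fin 6 := ![0, 2, 3, 0, 0, 4, 5]

/-- The other end of an edge. -/
def edgeTgt : Fin 7 → Fin 6 := ![2, 3, 1, 1, 4, 5, 1]

theorem edge_eq (e : Fin 7) : edge e = s(edgeSrc e, edgeTgt e) := by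
  fin_cases e <;> rfl

theorem edge_injective : Function.Injective edge := by
  decide

theorem edgeSrc_ne_edgeTgt : ∀ e, edgeSrc e ≠ edgeTgt e := by
  decide

/-- Identify two labels. -/
def mergeLabels (f : Fin 6 → Fin 6) (e : Fin 7) (v : Fin 6) : Fin 6 :=
  if f v = f (edgeTgt e) then f (edgeSrc e) else f v

/-- A labelling of the vertices by connected components. -/
def label (T : Finset (Fin 7)) : Fin 6 → Fin 6 :=
  ((List.finRange 7).filter (· ∉ T)).foldl mergeLabels id

-- A finite check over all sets of cut edges. It shows that labels are constant on components; the
-- converse is `reachable_of_foldl_eq`.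
set_option maxRecDepth 10000 in
theorem label_edge : ∀ T : Finset (Fin 7), ∀ e, e ∉ T →
    label T (edgeSrc e) = label T (edgeTgt e) := by
  decide +kernel

/-- The invariant "equal labels imply reachable" survives each merging step, since only the classes
of the two ends of an edge are merged. -/
theorem reachable_of_foldl_eq {G : SimpleGraph (Fin 6)} (es : List (Fin 7))
    (h : ∀ e ∈ es, G.Reachable (edgeSrc e) (edgeTgt e)) (f : Fin 6 → Fin 6)
    (hf : ∀ u v, f u = f v → G.Reachable u v) (u v : Fin 6)
    (huv : es.foldl mergeLabels f u = es.foldl mergeLabels f v) : G.Reachable u v := by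
  induction es generalizing f with
  | nil => exact hf u v huv
  | cons e es ih =>
    refine ih (fun e' he' => h e' (List.mem_cons_of_mem _ he')) (mergeLabels f e) ?_ huv
    intro u v huv
    have he := h e List.mem_cons_self
    simp only [mergeLabels] at huv
    split_ifs at huv with h1 h2 h2
    · exact hf _ _ (h1.trans h2.symm)
    · exact ((hf _ _ h1).trans he.symm).trans (hf _ _ huv)
    · exact (hf _ _ huv).trans (he.trans (hf _ _ h2.symm))
    · exact hf _ _ huv

theorem adj_cutGraph {T : Finset (Fin 7)} {e : Fin 7} (he : e ∉ T) :
    (cutGraph T).Adj (edgeSrc e) (edgeTgt e) := by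
  rw [cutGraph, SimpleGraph.fromEdgeSet_adj]
  exact ⟨⟨e, he, edge_eq e⟩, edgeSrc_ne_edgeTgt e⟩

theorem reachable_cutGraph_iff (T : Finset (Fin 7)) (u v : Fin 6) :
    (cutGraph T).Reachable u v ↔ label T u = label T v := by
  constructor
  · rintro ⟨p⟩
    induction p with
    | nil => rfl
    | cons h p ih =>
      refine Eq.trans ?_ ih
      rw [cutGraph, SimpleGraph.fromEdgeSet_adj] at h
      obtain ⟨⟨e, he, h1⟩, -⟩ := h
      rw [edge_eq, Sym2.eq_iff] at h1
      rcases h1 with ⟨rfl, rfl⟩ | ⟨rfl, rfl⟩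
      · exact label_edge T e he
      · exact (label_edge T e he).symm
  · refine reachable_of_foldl_eq _ (fun e he => ?_) id (fun u v h => ?_) u v
    · exact (adj_cutGraph (by simpa using he)).reachable
    · rw [show u = v from h]

theorem cutGraph_connected_iff (T : Finset (Fin 7)) :
    (cutGraph T).Connected ↔ ∀ v, label T 0 = label T v := by
  constructor
  · exact fun h v => (reachable_cutGraph_iff T 0 v).mp (h.preconnected 0 v)
  · intro h
    refine ⟨fun u v => (reachable_cutGraph_iff T u v).mpr ((h u).symm.trans (h v))⟩

/-- Five of the seven edges remain on six vertices, so connectedness alone makes a tree. -/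
theorem cutGraph_isTree_iff {T : Finset (Fin 7)} (hT : T.card = 2) :
    (cutGraph T).IsTree ↔ ∀ v, label T 0 = label T v := by
  rw [SimpleGraph.isTree_iff_connected_and_card, cutGraph_connected_iff, and_iff_left]
  have h1 : (cutGraph T).edgeSet = edge '' (T : Set (Fin 7))ᶜ := by
    rw [cutGraph, SimpleGraph.edgeSet_fromEdgeSet, sdiff_eq_left, Set.disjoint_left]
    rintro _ ⟨e, -, rfl⟩ h
    rw [edge_eq] at h
    exact edgeSrc_ne_edgeTgt e h
  rw [h1, Nat.card_image_of_injective edge_injective, Nat.card_coe_set_eq, ← Finset.coe_compl,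
    Set.ncard_coe_finset, Finset.card_compl, hT]
  simp

theorem card_connectedComponent_cutGraph (T : Finset (Fin 7)) :
    Nat.card (cutGraph T).ConnectedComponent = (Finset.univ.image (label T)).card := by
  let f : (cutGraph T).ConnectedComponent → Fin 6 :=
    SimpleGraph.ConnectedComponent.lift (label T)
      fun u v p _ => (reachable_cutGraph_iff T u v).mp ⟨p⟩
  have hf : Function.Injective f := by
    refine SimpleGraph.ConnectedComponent.ind₂ fun u v h => ?_
    exact SimpleGraph.ConnectedComponent.sound ((reachable_cutGraph_iff T u v).mpr h)
  have hr : Set.range f = (Finset.univ.image (label T) : Finset (Fin 6)) := by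
    ext k
    simp only [Set.mem_range, Finset.coe_image, Finset.coe_univ, Set.image_univ]
    constructor
    · rintro ⟨c, rfl⟩
      induction c using SimpleGraph.ConnectedComponent.ind with
      | h v => exact ⟨v, rfl⟩
    · rintro ⟨v, rfl⟩
      exact ⟨(cutGraph T).connectedComponentMk v, rfl⟩
  rw [← Set.ncard_coe_finset, ← hr, Set.ncard_range_of_injective hf]

-- Used for acyclicity: restoring a suitable edge gives a tree, and subgraphs of a tree are acyclic.
set_option maxRecDepth 10000 in
theorem exists_label_erase : ∀ T ∈ Finset.powersetCard 3 (Finset.univ : Finset (Fin 7)),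
    (Finset.univ.image (label T)).card = 2 →
      ∃ e ∈ T, ∀ v, label (T.erase e) 0 = label (T.erase e) v := by
  decide +kernel

theorem isTwoTree_cutGraph_iff {T : Finset (Fin 7)} (hT : T.card = 3) :
    IsTwoTree (cutGraph T) ↔ (Finset.univ.image (label T)).card = 2 := by
  rw [IsTwoTree, card_connectedComponent_cutGraph, and_iff_right_iff_imp]
  intro h
  obtain ⟨e, he, h1⟩ := exists_label_erase T
    (Finset.mem_powersetCard.mpr ⟨Finset.subset_univ _, hT⟩) h
  have h2 : (cutGraph (T.erase e)).IsTree :=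
    (cutGraph_isTree_iff (by rw [Finset.card_erase_of_mem he, hT])).mpr h1
  refine h2.isAcyclic.anti ?_
  refine SimpleGraph.fromEdgeSet_mono (Set.image_mono (Set.compl_subset_compl.mpr ?_))
  exact Finset.coe_subset.mpr (Finset.erase_subset _ _)

/-- The pairs of edges whose removal leaves a tree. -/
abbrev treePair : (Fin 3 × Fin 3) ⊕ Fin 3 ⊕ Fin 3 → Finset (Fin 7) :=
  Sum.elim (fun p => {Fin.castAdd 4 p.1, Fin.natAdd 4 p.2})
    (Sum.elim (fun i => {Fin.castAdd 4 i, 3}) (fun j => {3, Fin.natAdd 4 j}))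

/-- The triples of edges whose removal leaves a forest with two components. -/
abbrev twoTreeTriple : (Fin 3 × Fin 4) ⊕ (Fin 3 × Fin 4) ⊕ (Fin 3 × Fin 3) → Finset (Fin 7) :=
  Sum.elim (fun p : Fin 3 × Fin 4 =>
      {Fin.castAdd 4 (p.1 + 1), Fin.castAdd 4 (p.1 + 2), Fin.natAdd 3 p.2})
    (Sum.elim (fun p : Fin 3 × Fin 4 =>
        {(Fin.natAdd 4 (p.1 + 1) : Fin 7), (Fin.natAdd 4 (p.1 + 2) : Fin 7), Fin.castAdd 3 p.2})
      (fun p => {Fin.castAdd 4 p.1, 3, Fin.natAdd 4 p.2}))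

theorem treePair_injective : Function.Injective treePair := by
  decide +kernel

theorem twoTreeTriple_injective : Function.Injective twoTreeTriple := by
  decide +kernel

set_option maxRecDepth 10000 in
theorem filter_label_eq_image_treePair :
    (Finset.powersetCard 2 (Finset.univ : Finset (Fin 7))).filter
      (fun T => ∀ v, label T 0 = label T v) = Finset.univ.image treePair := by
  decide +kernel

set_option maxRecDepth 10000 in
theorem filter_label_eq_image_twoTreeTriple :
    (Finset.powersetCard 3 (Finset.univ : Finset (Fin 7))).filter
      (fun T => (Finset.univ.image (label T)).card = 2) = Finset.univ.image twoTreeTriple := by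
  decide +kernel

/-- The vertices split off by cutting two edges of the same chain or one edge of each chain. -/
abbrev splitVertices : (Fin 3 × Fin 4) ⊕ (Fin 3 × Fin 4) ⊕ (Fin 3 × Fin 3) → Finset (Fin 6) :=
  Sum.elim (fun p => (![{3}, {2, 3}, {2}] : Fin 3 → Finset (Fin 6)) p.1)
    (Sum.elim (fun p => (![{5}, {4, 5}, {4}] : Fin 3 → Finset (Fin 6)) p.1)
      (fun p => (![{0}, {0, 2}, {0, 2, 3}] : Fin 3 → Finset (Fin 6)) p.1 ∪
        (![∅, {4}, {4, 5}] : Fin 3 → Finset (Fin 6)) p.2))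

-- Of the two components, `splitVertices` names the one without the vertex `1`, whose momentum is
-- later eliminated by conservation.
set_option maxRecDepth 10000 in
theorem filter_label_eq_splitVertices : ∀ k,
    Finset.univ.filter (fun v => label (twoTreeTriple k) 0 = label (twoTreeTriple k) v) =
        splitVertices k ∨
      Finset.univ.filter (fun v => label (twoTreeTriple k) 0 = label (twoTreeTriple k) v) =
        (splitVertices k)ᶜ := by
  decide +kernel

/-! ### The second Symanzik polynomial as a cubic form -/

section Params

variable {R S : Type*} [CommRing R] [CommRing S] {D : ℕ}

/-- The square of the momentum flowing through a triple of cut edges. -/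
def splitSq (w : Fin 6 → Fin D → R) (k : (Fin 3 × Fin 4) ⊕ (Fin 3 × Fin 4) ⊕ (Fin 3 × Fin 3)) : R :=
  ∑ d, (∑ v ∈ splitVertices k, w v d) ^ 2

/-- The quadratic form `(∑ μᵢ² tᵢ) (∑ tᵢ) + s₀ t₁ t₂ + s₁ t₀ t₂ + s₂ t₀ t₁`. -/
def chainForm (μ s : Fin 3 → R) : Fin 6 → R :=
  ![μ 0 ^ 2, μ 0 ^ 2 + μ 1 ^ 2 + s 2, μ 0 ^ 2 + μ 2 ^ 2 + s 1, μ 1 ^ 2, μ 1 ^ 2 + μ 2 ^ 2 + s 0,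
    μ 2 ^ 2]

theorem quad_chainForm (μ s t : Fin 3 → R) : quad (chainForm μ s) t =
    (∑ k, μ k ^ 2 * t k) * lin t + ∑ k, s k * (t (k + 1) * t (k + 2)) := by
  have h1 : (1 : Fin 3) + 1 = 2 := rfl
  have h2 : (1 : Fin 3) + 2 = 0 := rfl
  have h3 : (2 : Fin 3) + 1 = 0 := rfl
  have h4 : (2 : Fin 3) + 2 = 1 := rfl
  simp only [quad, chainForm, lin, Fin.sum_univ_three, Matrix.cons_val, zero_add, h1, h2, h3, h4]
  ring

/-- The parameters of the second Symanzik polynomial. -/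
def symanzikParams (m : Fin 7 → R) (w : Fin 6 → Fin D → R) : FormIndex ⊕ Unit → R :=
  Sum.elim
    (Sum.elim
      (chainForm (fun k => m (Fin.natAdd 4 k)) (fun k => splitSq w (.inr (.inl (k, 0)))))
      (Sum.elim (chainForm (fun k => m (Fin.castAdd 4 k)) (fun k => splitSq w (.inl (k, 0))))
        (fun p => m 3 ^ 2 + m (Fin.castAdd 4 p.1) ^ 2 + m (Fin.natAdd 4 p.2) ^ 2 +
          splitSq w (.inr (.inr p)))))
    (fun _ => m 3 ^ 2)

theorem map_splitSq (f : R →+* S) (w : Fin 6 → Fin D → R) (k) :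
    f (splitSq w k) = splitSq (fun v d => f (w v d)) k := by
  simp [splitSq]

theorem map_chainForm (f : R →+* S) (μ s : Fin 3 → R) (k : Fin 6) :
    f (chainForm μ s k) = chainForm (f ∘ μ) (f ∘ s) k := by
  fin_cases k <;> simp [chainForm]

theorem map_symanzikParams (f : R →+* S) (m : Fin 7 → R) (w : Fin 6 → Fin D → R) (i) :
    f (symanzikParams m w i) = symanzikParams (f ∘ m) (fun v d => f (w v d)) i := by
  rcases i with (k | k | p) | _
  · simp only [symanzikParams, Sum.elim_inl, map_chainForm]
    congr 1
    exact funext fun k => map_splitSq _ _ _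
  · simp only [symanzikParams, Sum.elim_inl, Sum.elim_inr, map_chainForm]
    congr 1
    exact funext fun k => map_splitSq _ _ _
  · simp [symanzikParams, map_splitSq]
  · simp [symanzikParams]

end Params

variable {D : ℕ} {w : Fin 6 → Fin D → ℂ}

/-- By momentum conservation the two components carry opposite momenta, so it does not matter which
one is squared. -/
theorem flowSq_cutGraph (hw : ∑ v, w v = 0) (k) :
    flowSq w (cutGraph (twoTreeTriple k)) = splitSq w k := by
  refine Finset.sum_congr rfl fun d _ => ?_
  have h0 : ∑ v, w v d = 0 := by
    simpa using congrFun hw d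
  have h1 : ∀ (inst : DecidablePred fun v => (cutGraph (twoTreeTriple k)).Reachable 0 v),
      Finset.univ.filter (fun v => (cutGraph (twoTreeTriple k)).Reachable 0 v) =
      Finset.univ.filter (fun v => label (twoTreeTriple k) 0 = label (twoTreeTriple k) v) := by
    intro inst
    ext v
    simp only [Finset.mem_filter, Finset.mem_univ, true_and, reachable_cutGraph_iff]
  rw [h1]
  rcases filter_label_eq_splitVertices k with h | h
  · rw [h]
  · rw [h, ← sub_eq_zero]
    have h2 := Finset.sum_add_sum_compl (splitVertices k) fun v => w v d
    rw [h0] at h2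
    linear_combination (∑ v ∈ (splitVertices k)ᶜ, w v d - ∑ v ∈ splitVertices k, w v d) * h2

theorem firstSymanzik_eq : firstSymanzik = ∑ k, ∏ e ∈ treePair k, x e := by
  rw [firstSymanzik, ← Finset.sum_image (fun _ _ _ _ h => treePair_injective h) (f := fun T => ∏ e ∈ T, x e),
    ← filter_label_eq_image_treePair]
  refine Finset.sum_congr ?_ fun _ _ => rfl
  ext T
  simp only [Finset.mem_filter, Finset.mem_powersetCard]
  refine and_congr_right fun h => ?_
  rw [cutGraph_isTree_iff h.2]

theorem masslessSymanzik_eq (hw : ∑ v, w v = 0) : masslessSymanzik w =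
    ∑ k, MvPolynomial.C (splitSq w k) * ∏ e ∈ twoTreeTriple k, x e := by
  simp only [← flowSq_cutGraph hw]
  rw [masslessSymanzik, ← Finset.sum_image (fun _ _ _ _ h => twoTreeTriple_injective h)
    (f := fun T => MvPolynomial.C (flowSq w (cutGraph T)) * ∏ e ∈ T, x e),
    ← filter_label_eq_image_twoTreeTriple]
  refine Finset.sum_congr ?_ fun _ _ => rfl
  ext T
  simp only [Finset.mem_filter, Finset.mem_powersetCard]
  refine and_congr_right fun h => ?_
  rw [isTwoTree_cutGraph_iff h.2]

theorem sum_treePair : ∑ k, ∏ e ∈ treePair k, x e =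
    lin xU * lin xV + lin xU * x 3 + x 3 * lin xV := by
  have h1 : ∀ i j : Fin 3, (Fin.castAdd 4 i : Fin 7) ≠ Fin.natAdd 4 j := by decide
  have h2 : ∀ i : Fin 3, (Fin.castAdd 4 i : Fin 7) ≠ 3 := by decide
  have h3 : ∀ i : Fin 3, (3 : Fin 7) ≠ Fin.natAdd 4 i := by decide
  simp only [Fintype.sum_sum_type, Fintype.sum_prod_type, treePair, Sum.elim_inl, Sum.elim_inr,
    Finset.prod_pair (h1 _ _), Finset.prod_pair (h2 _), Finset.prod_pair (h3 _)]
  change ∑ i, ∑ j, xU i * xV j + (∑ i, xU i * x 3 + ∑ j, x 3 * xV j) = _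
  simp only [Fin.sum_univ_three, lin]
  ring

theorem sum_twoTreeTriple (s : (Fin 3 × Fin 4) ⊕ (Fin 3 × Fin 4) ⊕ (Fin 3 × Fin 3) → ℂ) :
    ∑ k, MvPolynomial.C (s k) * ∏ e ∈ twoTreeTriple k, x e =
      ∑ i : Fin 3, ∑ j : Fin 4, MvPolynomial.C (s (.inl (i, j))) *
        (xU (i + 1) * (xU (i + 2) * x (Fin.natAdd 3 j))) +
      (∑ i : Fin 3, ∑ j : Fin 4, MvPolynomial.C (s (.inr (.inl (i, j)))) *
        (xV (i + 1) * (xV (i + 2) * x (Fin.castAdd 3 j))) +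
      ∑ i : Fin 3, ∑ j : Fin 3, MvPolynomial.C (s (.inr (.inr (i, j)))) *
        (xU i * (x 3 * xV j))) := by
  have h1 : ∀ (i : Fin 3) (j : Fin 4), (Fin.castAdd 4 (i + 1) : Fin 7) ∉
      ({Fin.castAdd 4 (i + 2), Fin.natAdd 3 j} : Finset (Fin 7)) := by decide
  have h2 : ∀ (i : Fin 3) (j : Fin 4), (Fin.castAdd 4 (i + 2) : Fin 7) ≠ Fin.natAdd 3 j := by
    decide
  have h3 : ∀ (i : Fin 3) (j : Fin 4), (Fin.natAdd 4 (i + 1) : Fin 7) ∉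
      ({(Fin.natAdd 4 (i + 2) : Fin 7), Fin.castAdd 3 j} : Finset (Fin 7)) := by decide
  have h4 : ∀ (i : Fin 3) (j : Fin 4), (Fin.natAdd 4 (i + 2) : Fin 7) ≠ Fin.castAdd 3 j := by
    decide
  have h5 : ∀ (i j : Fin 3), (Fin.castAdd 4 i : Fin 7) ∉
      ({3, Fin.natAdd 4 j} : Finset (Fin 7)) := by decide
  have h6 : ∀ j : Fin 3, (3 : Fin 7) ≠ Fin.natAdd 4 j := by decide
  simp only [Fintype.sum_sum_type, Fintype.sum_prod_type, twoTreeTriple, Sum.elim_inl, Sum.elim_inr,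
    Finset.prod_insert (h1 _ _), Finset.prod_insert (h3 _ _), Finset.prod_insert (h5 _ _),
    Finset.prod_pair (h2 _ _), Finset.prod_pair (h4 _ _), Finset.prod_pair (h6 _)]

theorem sum_sum_mul {R ι κ : Type*} [CommRing R] [Fintype ι] [Fintype κ] (s : ι × κ → R)
    (a p q : ι → R) (y : κ → R) (h : ∀ i j, s (i, j) = a i) :
    ∑ i, ∑ j, s (i, j) * (p i * (q i * y j)) = (∑ i, a i * (p i * q i)) * ∑ j, y j := by
  rw [Finset.sum_mul_sum]
  refine Finset.sum_congr rfl fun i _ => Finset.sum_congr rfl fun j _ => ?_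
  rw [h i j]
  ring

/-- Masses of one chain contribute to its own quadratic form and to the mixed coefficients. The
polynomial `φ` has no `z²` term, so there is no `z³`, and every `z² uᵢ` and `z² vⱼ` has the same
coefficient `m²`. -/
theorem symanzik_identity {R : Type*} [CommRing R] (u v μ ν : Fin 3 → R) (z m p q : R)
    (s : Fin 3 → Fin 3 → R) :
    (∑ i, μ i ^ 2 * u i + m ^ 2 * z + ∑ i, ν i ^ 2 * v i) *
        (lin u * lin v + lin u * z + z * lin v) +
      (p * (z + lin v) + q * (lin u + z) + z * ∑ i, ∑ j, s i j * (u i * v j)) =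
    ((∑ i, ν i ^ 2 * v i) * lin v + q) * (lin u + z) +
      ((∑ i, μ i ^ 2 * u i) * lin u + p) * (z + lin v) +
      z * (∑ i, ∑ j, (m ^ 2 + μ i ^ 2 + ν j ^ 2 + s i j) * (u i * v j) +
        z * ∑ i, m ^ 2 * u i + z * ∑ i, m ^ 2 * v i) := by
  simp only [Fin.sum_univ_three, lin]
  ring

/-- The massive second Symanzik polynomial of the double box graph is a cubic form `Ψ₃,₁,₃`. -/
theorem massiveSymanzik_eq (m : Fin 7 → ℂ) (hw : ∑ v, w v = 0) : massiveSymanzik m w =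
    (CubicForm.ofParams (fun _ => ()) (fun _ => ()) (symanzikParams m w)).poly := by
  have hm : ∑ i : Fin 7, MvPolynomial.C (m i ^ 2) * x i =
      ∑ i : Fin 3, MvPolynomial.C (m (Fin.castAdd 4 i)) ^ 2 * xU i +
        MvPolynomial.C (m 3) ^ 2 * x 3 +
        ∑ i : Fin 3, MvPolynomial.C (m (Fin.natAdd 4 i)) ^ 2 * xV i := by
    simp only [Fin.sum_univ_seven, Fin.sum_univ_three, map_pow, ← add_assoc]
    rfl
  have hA : ∀ i j, splitSq w (.inl (i, j)) = splitSq w (.inl (i, 0)) := fun _ _ => rfl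
  have hB : ∀ i j, splitSq w (.inr (.inl (i, j))) = splitSq w (.inr (.inl (i, 0))) := fun _ _ => rfl
  have hV : ∑ j : Fin 4, x (Fin.natAdd 3 j) = x 3 + lin xV := by
    simp only [Fin.sum_univ_four, lin, ← add_assoc]
    rfl
  have hU : ∑ j : Fin 4, x (Fin.castAdd 3 j) = lin xU + x 3 := by
    simp only [Fin.sum_univ_four, lin]
    rfl
  have hψ : masslessSymanzik w =
      (∑ i : Fin 3, MvPolynomial.C (splitSq w (.inl (i, 0))) * (xU (i + 1) * xU (i + 2))) *
          (x 3 + lin xV) +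
        (∑ i : Fin 3, MvPolynomial.C (splitSq w (.inr (.inl (i, 0)))) *
          (xV (i + 1) * xV (i + 2))) * (lin xU + x 3) +
        x 3 * ∑ i : Fin 3, ∑ j : Fin 3, MvPolynomial.C (splitSq w (.inr (.inr (i, j)))) *
          (xU i * xV j) := by
    rw [masslessSymanzik_eq hw, sum_twoTreeTriple, ← hU, ← hV]
    rw [sum_sum_mul (fun p => MvPolynomial.C (splitSq w (.inl p)))
        (fun i => MvPolynomial.C (splitSq w (.inl (i, 0)))) (fun i => xU (i + 1))
        (fun i => xU (i + 2)) (fun j => x (Fin.natAdd 3 j)) fun i j => congrArg _ (hA i j),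
      sum_sum_mul (fun p => MvPolynomial.C (splitSq w (.inr (.inl p))))
        (fun i => MvPolynomial.C (splitSq w (.inr (.inl (i, 0))))) (fun i => xV (i + 1))
        (fun i => xV (i + 2)) (fun j => x (Fin.castAdd 3 j)) fun i j => congrArg _ (hB i j),
      add_assoc]
    refine congrArg₂ _ rfl (congrArg₂ _ rfl ?_)
    simp only [Finset.mul_sum]
    exact Finset.sum_congr rfl fun i _ => Finset.sum_congr rfl fun j _ => by ring
  have ha : ⇑MvPolynomial.C ∘ (CubicForm.ofParams (fun _ => ()) (fun _ => ()) (symanzikParams m w)).a =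
      chainForm (fun k => MvPolynomial.C (m (Fin.natAdd 4 k)))
        (fun k => (MvPolynomial.C (splitSq w (.inr (.inl (k, 0)))) : MvPolynomial (Fin 7) ℂ)) :=
    funext fun k => map_chainForm MvPolynomial.C (fun k => m (Fin.natAdd 4 k))
      (fun k => splitSq w (.inr (.inl (k, 0)))) k
  have hb : ⇑MvPolynomial.C ∘ (CubicForm.ofParams (fun _ => ()) (fun _ => ()) (symanzikParams m w)).b =
      chainForm (fun k => MvPolynomial.C (m (Fin.castAdd 4 k)))
        (fun k => (MvPolynomial.C (splitSq w (.inl (k, 0))) : MvPolynomial (Fin 7) ℂ)) :=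
    funext fun k => map_chainForm MvPolynomial.C (fun k => m (Fin.castAdd 4 k))
      (fun k => splitSq w (.inl (k, 0))) k
  rw [massiveSymanzik, hψ, hm, firstSymanzik_eq, sum_treePair, CubicForm.poly, CubicForm.psi,
    CubicForm.map_a, CubicForm.map_b, ha, hb, quad_chainForm, quad_chainForm]
  simp only [CubicForm.bil, CubicForm.map_M, CubicForm.map_α, CubicForm.map_β, CubicForm.ofParams,
    symanzikParams, Sum.elim_inl, Sum.elim_inr, Function.comp_apply, map_add, map_pow]
  exact symanzik_identity _ _ _ _ _ _ _ _ (fun i j => MvPolynomial.C (splitSq w (.inr (.inr (i, j)))))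

/-! ### All parameters occur -/

/-- A symmetric bilinear form has an orthogonal basis, and the diagonal entries, zero or not, have
complex square roots. -/
theorem exists_sum_mul_eq {n : ℕ} (S : Matrix (Fin n) (Fin n) ℂ) (hS : S.IsSymm) :
    ∃ b : Fin n → Fin n → ℂ, ∀ i j, ∑ k, b i k * b j k = S i j := by
  have hsymm : LinearMap.IsSymm (Matrix.toBilin' S) := by
    refine ⟨fun x y => ?_⟩
    simp only [Matrix.toBilin'_apply, RingHom.id_apply]
    rw [Finset.sum_comm]
    refine Finset.sum_congr rfl fun i _ => Finset.sum_congr rfl fun j _ => ?_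
    rw [hS.apply i j]
    ring
  obtain ⟨v, hv⟩ := LinearMap.BilinForm.exists_orthogonal_basis hsymm
  have hd : Module.finrank ℂ (Fin n → ℂ) = n := by simp
  obtain ⟨v, hv⟩ : ∃ v : Module.Basis (Fin n) ℂ (Fin n → ℂ), (Matrix.toBilin' S).IsOrthoᵢ v := by
    refine ⟨v.reindex (finCongr hd), fun i j hij => ?_⟩
    rw [Function.onFun, Module.Basis.reindex_apply, Module.Basis.reindex_apply]
    exact hv fun h => hij ((finCongr hd).symm.injective h)
  choose c hc using fun k => IsAlgClosed.exists_eq_mul_self (Matrix.toBilin' S (v k) (v k))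
  refine ⟨fun i k => c k * v.repr (Pi.single i 1) k, fun i j => ?_⟩
  rw [← Matrix.toBilin'_single S i j,
    ← LinearMap.sum_repr_mul_repr_mul v v (B := Matrix.toBilin' S) (Pi.single i 1) (Pi.single j 1)]
  rw [Finsupp.sum_fintype _ _ (by simp)]
  refine Finset.sum_congr rfl fun k _ => ?_
  rw [Finsupp.sum_fintype _ _ (by simp), Finset.sum_eq_single k]
  · rw [hc k]
    simp only [smul_eq_mul]
    ring
  · intro l _ hl
    rw [hv hl.symm, smul_zero, smul_zero]
  · simp

theorem exists_fin_sum_mul_eq {n D : ℕ} (hD : n ≤ D) (S : Matrix (Fin n) (Fin n) ℂ)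
    (hS : S.IsSymm) : ∃ b : Fin n → Fin D → ℂ, ∀ i j, ∑ d, b i d * b j d = S i j := by
  obtain ⟨b, hb⟩ := exists_sum_mul_eq S hS
  obtain ⟨k, rfl⟩ := Nat.exists_eq_add_of_le hD
  refine ⟨fun i => Fin.append (b i) 0, fun i j => ?_⟩
  simp [Fin.sum_univ_add, hb]

theorem splitSq_eq_sum {D : ℕ} {w : Fin 6 → Fin D → ℂ} {S : Fin 6 → Fin 6 → ℂ}
    (h : ∀ i j, i ≠ 1 → j ≠ 1 → ∑ d, w i d * w j d = S i j) (k) :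
    splitSq w k = ∑ i ∈ splitVertices k, ∑ j ∈ splitVertices k, S i j := by
  have h1 : ∀ k, ∀ v ∈ splitVertices k, v ≠ 1 := by decide +kernel
  simp only [splitSq, sq, Finset.sum_mul_sum]
  rw [Finset.sum_comm]
  refine Finset.sum_congr rfl fun i hi => ?_
  rw [Finset.sum_comm]
  exact Finset.sum_congr rfl fun j hj => h i j (h1 k i hi) (h1 k j hj)

/-- The fifteen prescribed squares correspond to the fifteen entries of the Gram matrix of the
momenta at the five vertices other than `1`. That matrix can be prescribed freely because `D ≥ 5`.
-/
theorem exists_splitSq_eq {D : ℕ} (hD : 5 ≤ D) (p q : Fin 3 → ℂ) (s : Fin 3 → Fin 3 → ℂ) :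
    ∃ w : Fin 6 → Fin D → ℂ, ∑ v, w v = 0 ∧ (∀ k, splitSq w (.inl (k, 0)) = p k) ∧
      (∀ k, splitSq w (.inr (.inl (k, 0))) = q k) ∧
      ∀ i j, splitSq w (.inr (.inr (i, j))) = s i j := by
  -- Scalar products of the momenta at the vertices `0, 2, 3, 4, 5`, numbered `0` to `4` in the
  -- names, obtained by polarization.
  let g01 := (s 1 0 - s 0 0 - p 2) / 2
  let g02 := (s 2 0 - s 1 0 - p 1 + p 2) / 2
  let g03 := (s 0 1 - s 0 0 - q 2) / 2
  let g04 := (s 0 2 - s 0 1 - q 1 + q 2) / 2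
  let g12 := (p 1 - p 0 - p 2) / 2
  let g13 := (s 1 1 - s 1 0 - s 0 1 + s 0 0) / 2
  let g14 := (s 1 2 - s 1 1 - s 0 2 + s 0 1) / 2
  let g23 := (s 2 1 - s 1 1 - s 2 0 + s 1 0) / 2
  let g24 := (s 2 2 - s 2 1 - s 1 2 + s 1 1) / 2
  let g34 := (q 1 - q 0 - q 2) / 2
  -- The zero row and column belong to the vertex `1` and are placeholders that get deleted.
  let S : Matrix (Fin 6) (Fin 6) ℂ :=
    !![s 0 0, 0, g01, g02, g03, g04;
       0, 0, 0, 0, 0, 0;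
       g01, 0, p 2, g12, g13, g14;
       g02, 0, g12, p 0, g23, g24;
       g03, 0, g13, g23, q 2, g34;
       g04, 0, g14, g24, g34, q 0]
  have hS : S.IsSymm := by
    ext i j
    fin_cases i <;> fin_cases j <;> rfl
  obtain ⟨b, hb⟩ := exists_fin_sum_mul_eq hD (S.submatrix (Fin.succAbove 1) (Fin.succAbove 1))
    (hS.submatrix _)
  let w : Fin 6 → Fin D → ℂ := Fin.insertNth 1 (-∑ i, b i) b
  have hw : ∑ v, w v = 0 := by
    rw [Fin.sum_univ_succAbove _ 1]
    simp [w]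
  have hG : ∀ i j, i ≠ 1 → j ≠ 1 → ∑ d, w i d * w j d = S i j := by
    intro i j hi hj
    obtain ⟨i, rfl⟩ := Fin.exists_succAbove_eq hi
    obtain ⟨j, rfl⟩ := Fin.exists_succAbove_eq hj
    simpa [w] using hb i j
  refine ⟨w, hw, fun k => ?_, fun k => ?_, fun i j => ?_⟩
  · rw [splitSq_eq_sum hG]
    fin_cases k
    · simp [splitVertices, S]
    · simp [splitVertices, S, g12]
      ring
    · simp [splitVertices, S]
  · rw [splitSq_eq_sum hG]
    fin_cases k
    · simp [splitVertices, S]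
    · simp [splitVertices, S, g34]
      ring
    · simp [splitVertices, S]
  · have hsplit : ∀ i j : Fin 3, splitVertices (.inr (.inr (i, j))) =
        (![![{0}, {0, 4}, {0, 4, 5}], ![{0, 2}, {0, 2, 4}, {0, 2, 4, 5}],
          ![{0, 2, 3}, {0, 2, 3, 4}, {0, 2, 3, 4, 5}]] :
            Fin 3 → Fin 3 → Finset (Fin 6)) i j := by decide +kernel
    rw [splitSq_eq_sum hG, hsplit]
    fin_cases i <;> fin_cases j <;>
    · simp [S, g01, g02, g03, g04, g12, g13, g14, g23, g24, g34]
      try ring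

/-- All values of the parameters of the second Symanzik polynomial occur. -/
theorem exists_symanzikParams_eq {D : ℕ} (hD : 5 ≤ D) (t : FormIndex ⊕ Unit → ℂ) :
    ∃ (m : Fin 7 → ℂ) (w : Fin 6 → Fin D → ℂ), ∑ v, w v = 0 ∧ symanzikParams m w = t := by
  choose r hr using fun z : ℂ => IsAlgClosed.exists_pow_nat_eq z two_pos
  let a : Fin 6 → ℂ := fun k => t (.inl (.inl k))
  let b : Fin 6 → ℂ := fun k => t (.inl (.inr (.inl k)))
  let M : Fin 3 → Fin 3 → ℂ := fun i j => t (.inl (.inr (.inr (i, j))))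
  let μ : ℂ := t (.inr ())
  -- Masses are square roots of the coefficients of the squares; the momenta then have to supply
  -- what the masses leave of the other coefficients.
  obtain ⟨w, hw, h1, h2, h3⟩ := exists_splitSq_eq hD
    ![b 4 - b 3 - b 5, b 2 - b 0 - b 5, b 1 - b 0 - b 3]
    ![a 4 - a 3 - a 5, a 2 - a 0 - a 5, a 1 - a 0 - a 3]
    fun i j => M i j - μ - b (sqIndex i) - a (sqIndex j)
  refine ⟨![r (b 0), r (b 3), r (b 5), r μ, r (a 0), r (a 3), r (a 5)], w, hw, ?_⟩
  funext k
  rcases k with (k | k | ⟨i, j⟩) | _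
  · simp only [symanzikParams, Sum.elim_inl, h2]
    fin_cases k <;> simp [chainForm, hr, a]
  · simp only [symanzikParams, Sum.elim_inl, Sum.elim_inr, h1]
    fin_cases k <;> simp [chainForm, hr, b]
  · simp only [symanzikParams, Sum.elim_inl, Sum.elim_inr, h3]
    fin_cases i <;> fin_cases j <;> simp [hr, a, b, M, μ, sqIndex]
  · simp [symanzikParams, hr, μ]

/-! ### Generic coefficients and generic kinematics -/

/-- The coefficient with a given position in a cubic form. -/
abbrev coeffIndex : FormIndex ⊕ (Fin 3 ⊕ Fin 3) → CoeffIndex :=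
  Sum.elim
    (Sum.elim (fun k => .inl (quadIndex k))
      (Sum.elim (fun k => .inr (.inl (quadIndex k))) (fun p => .inr (.inr (bilinIndex (.inl p))))))
    (fun k => .inr (.inr (bilinIndex (.inr k))))

theorem coeffIndex_bijective : Function.Bijective coeffIndex := by
  decide +kernel

theorem ofCoeff_eq_ofParams (c : CoeffIndex → ℂ) :
    ofCoeff c = CubicForm.ofParams Sum.inl Sum.inr (c ∘ coeffIndex) := rfl

theorem exists_ofCoeff_eq (d : CubicForm ℂ) : ∃ c, ofCoeff c = d := by
  let t : FormIndex ⊕ (Fin 3 ⊕ Fin 3) → ℂ :=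
    Sum.elim (Sum.elim d.a (Sum.elim d.b fun p => d.M p.1 p.2)) (Sum.elim d.α d.β)
  let e := Equiv.ofBijective _ coeffIndex_bijective
  refine ⟨t ∘ e.symm, ?_⟩
  have h : (t ∘ e.symm) ∘ coeffIndex = t := funext fun k => congrArg t (e.symm_apply_apply k)
  rw [ofCoeff_eq_ofParams, h]
  rfl

theorem exists_ne_zero_strictTransformIsSmoothDivisor :
    ∃ G : MvPolynomial CoeffIndex ℂ, G ≠ 0 ∧ ∀ c, MvPolynomial.eval c G ≠ 0 →
      StrictTransformIsSmoothDivisor c := by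
  obtain ⟨G, hG, h⟩ := exists_ne_zero_isGenericSide_ofParams
    (Sum.inl : Fin 3 → Fin 3 ⊕ Fin 3) Sum.inr
  -- The extra factor is the first entry of `α`, which secures smoothness at the point `u = v = 0`.
  refine ⟨MvPolynomial.rename coeffIndex (G * MvPolynomial.X (.inr (.inl 0))), ?_, fun c hc => ?_⟩
  · rw [Ne, map_eq_zero_iff _ (MvPolynomial.rename_injective _ coeffIndex_bijective.injective)]
    exact mul_ne_zero hG (MvPolynomial.X_ne_zero _)
  · rw [MvPolynomial.eval_rename, map_mul, MvPolynomial.eval_X] at hc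
    have h1 := h _ (left_ne_zero_of_mul hc)
    refine strictTransformIsSmoothDivisor_of_isGeneric c ⟨h1.1, h1.2, Or.inl fun h0 => ?_⟩
    exact right_ne_zero_of_mul hc (congrFun h0 0)

theorem exists_kinematics_strictTransformIsSmoothDivisor {D : ℕ} (hD : 5 ≤ D) :
    ∃ G : MvPolynomial (Fin 7 ⊕ Fin 6 × Fin D) ℂ,
      (∃ (m : Fin 7 → ℂ) (w : Fin 6 → Fin D → ℂ), ∑ v, w v = 0 ∧
        MvPolynomial.eval (kinematics m w) G ≠ 0) ∧
      ∀ (m : Fin 7 → ℂ) (w : Fin 6 → Fin D → ℂ), ∑ v, w v = 0 →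
        MvPolynomial.eval (kinematics m w) G ≠ 0 →
          ∃ c : CoeffIndex → ℂ, massiveSymanzik m w = Psi c ∧ StrictTransformIsSmoothDivisor c := by
  obtain ⟨G, hG, h⟩ := exists_ne_zero_isGenericSide_ofParams
    (fun _ => () : Fin 3 → Unit) (fun _ => ())
  let Φ : FormIndex ⊕ Unit → MvPolynomial (Fin 7 ⊕ Fin 6 × Fin D) ℂ :=
    symanzikParams (fun i => MvPolynomial.X (.inl i)) (fun v d => MvPolynomial.X (.inr (v, d)))
  have hΦ : ∀ (m : Fin 7 → ℂ) (w : Fin 6 → Fin D → ℂ) (P : MvPolynomial (FormIndex ⊕ Unit) ℂ),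
      MvPolynomial.eval (kinematics m w) (MvPolynomial.bind₁ Φ P) =
        MvPolynomial.eval (symanzikParams m w) P := by
    intro m w P
    rw [MvPolynomial.eval, MvPolynomial.eval₂Hom_bind₁]
    have : (fun i => MvPolynomial.eval₂Hom (RingHom.id ℂ) (kinematics m w) (Φ i)) =
        symanzikParams m w := by
      funext i
      rw [map_symanzikParams]
      congr 1 <;> simp [Function.comp_def, kinematics]
    rw [this]
    rfl
  -- Here the extra factor is `m₄²`, the common value of all entries of `α` and `β`. Nonvanishing
  -- somewhere follows from surjectivity of the parameter map.
  refine ⟨MvPolynomial.bind₁ Φ (G * MvPolynomial.X (.inr ())), ?_, fun m w hw hc => ?_⟩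
  · have h0 : G * MvPolynomial.X (.inr ()) ≠ 0 := mul_ne_zero hG (MvPolynomial.X_ne_zero _)
    obtain ⟨t, ht⟩ : ∃ t, MvPolynomial.eval t (G * MvPolynomial.X (.inr ())) ≠ 0 := by
      by_contra! hc
      exact h0 (MvPolynomial.funext fun t => (hc t).trans (map_zero _).symm)
    obtain ⟨m, w, hw, rfl⟩ := exists_symanzikParams_eq hD t
    exact ⟨m, w, hw, by rwa [hΦ]⟩
  · rw [hΦ, map_mul, MvPolynomial.eval_X] at hc
    have h1 := h _ (left_ne_zero_of_mul hc)
    obtain ⟨c, h2⟩ := exists_ofCoeff_eq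
      (CubicForm.ofParams (fun _ => ()) (fun _ => ()) (symanzikParams m w))
    refine ⟨c, ?_, ?_⟩
    · rw [massiveSymanzik_eq m hw, Psi_eq, h2]
    · refine strictTransformIsSmoothDivisor_of_isGeneric c ?_
      rw [h2]
      exact ⟨h1.1, h1.2, Or.inl fun h0 => right_ne_zero_of_mul hc (congrFun h0 0)⟩

end DoubleBox

end

theorem mainTheorem7 :
    (∃ G : MvPolynomial DoubleBox.CoeffIndex ℂ, G ≠ 0 ∧
      ∀ c : DoubleBox.CoeffIndex → ℂ, MvPolynomial.eval c G ≠ 0 →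
        DoubleBox.StrictTransformIsSmoothDivisor c) ∧
    (∀ D : ℕ, 5 ≤ D → ∃ G : MvPolynomial (Fin 7 ⊕ Fin 6 × Fin D) ℂ,
      (∃ (m : Fin 7 → ℂ) (w : Fin 6 → Fin D → ℂ), ∑ v, w v = 0 ∧
        MvPolynomial.eval (DoubleBox.kinematics m w) G ≠ 0) ∧
      ∀ (m : Fin 7 → ℂ) (w : Fin 6 → Fin D → ℂ), ∑ v, w v = 0 →
        MvPolynomial.eval (DoubleBox.kinematics m w) G ≠ 0 →
          ∃ c : DoubleBox.CoeffIndex → ℂ, DoubleBox.massiveSymanzik m w = DoubleBox.Psi c ∧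
            DoubleBox.StrictTransformIsSmoothDivisor c) := by
  exact ⟨DoubleBox.exists_ne_zero_strictTransformIsSmoothDivisor, fun _ hD =>
    DoubleBox.exists_kinematics_strictTransformIsSmoothDivisor hD⟩
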